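/- \textbf{Setting.} Let $L$ be a finite-dimensional semisimple complex Lie algebra with Cartan subalgebra $H$, root system $\Phi$ and Weyl group $W$, let $X_\alpha$ ($\alpha\in\Phi$) be the root vectors of a Chevalley basis, and let $\rho$ be a faithful $n$-dimensional representation of $L$. Let $G\subset \mathrm{GL}_n(\mathbb C)$ be the (semisimple complex) Chevalley group generated by the elements $x_\alpha(t)=\exp(t\rho(X_\alpha))$, $t\in\mathbb C$. Put $w_\alpha(t)=x_\alpha(t)x_{-\alpha}(-t^{-1})x_\alpha(t)$, $\omega_\alpha=w_\alpha(1)$, $h_\alpha(t)=w_\alpha(t)\omega_\alpha^{-1}$, and let $T$ be the torus generated by all $h_\alpha(t)$. Let $\sigma$ be the automorphism of $G$ with $\sigma(x_\alpha(t))=x_{-\alpha}(-\bar t)$, let $C=G^\sigma$ and $K=T^\sigma$ be the groups of its fixed points in $G$ and in $T$. Let $\mathcal N$ be the group generated by $K$ and all $\omega_\alpha$; identify $W$ with $\mathcal N/K$ by $s_\alpha\mapsto\omega_\alpha K$, write $wK\subset\mathcal N$ for the coset of $w\in W$, and choose representatives $\dot w\in wK$. Let $\phi_\alpha:\mathrm{SL}_2(\mathbb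 C)\to G$ be the homomorphism with $\begin{pmatrix}1&t\\0&1\end{pmatrix}\mapsto x_\alpha(t)$, $\begin{pmatrix}1&0\\t&1\end{pmatrix}\mapsto x_{-\alpha}(t)$, and put $C_{s_\alpha}=\phi_\alpha(\mathrm{SU}_2)K$. Let $I$ be a finite totally ordered set and $s=(s_i)_{i\in I}$ a sequence of reflections $s_i\in\{s_\alpha:\alpha\in\Phi\}$. Let $C(s)=\prod_{i\in I}C_{s_i}$ and let $\mathrm{BS}_c(s)=C(s)/K^I$ be the space of orbits $[c]$ of the right action $(ck)_i=k_{i-1}^{-1}c_ik_i$, where $i-1$ is the element preceding $i$ and $k_{-\infty}=1$. A nested structure on $I$ is a set $R\subset I^2$ of pairs $r=(r_1,r_2)$ with $r_1\le r_2$ such that for any two distinct $r,r'\in R$ the sets $\{r_1,r_2\}$ and $\{r_1',r_2'\}$ are disjoint, and the intervals $[r]=[r_1,r_2]$ and $[r']$ are disjoint or one of them contains the other. For $v:R\to W$, let $C(s,v)$ be the set of $c\in C(s)$ with $c_{r_1}c_{r_1+1}\cdots c_{r_2}\in v_rK$ for all $r\in R$, and let $\mathrm{BS}_c(s,v)\subset\mathrm{BS}_c(s)$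 be its image, with the subspace topology. Let $F=\{f^1,\dots,f^q\}\subset R$ be a set of pairs whose intervals are pairwise disjoint, written in increasing order. Put $I^F=I\setminus\bigcup_{f\in F}[f]$ and $R^F=\{r\in R: [r]\not\subset[f]\text{ for all }f\in F\}$. For $i\in I^F$, put $v^i=v_{f^1}\cdots v_{f^m}$ and $\dot v^i=\dot v_{f^1}\cdots\dot v_{f^m}$, where $f^1,\dots,f^m$ are the elements of $F$ with $f_2<i$. Let $s^F_i=v^is_i(v^i)^{-1}$ for $i\in I^F$ and $v^F_r=v^{r_1}v_r(v^{r_2})^{-1}$ for $r\in R^F$. For $f\in F$, let $s_f$ be the restriction of $s$ to $[f]$ and $v_f$ the restriction of $v$ to $R_f=\{r\in R:[r]\subset[f]\}$. \textbf{Theorem.} $R^F$ is a nested structure on $I^F$ and $s^F$ is a sequence of reflections. Every point of $\mathrm{BS}_c(s,v)$ is of the form $[c]$ for some $c\in C(s,v)$ that is $F$-balanced, that is, $c_{f_1}c_{f_1+1}\cdots c_{f_2}=\dot v_f$ for all $f\in F$. There is a unique map (the projection along $F$) $$p^F:\mathrm{BS}_c(s,v)\to\mathrm{BS}_c(s^F,v^F),\qquad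 p^F([c])=[c^F]\ \text{ for all $F$-balanced } c\in C(s,v),\quad\text{where } c^F_i=\dot v^ic_i(\dot v^i)^{-1}\ (i\in I^F),$$ and $p^F$ is a locally trivial fibre bundle with fibre $\mathrm{BS}_c(s_{f^1},v_{f^1})\times\dots\times\mathrm{BS}_c(s_{f^q},v_{f^q})$. -/

import Mathlib

open scoped Matrix

noncomputable section

namespace BottSamelson

/-! ### Generalities -/

/-- The product of the elements `g j`, `j ∈ S`, of a monoid, taken in the increasing order of `j`. -/
def orderedProd {J M : Type*} [LinearOrder J] [Finite J] [Monoid M] (S : Set J) (g : J → M) : M :=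
  ((S.toFinite.toFinset.sort (· ≤ ·)).map g).prod

/-- The graph of the homomorphism from (a subgroup of) `A` to `B` that is prescribed on generators:
`S` is the set of the pairs (generator, prescribed value), and the graph is the subgroup
generated by `S`. -/
def homGraph {A B : Type*} [Group A] [Group B] (S : Set (A × B)) : Subgroup (A × B) :=
  Subgroup.closure S

/-! ### Chevalley groups and their compact subgroups -/

section Chevalley

variable {L : Type*} [LieRing L] [LieAlgebra ℂ L] [FiniteDimensional ℂ L]
  [LieAlgebra.IsKilling ℂ L] (H : LieSubalgebra ℂ L) [H.IsCartanSubalgebra]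

/-- The root system `Φ`. Its index type is `H.root`, the finite set of nonzero weights of `H`. -/
abbrev Phi := LieAlgebra.IsKilling.rootSystem H

/-- The Weyl group `W`. -/
abbrev Weyl := (Phi H).weylGroup

variable {H}

/-- The root `-α`. -/
def negRoot (α : H.root) : H.root :=
  ⟨-α.1, Finset.mem_filter.mpr ⟨Finset.mem_univ _,
    LieModule.Weight.IsNonZero.neg (Finset.mem_filter.mp α.2).2⟩⟩

/-- The reflection `s_α` as an element of the Weyl group. -/
def refl (α : H.root) : Weyl H := RootPairing.weylGroup.ofIdx (Phi H) α

/-- `w` is one of the reflections `s_α`, `α ∈ Φ`. -/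
def IsReflection (w : Weyl H) : Prop := ∃ α : H.root, refl α = w

variable (H)

/-- The data from which a semisimple complex Chevalley group of matrices is built: root vectors
`X_α` of a Chevalley basis of the semisimple Lie algebra `L` with Cartan subalgebra `H`,
and a faithful representation `ρ` of `L` of finite dimension `n`. -/
structure ChevalleyData (n : ℕ) where
  X : H.root → L
  X_mem : ∀ α, X α ∈ LieAlgebra.rootSpace H α.1
  lie_X_neg : ∀ α, ⁅X α, X (negRoot α)⁆ = (LieAlgebra.IsKilling.coroot α.1 : L)
  lie_X_X : ∀ α β γ : H.root, (γ.1 : H → ℂ) = α.1 + β.1 →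
    ∃ N : ℂ, ⁅X α, X β⁆ = N • X γ ∧ ⁅X (negRoot α), X (negRoot β)⁆ = (-N) • X (negRoot γ)
  ρ : L →ₗ[ℂ] Matrix (Fin n) (Fin n) ℂ
  ρ_lie : ∀ a b, ρ ⁅a, b⁆ = ρ a * ρ b - ρ b * ρ a
  ρ_injective : Function.Injective ρ

variable {H}

namespace ChevalleyData

variable {n : ℕ} (D : ChevalleyData H n)

/-- The root element `x_α(t) = exp (t X_α)`. -/
def x (α : H.root) (t : ℂ) : GL (Fin n) ℂ :=
  (Matrix.isUnit_exp (t • D.ρ (D.X α))).unit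

/-- The Chevalley group `G`, generated by the root elements. -/
def G : Subgroup (GL (Fin n) ℂ) := Subgroup.closure {g | ∃ α t, g = D.x α t}

/-- `w_α(t) = x_α(t) x_{-α}(-t⁻¹) x_α(t)`. -/
def w (α : H.root) (t : ℂˣ) : GL (Fin n) ℂ :=
  D.x α t * D.x (negRoot α) (-(t : ℂ)⁻¹) * D.x α t

/-- `ω_α = w_α(1)`. -/
def omega (α : H.root) : GL (Fin n) ℂ := D.w α 1

/-- `h_α(t) = w_α(t) ω_α⁻¹`. -/
def h (α : H.root) (t : ℂˣ) : GL (Fin n) ℂ := D.w α t * (D.omega α)⁻¹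

/-- The maximal torus `T`, generated by the elements `h_α(t)`. -/
def T : Subgroup (GL (Fin n) ℂ) := Subgroup.closure {g | ∃ α t, g = D.h α t}

/-- The graph of the automorphism `σ` of `G` with `σ (x_α(t)) = x_{-α}(-t̄)`. -/
def sigmaGraph : Subgroup (GL (Fin n) ℂ × GL (Fin n) ℂ) :=
  homGraph {p | ∃ α t, p = (D.x α t, D.x (negRoot α) (-(starRingEnd ℂ t)))}

/-- The maximal compact subgroup `C = G_σ` of the fixed points of `σ` in `G`. -/
def C : Subgroup (GL (Fin n) ℂ) where
  carrier := {g | g ∈ D.G ∧ (g, g) ∈ D.sigmaGraph}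
  mul_mem' ha hb := ⟨mul_mem ha.1 hb.1, mul_mem ha.2 hb.2⟩
  one_mem' := ⟨one_mem _, one_mem _⟩
  inv_mem' ha := ⟨inv_mem ha.1, inv_mem ha.2⟩

/-- The compact torus `K = T_σ`. -/
def K : Subgroup (GL (Fin n) ℂ) := D.T ⊓ D.C

/-- The graph of the homomorphism `φ_α : SL₂(ℂ) → G` that sends the upper unitriangular matrix
with entry `t` to `x_α(t)` and the lower one to `x_{-α}(t)`. -/
def phiGraph (α : H.root) : Subgroup (Matrix.SpecialLinearGroup (Fin 2) ℂ × GL (Fin n) ℂ) :=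
  homGraph {p | ∃ t : ℂ,
    ((p.1 : Matrix (Fin 2) (Fin 2) ℂ) = !![1, t; 0, 1] ∧ p.2 = D.x α t) ∨
    ((p.1 : Matrix (Fin 2) (Fin 2) ℂ) = !![1, 0; t, 1] ∧ p.2 = D.x (negRoot α) t)}

/-- `φ_α(SU₂)`. -/
def phiSU (α : H.root) : Set (GL (Fin n) ℂ) :=
  {g | ∃ M : Matrix.SpecialLinearGroup (Fin 2) ℂ,
    (M : Matrix (Fin 2) (Fin 2) ℂ) ∈ Matrix.unitaryGroup (Fin 2) ℂ ∧ (M, g) ∈ D.phiGraph α}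

/-- `C_t = C_α = φ_α(SU₂) K` for a reflection `t = s_α`; here `α` is unique up to sign, and
`C_α = C_{-α}`. (Empty if `t` is not a reflection.) -/
def Crefl (t : Weyl H) : Set (GL (Fin n) ℂ) :=
  {g | ∃ α : H.root, refl α = t ∧ ∃ a ∈ D.phiSU α, ∃ k ∈ D.K, g = a * k}

/-- The graph of the homomorphism `𝒩 → W` with kernel `K` that sends `ω_α` to `s_α`, where `𝒩`
is generated by `K` and the elements `ω_α`; it consists of pairs (element of `W`, element of `𝒩`),
so it is also the relation `g ∈ φ(w)` for the isomorphism `φ : W ≅ 𝒩/K`, `s_α ↦ ω_α K`. -/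
def weylGraph : Subgroup (Weyl H × GL (Fin n) ℂ) :=
  homGraph ({p | ∃ α : H.root, p = (refl α, D.omega α)} ∪ {p | p.1 = 1 ∧ p.2 ∈ D.K})

/-- The coset `wK = φ(w) ∈ 𝒩/K`. -/
def coset (w : Weyl H) : Set (GL (Fin n) ℂ) := {g | (w, g) ∈ D.weylGraph}

/-! ### Compactly defined Bott–Samelson varieties -/

section BS

variable {I : Type*} [LinearOrder I] [Finite I]

/-- The element preceding `i` in `I ∪ {-∞}`. -/
def pred (i : I) : WithBot I := (Set.Iio i).toFinite.toFinset.max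

/-- The value `k_j` for `j ∈ I ∪ {-∞}`, where `k_{-∞} = 1`. -/
def extend {M : Type*} [One M] (k : I → M) : WithBot I → M := WithBot.recBotCoe 1 k

/-- The space `C(s) = ∏ C_{s_i}`. -/
abbrev CSeq (s : I → Weyl H) : Type _ := {c : I → GL (Fin n) ℂ // ∀ i, c i ∈ D.Crefl (s i)}

/-- The orbit relation of the right action `(ck)_i = k_{i-1}⁻¹ c_i k_i` of `K(I)` on `C(s)`. -/
def orbitSetoid (s : I → Weyl H) : Setoid (D.CSeq s) where
  r c d := ∃ k : I → GL (Fin n) ℂ, (∀ i, k i ∈ D.K) ∧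
    ∀ i, d.1 i = (extend k (pred i))⁻¹ * c.1 i * k i
  iseqv := by
    have e1 : ∀ j : WithBot I, extend (fun _ : I => (1 : GL (Fin n) ℂ)) j = 1 := by
      intro j; cases j <;> rfl
    have e2 : ∀ (k : I → GL (Fin n) ℂ) (j : WithBot I),
        extend (fun i => (k i)⁻¹) j = (extend k j)⁻¹ := by
      intro k j; cases j <;> simp [extend]
    have e3 : ∀ (k l : I → GL (Fin n) ℂ) (j : WithBot I),
        extend (fun i => k i * l i) j = extend k j * extend l j := by
      intro k l j; cases j <;> simp [extend]
    refine ⟨fun c => ⟨fun _ => 1, fun _ => one_mem _, fun i => by simp [e1]⟩, ?_, ?_⟩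
    · rintro c d ⟨k, hk, h⟩
      refine ⟨fun i => (k i)⁻¹, fun i => inv_mem (hk i), fun i => ?_⟩
      rw [e2, h i]; group
    · rintro c d e ⟨k, hk, h⟩ ⟨l, hl, h'⟩
      refine ⟨fun i => k i * l i, fun i => mul_mem (hk i) (hl i), fun i => ?_⟩
      rw [e3, h' i, h i]; group

/-- `BS_c(s) = C(s)/K(I)`, with the quotient topology. -/
abbrev BS (s : I → Weyl H) : Type _ := Quotient (D.orbitSetoid s)

/-- `C(s,v)`: the sequences `c ∈ C(s)` with `c_{r₁} c_{r₁+1} ⋯ c_{r₂} ∈ v_r K` for all `r ∈ R`. -/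
def CNested (s : I → Weyl H) {R : Set (I × I)} (v : R → Weyl H) : Set (D.CSeq s) :=
  {c | ∀ r : R, orderedProd (Set.Icc r.1.1 r.1.2) c.1 ∈ D.coset (v r)}

/-- `BS_c(s,v)`: the image of `C(s,v)` in `BS_c(s)`, with the subspace topology. -/
def BSNested (s : I → Weyl H) {R : Set (I × I)} (v : R → Weyl H) : Set (D.BS s) :=
  Quotient.mk (D.orbitSetoid s) '' D.CNested s v

end BS

end ChevalleyData

end Chevalley

/-! ### Nested structures -/

section Nested

variable {I : Type*} [LinearOrder I]

/-- `R` is a nested structure on `I`. -/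
structure IsNested (R : Set (I × I)) : Prop where
  le : ∀ r ∈ R, r.1 ≤ r.2
  endpoints : ∀ r ∈ R, ∀ r' ∈ R, r ≠ r' → Disjoint ({r.1, r.2} : Set I) {r'.1, r'.2}
  nested : ∀ r ∈ R, ∀ r' ∈ R, Disjoint (Set.Icc r.1 r.2) (Set.Icc r'.1 r'.2) ∨
    Set.Icc r.1 r.2 ⊆ Set.Icc r'.1 r'.2 ∨ Set.Icc r'.1 r'.2 ⊆ Set.Icc r.1 r.2

variable {R : Set (I × I)} (F : Set R)

/-- `I^F = I \ ⋃_{f ∈ F} [f]`. -/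
def compl : Set I := {i | ∀ f ∈ F, i ∉ Set.Icc f.1.1 f.1.2}

/-- `R^F`: the elements of `R` not contained in an element of `F`. Their end points lie in `I^F`
if `R` is a nested structure, so they are pairs of elements of `I^F`. -/
def RF : Set (compl F × compl F) :=
  {r | ((r.1 : I), (r.2 : I)) ∈ R ∧ ∀ f ∈ F, ¬ Set.Icc (r.1 : I) r.2 ⊆ Set.Icc f.1.1 f.1.2}

theorem mem_compl_of_not_subset (hR : IsNested R) (r : R)
    (hr : ∀ f ∈ F, ¬ Set.Icc r.1.1 r.1.2 ⊆ Set.Icc f.1.1 f.1.2) :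
    r.1.1 ∈ compl F ∧ r.1.2 ∈ compl F := by
  have hle := hR.le r.1 r.2
  have key : ∀ f ∈ F, ∀ i ∈ ({r.1.1, r.1.2} : Set I), i ∉ Set.Icc f.1.1 f.1.2 := by
    intro f hf i hi hif
    have hir : i ∈ Set.Icc r.1.1 r.1.2 := by
      rcases hi with rfl | rfl
      · exact ⟨le_rfl, hle⟩
      · exact ⟨hle, le_rfl⟩
    have hne : r.1 ≠ f.1 := fun h => hr f hf (by rw [h])
    have hd := Set.disjoint_left.mp (hR.endpoints r.1 r.2 f.1 f.2 hne) hi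
    have hfle := hR.le f.1 f.2
    rcases hR.nested r.1 r.2 f.1 f.2 with h | h | h
    · exact Set.disjoint_left.mp h hir hif
    · exact hr f hf h
    · have h1 := h ⟨le_rfl, hfle⟩
      have h2 := h ⟨hfle, le_rfl⟩
      rcases hi with rfl | rfl
      · exact hd (Or.inl (le_antisymm h1.1 hif.1))
      · exact hd (Or.inr (le_antisymm hif.2 h2.2))
  exact ⟨fun f hf => key f hf _ (Or.inl rfl), fun f hf => key f hf _ (Or.inr rfl)⟩

/-- The element of `R` underlying an element of `R^F`. -/
def RF.toR (r : RF F) : R := ⟨((r.1.1 : I), (r.1.2 : I)), r.2.1⟩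

/-- `R_f`: the elements of `R` contained in `f`, as pairs of elements of `[f]`. -/
def Rf (f : R) : Set (Set.Icc f.1.1 f.1.2 × Set.Icc f.1.1 f.1.2) :=
  {r | ((r.1 : I), (r.2 : I)) ∈ R}

/-- The element of `R` underlying an element of `R_f`. -/
def Rf.toR (f : R) (r : Rf f) : R := ⟨((r.1.1 : I), (r.1.2 : I)), r.2⟩

variable [Finite I]

/-- The product `u_{f¹} ⋯ u_{fᵐ}` over the elements `f¹ < ⋯ < fᵐ` of `F` with `f₂ < i`. These
intervals being pairwise disjoint, their order is the lexicographic order of the pairs. -/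
def prodBefore {M : Type*} [Monoid M] (u : R → M) (i : I) : M :=
  letI : LinearOrder R := LinearOrder.lift' (fun f : R => toLex f.1)
    (toLex.injective.comp Subtype.val_injective)
  orderedProd {f : R | f ∈ F ∧ f.1.2 < i} u

variable {W : Type*} [Group W]

/-- `s^F_i = v^i s_i (v^i)⁻¹` for `i ∈ I^F`. -/
def sF (s : I → W) (v : R → W) (i : compl F) : W :=
  prodBefore F v i * s i * (prodBefore F v i)⁻¹

/-- `v^F_r = v^{r₁} v_r (v^{r₂})⁻¹` for `r ∈ R^F`. -/
def vF (v : R → W) (r : RF F) : W :=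
  prodBefore F v r.1.1 * v (RF.toR F r) * (prodBefore F v r.1.2)⁻¹

/-- `s_f`: the restriction of `s` to `[f]`. -/
def sRes (s : I → W) (f : R) (i : Set.Icc f.1.1 f.1.2) : W := s i

/-- `v_f`: the restriction of `v` to `R_f`. -/
def vRes (v : R → W) (f : R) (r : Rf f) : W := v (Rf.toR f r)

end Nested

/-! ### The projection along `F` -/

namespace ChevalleyData

variable {L : Type*} [LieRing L] [LieAlgebra ℂ L] [FiniteDimensional ℂ L]
  [LieAlgebra.IsKilling ℂ L] {H : LieSubalgebra ℂ L} [H.IsCartanSubalgebra] {n : ℕ}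
  (D : ChevalleyData H n) {I : Type*} [LinearOrder I] [Finite I]

/-- `c` is `F`-balanced: `c_{f₁} c_{f₁+1} ⋯ c_{f₂} = v̇_f` for all `f ∈ F`, where `dot` is the
choice `w ↦ ẇ` of representatives. -/
def IsBalanced (dot : Weyl H → GL (Fin n) ℂ) {R : Set (I × I)} (F : Set R) (v : R → Weyl H)
    (c : I → GL (Fin n) ℂ) : Prop :=
  ∀ f ∈ F, orderedProd (Set.Icc f.1.1 f.1.2) c = dot (v f)

/-- `c^F_i = v̇^i c_i (v̇^i)⁻¹` for `i ∈ I^F`. -/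
def cF (dot : Weyl H → GL (Fin n) ℂ) {R : Set (I × I)} (F : Set R) (v : R → Weyl H)
    (c : I → GL (Fin n) ℂ) (i : compl F) : GL (Fin n) ℂ :=
  prodBefore F (fun f => dot (v f)) i * c i * (prodBefore F (fun f => dot (v f)) i)⁻¹

/-- The defining property of the projection `p^F : BS_c(s,v) → BS_c(s^F,v^F)` along `F`:
for every `F`-balanced `c ∈ C(s,v)`, the sequence `c^F` is in `C(s^F)` and `p^F([c]) = [c^F]`. -/
def IsProjectionAlong (dot : Weyl H → GL (Fin n) ℂ) (s : I → Weyl H) {R : Set (I × I)}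
    (F : Set R) (v : R → Weyl H)
    (p : D.BSNested s v → D.BSNested (sF F s v) (vF F v)) : Prop :=
  ∀ (c : D.CSeq s) (hc : c ∈ D.CNested s v), IsBalanced dot F v c.1 →
    ∃ hcF : ∀ i, cF dot F v c.1 i ∈ D.Crefl (sF F s v i),
      (p ⟨Quotient.mk (D.orbitSetoid s) c, c, hc, rfl⟩).1 =
        Quotient.mk (D.orbitSetoid (sF F s v)) ⟨cF dot F v c.1, hcF⟩

end ChevalleyData

end BottSamelson

end

/-!
The theorem has three ingredients: facts about the Chevalley group, the combinatorics of the index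
set, and a topological argument that combines them.

*The group.* Everything is deduced from the adjoint action `Ad g y = g y g⁻¹` on matrices. The
elements of `T` are the exponentials of the elements of `ρ(H)`, and `ω_α` permutes the root spaces
and the coroots like `s_α` (`ChevalleyData.acts_omega`). Modulo `T`, the `ω_α` are involutions with
`ω_α ω_β ω_α = ω_{s_α(β)}`; by the exchange argument these relations define the Weyl group
(`eq_one_of_mem_closure`), so that the kernel of `𝒩 → W` is exactly `K`
(`ChevalleyData.mem_K_of_one_mem_weylGraph`). The structure constants of a Chevalley basis are real,
because the Killing form is positive definite on the real span of the coroots; hence the graph of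
the differential of `σ` is stable under the graph of `σ`, and the elements of `𝒩` multiply the root
vectors by scalars of absolute value one (`ChevalleyData.conj_eq_inv`). Therefore conjugation by an
element of the coset of `w` maps `C_t` to `C_{wtw⁻¹}` (`ChevalleyData.conj_mem_Crefl`). Finally
`C_t → C_t/K` has local sections (`ChevalleyData.exists_local_retraction`): for a special unitary
`M`, the class of `φ_α(M)` modulo `K` can be recovered continuously from `Ad(φ_α(M)) α^∨`, by means
of the big cell decomposition of `M`. The structure `CosetSystem` collects these facts.

*Combinatorics.* The element before an `i ∈ I^F` is either in `I^F` or the last element of an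
interval of `F` (`IsStart.cases`), and induction over this relation computes the products of `c^F`
along intervals from those of `c` when `c` is balanced (`orderedProd_proj`). In the same way a
sequence `k` in `K^I` which carries one balanced sequence to another induces a sequence in `K^{I^F}`
that carries one projection to the other (`IsLift.proj_act`). A sequence can be made balanced by
adjusting its entries at the last elements of the intervals only.

*Local triviality.* The local sections of `C_t → C_t/K` yield, near any given point, a
`K^{I^F}`-equivariant map `θ` from the sequences on `I^F` to `K^{I^F}`
(`CosetSystem.exists_equivariant`). Every class over such a neighbourhood is represented by a
balanced sequence `c` with `θ(c^F) = 1`, which can be chosen continuously. The only `k` that relates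
two of these is trivial on `I^F` and on what precedes the intervals of `F`, so two of them are
equivalent if and only if their projections and their restrictions to the intervals of `F` are
(`CosetSystem.rel_iff_of_normalized`). Conversely, sequences on `I^F` and on the intervals, suitably
normalized, can be put together. Both descriptions are by open quotient maps, which gives the
trivialization (`exists_trivialization`, `CosetSystem.exists_projection`).
-/

open scoped Matrix

noncomputable section

namespace BottSamelson

set_option linter.unusedSectionVars false

/-! ### Conjugation by exponentials -/

section ExpConj

variable {A : Type*} [NormedRing A] [NormedAlgebra ℝ A]

/-- The commutator `y ↦ a y - y a` as a continuous linear map. -/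
def commOp (a : A) : A →L[ℝ] A :=
  ContinuousLinearMap.mul ℝ A a - (ContinuousLinearMap.mul ℝ A).flip a

theorem commOp_apply (a y : A) : commOp a y = a * y - y * a := by simp [commOp]

variable [CompleteSpace A]

/-- `exp a · y · exp (-a) = ∑ (ad a)ⁿ y / n!`. -/
theorem hasSum_exp_conj (a y : A) :
    HasSum (fun k : ℕ => (k.factorial : ℝ)⁻¹ • (commOp a ^ k) y)
      (NormedSpace.exp a * y * NormedSpace.exp (-a)) := by
  let _ : NormedAlgebra ℚ A := NormedAlgebra.restrictScalars ℚ ℝ A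
  let _ : NormedAlgebra ℚ (A →L[ℝ] A) := NormedAlgebra.restrictScalars ℚ ℝ (A →L[ℝ] A)
  set l : A →L[ℝ] A := ContinuousLinearMap.mul ℝ A a with hl
  set r : A →L[ℝ] A := (ContinuousLinearMap.mul ℝ A).flip a with hr
  have ev : ∀ (f : A →L[ℝ] A) (z : A),
      HasSum (fun k : ℕ => (k.factorial : ℝ)⁻¹ • (f ^ k) z) (NormedSpace.exp f z) := by
    intro f z
    have h := (NormedSpace.exp_series_hasSum_exp' (𝕂 := ℝ) f).mapL
      (ContinuousLinearMap.apply ℝ A z)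
    simpa using h
  have hlp : ∀ (k : ℕ) (z : A), (l ^ k) z = a ^ k * z := by
    intro k; induction k with
    | zero => simp
    | succ k ih => intro z; rw [pow_succ, mul_apply_eq_comp, ih]; simp [hl, pow_succ, mul_assoc]
  have hrp : ∀ (k : ℕ) (z : A), ((-r) ^ k) z = z * (-a) ^ k := by
    intro k; induction k with
    | zero => simp
    | succ k ih =>
      intro z; rw [pow_succ, mul_apply_eq_comp, ih]; simp [hr, pow_succ', mul_assoc]
  have hle : ∀ z, NormedSpace.exp l z = NormedSpace.exp a * z := by
    intro z
    refine (ev l z).unique ?_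
    have h := (NormedSpace.exp_series_hasSum_exp' (𝕂 := ℝ) a).mul_right z
    simpa [hlp] using h
  have hre : ∀ z, NormedSpace.exp (-r) z = z * NormedSpace.exp (-a) := by
    intro z
    refine (ev (-r) z).unique ?_
    have h := (NormedSpace.exp_series_hasSum_exp' (𝕂 := ℝ) (-a)).mul_left z
    simpa [hrp] using h
  have hc : Commute l (-r) := by
    ext z; simp [hl, hr, mul_assoc]
  have he : NormedSpace.exp (commOp a) y = NormedSpace.exp a * y * NormedSpace.exp (-a) := by
    rw [commOp, sub_eq_add_neg, NormedSpace.exp_add_of_commute hc, mul_apply_eq_comp, hre,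
      hle, mul_assoc]
  exact he ▸ ev (commOp a) y

/-- A closed real subspace that is stable under the commutator with `a` is stable under the
conjugation by `exp a`. -/
theorem exp_conj_mem (S : Submodule ℝ A) (hS : IsClosed (S : Set A)) (a : A)
    (ha : ∀ y ∈ S, a * y - y * a ∈ S) {y : A} (hy : y ∈ S) :
    NormedSpace.exp a * y * NormedSpace.exp (-a) ∈ S := by
  have hk : ∀ k : ℕ, (commOp a ^ k) y ∈ S := by
    intro k; induction k with
    | zero => simpa using hy
    | succ k ih =>
      rw [pow_succ', mul_apply_eq_comp, commOp_apply]; exact ha _ ih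
  exact hS.mem_of_tendsto (hasSum_exp_conj a y)
    (Filter.Eventually.of_forall fun s => S.sum_mem fun k _ => S.smul_mem _ (hk k))

theorem exp_conj_of_comm_three {a y c d : A} (h1 : a * y - y * a = c) (h2 : a * c - c * a = d)
    (h3 : a * d - d * a = 0) :
    NormedSpace.exp a * y * NormedSpace.exp (-a) = y + c + (2 : ℝ)⁻¹ • d := by
  have e1 : (commOp a ^ 1) y = c := by rw [pow_one, commOp_apply, h1]
  have e2 : (commOp a ^ 2) y = d := by
    rw [pow_succ', mul_apply_eq_comp, e1, commOp_apply, h2]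
  have e3 : ∀ k, (commOp a ^ (k + 3)) y = 0 := by
    intro k; induction k with
    | zero => rw [zero_add, pow_succ', mul_apply_eq_comp, e2, commOp_apply, h3]
    | succ k ih =>
      rw [add_right_comm, pow_succ', mul_apply_eq_comp, ih, map_zero]
  refine (hasSum_exp_conj a y).unique ?_
  have h := hasSum_sum_of_ne_finset_zero (L := SummationFilter.unconditional ℕ)
    (s := Finset.range 3) (f := fun k : ℕ => (k.factorial : ℝ)⁻¹ • (commOp a ^ k) y) (by
      intro k hk
      obtain ⟨m, rfl⟩ := Nat.exists_eq_add_of_le' (not_lt.mp (mt Finset.mem_range.mpr hk))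
      simp [e3])
  simpa only [Finset.sum_range_succ, Finset.sum_range_zero, pow_zero, e1, e2, zero_add,
    Nat.factorial_zero, Nat.factorial_one, Nat.factorial_two, Nat.cast_one, inv_one, one_smul,
    one_apply_eq_self, Nat.cast_ofNat] using h

theorem exp_conj_prod_mem (S : Submodule ℝ (A × A)) (hS : IsClosed (S : Set (A × A))) (a b : A)
    (ha : ∀ y ∈ S, (a * y.1 - y.1 * a, b * y.2 - y.2 * b) ∈ S) {y : A × A} (hy : y ∈ S) :
    (NormedSpace.exp a * y.1 * NormedSpace.exp (-a),
      NormedSpace.exp b * y.2 * NormedSpace.exp (-b)) ∈ S := by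
  let _ : NormedAlgebra ℚ A := NormedAlgebra.restrictScalars ℚ ℝ A
  have := exp_conj_mem S hS (a, b) ha hy
  have e : ∀ a b : A, NormedSpace.exp (a, b) = (NormedSpace.exp a, NormedSpace.exp b) :=
    fun a b => Prod.ext (Prod.fst_exp _) (Prod.snd_exp _)
  rwa [Prod.neg_mk, e, e] at this

end ExpConj

section ExpConjEigen

variable {A : Type*} [NormedRing A] [NormedAlgebra ℂ A] [CompleteSpace A]

theorem exp_conj_of_comm_smul {a y : A} {c : ℂ} (h : a * y - y * a = c • y) :
    NormedSpace.exp a * y * NormedSpace.exp (-a) = Complex.exp c • y := by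
  let _ : NormedAlgebra ℝ A := NormedAlgebra.restrictScalars ℝ ℂ A
  have e : ∀ k : ℕ, (commOp a ^ k) y = c ^ k • y := by
    intro k; induction k with
    | zero => simp
    | succ k ih =>
      rw [pow_succ', mul_apply_eq_comp, ih, commOp_apply, mul_smul_comm,
        smul_mul_assoc, ← smul_sub, h, smul_smul, pow_succ]
  refine (hasSum_exp_conj a y).unique ?_
  have h2 := (NormedSpace.exp_series_hasSum_exp' (𝕂 := ℝ) c).smul_const y
  rw [← Complex.exp_eq_exp_ℂ] at h2
  convert! h2 using 2 with k
  rw [e, smul_assoc]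

end ExpConjEigen

/-! ### Matrices -/

section MatrixExp

open NormedSpace

variable {n : ℕ}

/-- `exp a` as an invertible matrix. -/
def expGL (a : Matrix (Fin n) (Fin n) ℂ) : GL (Fin n) ℂ := (Matrix.isUnit_exp a).unit

@[simp] theorem coe_expGL (a : Matrix (Fin n) (Fin n) ℂ) :
    (expGL a : Matrix (Fin n) (Fin n) ℂ) = exp a := rfl

theorem expGL_zero : expGL (0 : Matrix (Fin n) (Fin n) ℂ) = 1 := Units.ext (by simp)

theorem expGL_add {a b : Matrix (Fin n) (Fin n) ℂ} (h : Commute a b) :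
    expGL (a + b) = expGL a * expGL b :=
  Units.ext (by simpa using Matrix.exp_add_of_commute a b h)

theorem expGL_neg (a : Matrix (Fin n) (Fin n) ℂ) : expGL (-a) = (expGL a)⁻¹ := by
  rw [eq_inv_iff_mul_eq_one, ← expGL_add (Commute.refl a).neg_left, neg_add_cancel, expGL_zero]

theorem coe_inv_expGL (a : Matrix (Fin n) (Fin n) ℂ) :
    (((expGL a)⁻¹ : GL (Fin n) ℂ) : Matrix (Fin n) (Fin n) ℂ) = exp (-a) := by
  rw [← expGL_neg, coe_expGL]

/-- The conjugation of matrices by an invertible matrix. -/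
def Ad (g : GL (Fin n) ℂ) (y : Matrix (Fin n) (Fin n) ℂ) : Matrix (Fin n) (Fin n) ℂ :=
  g.val * y * (g⁻¹).val

theorem Ad_one (y : Matrix (Fin n) (Fin n) ℂ) : Ad 1 y = y := by simp [Ad]

theorem Ad_mul (g h : GL (Fin n) ℂ) (y : Matrix (Fin n) (Fin n) ℂ) :
    Ad (g * h) y = Ad g (Ad h y) := by
  simp only [Ad, mul_inv_rev, Units.val_mul, mul_assoc]

theorem Ad_inv_eq_iff (g : GL (Fin n) ℂ) (y z : Matrix (Fin n) (Fin n) ℂ) :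
    Ad g⁻¹ y = z ↔ y = Ad g z := by
  constructor
  · rintro rfl; rw [← Ad_mul, mul_inv_cancel, Ad_one]
  · rintro rfl; rw [← Ad_mul, inv_mul_cancel, Ad_one]

theorem Ad_smul (g : GL (Fin n) ℂ) (c : ℂ) (y : Matrix (Fin n) (Fin n) ℂ) :
    Ad g (c • y) = c • Ad g y := by simp [Ad]

theorem Ad_add (g : GL (Fin n) ℂ) (y z : Matrix (Fin n) (Fin n) ℂ) :
    Ad g (y + z) = Ad g y + Ad g z := by simp [Ad, mul_add, add_mul]

theorem Ad_sub (g : GL (Fin n) ℂ) (y z : Matrix (Fin n) (Fin n) ℂ) :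
    Ad g (y - z) = Ad g y - Ad g z := by simp [Ad, mul_sub, sub_mul]

theorem Ad_neg (g : GL (Fin n) ℂ) (y : Matrix (Fin n) (Fin n) ℂ) :
    Ad g (-y) = -Ad g y := by simp [Ad]

theorem Ad_mul_mul (g : GL (Fin n) ℂ) (y z : Matrix (Fin n) (Fin n) ℂ) :
    Ad g (y * z) = Ad g y * Ad g z := by
  have : (g⁻¹).val * (g.val * (z * (g⁻¹).val)) = z * (g⁻¹).val := by
    rw [← mul_assoc, ← Units.val_mul]; simp
  simp only [Ad, mul_assoc, this]

theorem conj_expGL (g : GL (Fin n) ℂ) (a : Matrix (Fin n) (Fin n) ℂ) :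
    g * expGL a * g⁻¹ = expGL (Ad g a) :=
  Units.ext (by simp only [Units.val_mul, coe_expGL, Ad, Matrix.exp_units_conj])

theorem Ad_expGL_of_comm_three {a y c d : Matrix (Fin n) (Fin n) ℂ} (h1 : a * y - y * a = c)
    (h2 : a * c - c * a = d) (h3 : a * d - d * a = 0) :
    Ad (expGL a) y = y + c + (2 : ℂ)⁻¹ • d := by
  have e : (2 : ℂ)⁻¹ • d = (2 : ℝ)⁻¹ • d := by ext i j; simp
  rw [Ad, coe_inv_expGL, coe_expGL, e]
  let _ : NormedRing (Matrix (Fin n) (Fin n) ℂ) := Matrix.linftyOpNormedRing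
  let _ : NormedAlgebra ℂ (Matrix (Fin n) (Fin n) ℂ) := Matrix.linftyOpNormedAlgebra
  exact exp_conj_of_comm_three h1 h2 h3

theorem Ad_expGL_of_comm_smul {a y : Matrix (Fin n) (Fin n) ℂ} {c : ℂ}
    (h : a * y - y * a = c • y) : Ad (expGL a) y = Complex.exp c • y := by
  rw [Ad, coe_inv_expGL, coe_expGL]
  let _ : NormedRing (Matrix (Fin n) (Fin n) ℂ) := Matrix.linftyOpNormedRing
  let _ : NormedAlgebra ℂ (Matrix (Fin n) (Fin n) ℂ) := Matrix.linftyOpNormedAlgebra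
  exact exp_conj_of_comm_smul h

theorem Ad_expGL_of_commute {a y : Matrix (Fin n) (Fin n) ℂ} (h : Commute a y) :
    Ad (expGL a) y = y := by
  have := Ad_expGL_of_comm_smul (a := a) (y := y) (c := 0) (by simp [h.eq])
  simpa using this

theorem Ad_expGL_mem (S : Submodule ℂ (Matrix (Fin n) (Fin n) ℂ))
    (a : Matrix (Fin n) (Fin n) ℂ) (ha : ∀ y ∈ S, a * y - y * a ∈ S)
    {y : Matrix (Fin n) (Fin n) ℂ} (hy : y ∈ S) : Ad (expGL a) y ∈ S := by
  rw [Ad, coe_inv_expGL, coe_expGL]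
  let _ : NormedRing (Matrix (Fin n) (Fin n) ℂ) := Matrix.linftyOpNormedRing
  let _ : NormedAlgebra ℂ (Matrix (Fin n) (Fin n) ℂ) := Matrix.linftyOpNormedAlgebra
  exact exp_conj_mem (S.restrictScalars ℝ) (Submodule.closed_of_finiteDimensional _) a ha hy

theorem Ad_expGL_prod_mem
    (S : Submodule ℝ (Matrix (Fin n) (Fin n) ℂ × Matrix (Fin n) (Fin n) ℂ))
    (a b : Matrix (Fin n) (Fin n) ℂ)
    (ha : ∀ y ∈ S, (a * y.1 - y.1 * a, b * y.2 - y.2 * b) ∈ S)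
    {y : Matrix (Fin n) (Fin n) ℂ × Matrix (Fin n) (Fin n) ℂ} (hy : y ∈ S) :
    (Ad (expGL a) y.1, Ad (expGL b) y.2) ∈ S := by
  simp only [Ad, coe_inv_expGL, coe_expGL]
  let _ : NormedRing (Matrix (Fin n) (Fin n) ℂ) := Matrix.linftyOpNormedRing
  let _ : NormedAlgebra ℂ (Matrix (Fin n) (Fin n) ℂ) := Matrix.linftyOpNormedAlgebra
  let _ : NormedAlgebra ℚ (Matrix (Fin n) (Fin n) ℂ) := NormedAlgebra.restrictScalars ℚ ℂ _
  exact exp_conj_prod_mem S (Submodule.closed_of_finiteDimensional _) a b ha hy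

theorem continuous_expGL : Continuous (expGL : Matrix (Fin n) (Fin n) ℂ → GL (Fin n) ℂ) := by
  have h : Continuous (exp : Matrix (Fin n) (Fin n) ℂ → Matrix (Fin n) (Fin n) ℂ) := by
    let _ : NormedRing (Matrix (Fin n) (Fin n) ℂ) := Matrix.linftyOpNormedRing
    let _ : NormedAlgebra ℂ (Matrix (Fin n) (Fin n) ℂ) := Matrix.linftyOpNormedAlgebra
    let _ : NormedAlgebra ℚ (Matrix (Fin n) (Fin n) ℂ) := NormedAlgebra.restrictScalars ℚ ℂ _
    exact NormedSpace.exp_continuous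
  rw [Units.continuous_iff]
  refine ⟨h, ?_⟩
  simp only [coe_inv_expGL]
  exact h.comp continuous_neg

theorem continuous_Ad (y : Matrix (Fin n) (Fin n) ℂ) :
    Continuous fun g : GL (Fin n) ℂ => Ad g y :=
  (Units.continuous_val.mul continuous_const).mul (Units.continuous_val.comp continuous_inv)

end MatrixExp

/-! ### Exponentials of an `𝔰𝔩₂`-triple of matrices -/

/-- The commutation relations of an `𝔰𝔩₂`-triple of matrices; the triple may be zero. -/
structure IsMatrixSl2 {n : ℕ} (e f h : Matrix (Fin n) (Fin n) ℂ) : Prop where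
  ef : e * f - f * e = h
  he : h * e - e * h = (2 : ℂ) • e
  hf : h * f - f * h = (-2 : ℂ) • f

namespace IsMatrixSl2

variable {n : ℕ} {e f h : Matrix (Fin n) (Fin n) ℂ}

theorem symm (s : IsMatrixSl2 e f h) : IsMatrixSl2 f e (-h) where
  ef := by rw [← s.ef, neg_sub]
  he := by rw [neg_mul, mul_neg, sub_neg_eq_add, neg_add_eq_sub, ← neg_sub, s.hf,
    ← neg_smul, neg_neg]
  hf := by rw [neg_mul, mul_neg, sub_neg_eq_add, neg_add_eq_sub, ← neg_sub, s.he, ← neg_smul]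

/-- `w(t) = exp(te) exp(-t⁻¹f) exp(te)`. -/
def sw (e f : Matrix (Fin n) (Fin n) ℂ) (t : ℂ) : GL (Fin n) ℂ :=
  expGL (t • e) * expGL ((-t⁻¹) • f) * expGL (t • e)

/-- `h(t) = w(t) w(1)⁻¹`. -/
def sh (e f : Matrix (Fin n) (Fin n) ℂ) (t : ℂ) : GL (Fin n) ℂ := sw e f t * (sw e f 1)⁻¹

theorem Ad_exp_of_weight (t : ℂ) {y : Matrix (Fin n) (Fin n) ℂ} {a : ℂ}
    (hy : y * e - e * y = a • e) : Ad (expGL (t • e)) y = y - (t * a) • e := by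
  rw [Ad_expGL_of_comm_three (c := -((t * a) • e)) (d := 0)]
  · simp [sub_eq_add_neg]
  · rw [smul_mul_assoc, mul_smul_comm, ← smul_sub, ← neg_sub, hy, smul_neg, smul_smul]
  · simp only [mul_neg, neg_mul, smul_mul_assoc, mul_smul_comm]; module
  · simp

theorem Ad_exp_e_f (s : IsMatrixSl2 e f h) (t : ℂ) :
    Ad (expGL (t • e)) f = f + t • h - (t ^ 2) • e := by
  have h1 : e * h - h * e = (-2 : ℂ) • e := by rw [← neg_sub, s.he, neg_smul]
  rw [Ad_expGL_of_comm_three (c := t • h) (d := (-2 * t ^ 2) • e), smul_smul]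
  · rw [sub_eq_add_neg, ← neg_smul]; congr 2; ring
  · rw [smul_mul_assoc, mul_smul_comm, ← smul_sub, s.ef]
  · rw [smul_mul_assoc, mul_smul_comm, smul_mul_assoc, mul_smul_comm, smul_comm t t (h * e),
      ← smul_sub, ← smul_sub, h1, smul_smul, smul_smul]
    congr 1; ring
  · rw [smul_mul_assoc, mul_smul_comm, smul_mul_assoc, mul_smul_comm, smul_comm, sub_self]

theorem Ad_exp_e_h (s : IsMatrixSl2 e f h) (t : ℂ) :
    Ad (expGL (t • e)) h = h - (2 * t) • e := by
  rw [Ad_exp_of_weight t s.he, mul_comm]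

theorem Ad_exp_e_e (t : ℂ) : Ad (expGL (t • e)) e = e :=
  Ad_expGL_of_commute ((Commute.refl e).smul_left t)

theorem Ad_exp_f_e (s : IsMatrixSl2 e f h) (t : ℂ) :
    Ad (expGL (t • f)) e = e - t • h - (t ^ 2) • f := by
  rw [s.symm.Ad_exp_e_f t, smul_neg, ← sub_eq_add_neg]

theorem Ad_exp_f_h (s : IsMatrixSl2 e f h) (t : ℂ) :
    Ad (expGL (t • f)) h = h + (2 * t) • f := by
  have := s.symm.Ad_exp_e_h t
  rw [Ad_neg] at this
  rw [← neg_neg h, Ad_neg, Ad_neg, this]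
  rw [neg_neg, neg_sub, sub_eq_add_neg, neg_neg, add_comm]

/-- `w(t)` acts on an element that acts on `e` and `f` by opposite weights as a reflection. -/
theorem Ad_sw_of_weight (s : IsMatrixSl2 e f h) {t : ℂ} (ht : t ≠ 0)
    {y : Matrix (Fin n) (Fin n) ℂ} {a : ℂ}
    (he : y * e - e * y = a • e) (hf : y * f - f * y = (-a) • f) :
    Ad (sw e f t) y = y - a • h := by
  rw [sw, Ad_mul, Ad_mul, Ad_exp_of_weight t he, Ad_sub, Ad_smul,
    Ad_exp_of_weight _ hf, s.Ad_exp_f_e, Ad_sub, Ad_sub, Ad_exp_of_weight t he]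
  simp only [Ad_sub, Ad_smul, s.Ad_exp_e_h, s.Ad_exp_e_f, Ad_exp_e_e]
  match_scalars <;> field_simp <;> ring

theorem Ad_sw_h (s : IsMatrixSl2 e f h) {t : ℂ} (ht : t ≠ 0) : Ad (sw e f t) h = -h := by
  rw [s.Ad_sw_of_weight ht s.he s.hf]; module

theorem Ad_sw_e (s : IsMatrixSl2 e f h) {t : ℂ} (ht : t ≠ 0) :
    Ad (sw e f t) e = (-(t⁻¹) ^ 2) • f := by
  rw [sw, Ad_mul, Ad_mul, Ad_exp_e_e, s.Ad_exp_f_e]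
  simp only [Ad_sub, Ad_smul, s.Ad_exp_e_h, s.Ad_exp_e_f, Ad_exp_e_e]
  match_scalars <;> field_simp <;> ring

theorem Ad_sw_f (s : IsMatrixSl2 e f h) {t : ℂ} (ht : t ≠ 0) :
    Ad (sw e f t) f = (-t ^ 2) • e := by
  rw [sw, Ad_mul, Ad_mul, s.Ad_exp_e_f, Ad_sub, Ad_add, Ad_smul, Ad_smul, s.Ad_exp_f_e,
    s.Ad_exp_f_h, Ad_exp_e_e]
  simp only [Ad_sub, Ad_add, Ad_smul, s.Ad_exp_e_h, s.Ad_exp_e_f, Ad_exp_e_e]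
  match_scalars <;> field_simp <;> ring

/-- Exchanging `e` and `f` turns `w(t)` into `w(-t⁻¹)`. -/
theorem sw_swap (s : IsMatrixSl2 e f h) {t : ℂ} (ht : t ≠ 0) :
    sw f e (-t⁻¹) = sw e f t := by
  have h1 : sw e f t * sw e f t * (sw e f t)⁻¹ = sw f e (-t⁻¹) := by
    conv_lhs => enter [1, 2]; rw [sw]
    have h2 : ∀ a b c g : GL (Fin n) ℂ, g * (a * b * c) * g⁻¹ =
        (g * a * g⁻¹) * (g * b * g⁻¹) * (g * c * g⁻¹) := by intros; group
    rw [h2, conj_expGL, conj_expGL, Ad_smul, Ad_smul, s.Ad_sw_e ht, s.Ad_sw_f ht, sw, smul_smul,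
      smul_smul]
    have e1 : t * -t⁻¹ ^ 2 = -t⁻¹ := by field_simp
    have e2 : -t⁻¹ * -t ^ 2 = -(-t⁻¹)⁻¹ := by field_simp
    rw [e1, e2]
  rw [← h1, mul_inv_cancel_right]

theorem exp_mul (t u : ℂ) : expGL (t • e) * expGL (u • e) = expGL ((t + u) • e) := by
  rw [add_smul, expGL_add]
  exact ((Commute.refl e).smul_left t).smul_right u

theorem exp_inv (t : ℂ) : (expGL (t • e))⁻¹ = expGL ((-t) • e) := by
  rw [neg_smul, expGL_neg]

theorem exp_zero : expGL ((0 : ℂ) • e) = 1 := by rw [zero_smul, expGL_zero]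

theorem sw_inv (t : ℂ) : (sw e f t)⁻¹ = sw e f (-t) := by
  simp only [sw, mul_inv_rev, exp_inv, inv_neg, mul_assoc]

/-- `h(exp z) = exp(zh)`: both sides are `d w(1) d⁻¹ w(1)⁻¹` for `d = exp(zh/2)`. -/
theorem sh_exp (s : IsMatrixSl2 e f h) (z : ℂ) : sh e f (Complex.exp z) = expGL (z • h) := by
  set d := expGL ((z / 2) • h) with hd
  have h1 : d * sw e f 1 * d⁻¹ = sw e f (Complex.exp z) := by
    have h2 : ∀ a b c g : GL (Fin n) ℂ, g * (a * b * c) * g⁻¹ =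
        (g * a * g⁻¹) * (g * b * g⁻¹) * (g * c * g⁻¹) := by intros; group
    have e1 : Ad d e = Complex.exp z • e := by
      refine Ad_expGL_of_comm_smul ?_
      rw [smul_mul_assoc, mul_smul_comm, ← smul_sub, s.he, smul_smul]; congr 1; ring
    have e2 : Ad d f = (Complex.exp z)⁻¹ • f := by
      rw [← Complex.exp_neg]
      refine Ad_expGL_of_comm_smul ?_
      rw [smul_mul_assoc, mul_smul_comm, ← smul_sub, s.hf, smul_smul]; congr 1; ring
    rw [sw, h2, conj_expGL, conj_expGL, Ad_smul, Ad_smul, e1, e2, sw]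
    simp
  have h3 : sw e f 1 * d⁻¹ * (sw e f 1)⁻¹ = d := by
    rw [hd, ← expGL_neg, conj_expGL, Ad_neg, Ad_smul, s.Ad_sw_h one_ne_zero]; simp
  rw [sh, ← h1]
  calc d * sw e f 1 * d⁻¹ * (sw e f 1)⁻¹ = d * (sw e f 1 * d⁻¹ * (sw e f 1)⁻¹) := by group
    _ = d * d := by rw [h3]
    _ = expGL (z • h) := by rw [hd, exp_mul, add_halves]

theorem sh_one : sh e f 1 = 1 := by rw [sh, mul_inv_cancel]

theorem sh_eq_exp (s : IsMatrixSl2 e f h) {t : ℂ} (ht : t ≠ 0) :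
    sh e f t = expGL (Complex.log t • h) := by
  rw [← s.sh_exp, Complex.exp_log ht]

theorem sh_mul (s : IsMatrixSl2 e f h) {t u : ℂ} (ht : t ≠ 0) (hu : u ≠ 0) :
    sh e f t * sh e f u = sh e f (t * u) := by
  rw [s.sh_eq_exp ht, s.sh_eq_exp hu, exp_mul, ← s.sh_exp, Complex.exp_add, Complex.exp_log ht,
    Complex.exp_log hu]

theorem Ad_sh_e (s : IsMatrixSl2 e f h) {t : ℂ} (ht : t ≠ 0) :
    Ad (sh e f t) e = (t ^ 2) • e := by
  rw [s.sh_eq_exp ht, Ad_expGL_of_comm_smul (c := 2 * Complex.log t), two_mul, Complex.exp_add,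
    Complex.exp_log ht, sq]
  rw [smul_mul_assoc, mul_smul_comm, ← smul_sub, s.he, smul_smul]; congr 1; ring

theorem sh_mul_exp (s : IsMatrixSl2 e f h) {t : ℂ} (ht : t ≠ 0) (u : ℂ) :
    sh e f t * expGL (u • e) = expGL ((t ^ 2 * u) • e) * sh e f t := by
  rw [← mul_inv_eq_iff_eq_mul, conj_expGL, Ad_smul, s.Ad_sh_e ht, smul_smul, mul_comm]

theorem Ad_sh_f (s : IsMatrixSl2 e f h) {t : ℂ} (ht : t ≠ 0) :
    Ad (sh e f t) f = ((t ^ 2)⁻¹) • f := by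
  rw [s.sh_eq_exp ht, Ad_expGL_of_comm_smul (c := -(Complex.log t + Complex.log t)),
    Complex.exp_neg, Complex.exp_add, Complex.exp_log ht, sq]
  rw [smul_mul_assoc, mul_smul_comm, ← smul_sub, s.hf, smul_smul]; congr 1; ring

theorem sh_mul_exp_f (s : IsMatrixSl2 e f h) {t : ℂ} (ht : t ≠ 0) (u : ℂ) :
    sh e f t * expGL (u • f) = expGL (((t ^ 2)⁻¹ * u) • f) * sh e f t := by
  rw [← mul_inv_eq_iff_eq_mul, conj_expGL, Ad_smul, s.Ad_sh_f ht, smul_smul, mul_comm]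

theorem exp_f_eq (v : ℂ) :
    expGL (v • f) = expGL (v⁻¹ • e) * sw e f (-v⁻¹) * expGL (v⁻¹ • e) := by
  simp only [sw, inv_neg, inv_inv, neg_neg, mul_assoc, exp_mul]
  simp only [← mul_assoc, exp_mul]
  simp [expGL_zero]

/-- The rank one relation that moves an upper root element to the left of a lower one. -/
theorem exp_f_mul_exp_e (s : IsMatrixSl2 e f h) {u v : ℂ} (huv : 1 + u * v ≠ 0) :
    expGL (v • f) * expGL (u • e) =
      expGL ((u / (1 + u * v)) • e) * sh e f (1 + u * v)⁻¹ * expGL ((v / (1 + u * v)) • f) := by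
  rcases eq_or_ne v 0 with rfl | hv
  · simp [sh_one, expGL_zero]
  have huv' : 1 + v * u ≠ 0 := by rwa [mul_comm]
  set v' := v / (1 + u * v) with hv'
  have hv'0 : v' ≠ 0 := div_ne_zero hv huv
  have h1 : v⁻¹ + u = v'⁻¹ := by rw [hv']; field_simp
  have h2 : expGL (v'⁻¹ • e) = (sw e f (-v'⁻¹))⁻¹ * expGL ((-v'⁻¹) • e) * expGL (v' • f) := by
    rw [exp_f_eq (e := e) v', ← exp_inv]; group
  have h3 : sw e f (-v⁻¹) * (sw e f (-v'⁻¹))⁻¹ = sh e f (1 + u * v)⁻¹ := by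
    have h4 : sw e f (-v⁻¹) * (sw e f (-v'⁻¹))⁻¹ = sh e f (-v⁻¹) * (sh e f (-v'⁻¹))⁻¹ := by
      simp only [sh]; group
    rw [h4, mul_inv_eq_iff_eq_mul, s.sh_mul (inv_ne_zero huv) (by simpa using hv'0)]
    congr 1; rw [hv']; field_simp
  rw [exp_f_eq (e := e) v, mul_assoc, exp_mul, h1, h2]
  calc expGL (v⁻¹ • e) * sw e f (-v⁻¹) *
        ((sw e f (-v'⁻¹))⁻¹ * expGL ((-v'⁻¹) • e) * expGL (v' • f)) =
      expGL (v⁻¹ • e) * ((sw e f (-v⁻¹) * (sw e f (-v'⁻¹))⁻¹) * expGL ((-v'⁻¹) • e)) *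
        expGL (v' • f) := by group
    _ = _ := by
      rw [h3, s.sh_mul_exp (inv_ne_zero huv), ← mul_assoc, exp_mul]
      congr 4; rw [hv']; field_simp; ring

/-! ### The homomorphism from `SL₂` -/

/-- The upper unitriangular element of `SL₂(ℂ)`. -/
def up (t : ℂ) : Matrix.SpecialLinearGroup (Fin 2) ℂ := ⟨!![1, t; 0, 1], by simp⟩

/-- The lower unitriangular element of `SL₂(ℂ)`. -/
def lo (t : ℂ) : Matrix.SpecialLinearGroup (Fin 2) ℂ := ⟨!![1, 0; t, 1], by simp⟩

/-- The value at `M` of the homomorphism `SL₂(ℂ) → GL_n(ℂ)` attached to the triple, read off from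
the big cell decomposition; it is meaningful if the lower right entry of `M` is nonzero. -/
def cell (e f : Matrix (Fin n) (Fin n) ℂ) (M : Matrix (Fin 2) (Fin 2) ℂ) : GL (Fin n) ℂ :=
  expGL ((M 0 1 / M 1 1) • e) * sh e f (M 1 1)⁻¹ * expGL ((M 1 0 / M 1 1) • f)

/-- The graph of the homomorphism `SL₂(ℂ) → GL_n(ℂ)` attached to the triple. -/
def slGraph (e f : Matrix (Fin n) (Fin n) ℂ) :
    Subgroup (Matrix.SpecialLinearGroup (Fin 2) ℂ × GL (Fin n) ℂ) :=
  Subgroup.closure {p | ∃ t : ℂ, p = (up t, expGL (t • e)) ∨ p = (lo t, expGL (t • f))}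

theorem cell_up_mul (t : ℂ) (M : Matrix (Fin 2) (Fin 2) ℂ) (hM : M 1 1 ≠ 0) :
    cell e f (!![1, t; 0, 1] * M) = expGL (t • e) * cell e f M := by
  simp only [cell, ← mul_assoc, exp_mul]
  simp [Matrix.mul_apply, Fin.sum_univ_two]
  congr 4; field_simp; ring

theorem exp_f_mul_sh (s : IsMatrixSl2 e f h) {t : ℂ} (ht : t ≠ 0) (u : ℂ) :
    expGL (u • f) * sh e f t = sh e f t * expGL ((t ^ 2 * u) • f) := by
  rw [s.sh_mul_exp_f ht]; congr 3; field_simp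

theorem cell_lo_mul (s : IsMatrixSl2 e f h) (t : ℂ) (M : Matrix (Fin 2) (Fin 2) ℂ)
    (hd : M.det = 1) (hM : M 1 1 ≠ 0) (hM' : t * M 0 1 + M 1 1 ≠ 0) :
    cell e f (!![1, 0; t, 1] * M) = expGL (t • f) * cell e f M := by
  have h0 : 1 + M 0 1 / M 1 1 * t ≠ 0 := by
    intro h; apply hM'; field_simp at h; linear_combination h
  have h1 : (1 + M 0 1 / M 1 1 * t) * M 1 1 = t * M 0 1 + M 1 1 := by field_simp; ring
  rw [Matrix.det_fin_two] at hd
  have h2 : (!![1, 0; t, 1] * M) 0 1 = M 0 1 := by simp [Matrix.mul_apply, Fin.sum_univ_two]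
  have h3 : (!![1, 0; t, 1] * M) 1 0 = t * M 0 0 + M 1 0 := by
    simp [Matrix.mul_apply, Fin.sum_univ_two]
  have h4 : (!![1, 0; t, 1] * M) 1 1 = t * M 0 1 + M 1 1 := by
    simp [Matrix.mul_apply, Fin.sum_univ_two]
  symm
  calc expGL (t • f) * cell e f M
      = expGL (t • f) * expGL ((M 0 1 / M 1 1) • e) *
          (sh e f (M 1 1)⁻¹ * expGL ((M 1 0 / M 1 1) • f)) := by simp only [cell, mul_assoc]
    _ = expGL ((M 0 1 / M 1 1 / (1 + M 0 1 / M 1 1 * t)) • e) *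
          (sh e f (1 + M 0 1 / M 1 1 * t)⁻¹ * sh e f (M 1 1)⁻¹) *
          (expGL (((M 1 1)⁻¹ ^ 2 * (t / (1 + M 0 1 / M 1 1 * t))) • f) *
            expGL ((M 1 0 / M 1 1) • f)) := by
        rw [s.exp_f_mul_exp_e h0, mul_assoc, ← mul_assoc (expGL _) (sh e f (M 1 1)⁻¹),
          s.exp_f_mul_sh (inv_ne_zero hM)]
        simp only [mul_assoc]
    _ = cell e f (!![1, 0; t, 1] * M) := by
        rw [s.sh_mul (inv_ne_zero h0) (inv_ne_zero hM), ← mul_inv, h1, exp_mul, cell, h2, h3, h4]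
        have h5 : 1 + M 0 1 / M 1 1 * t = (t * M 0 1 + M 1 1) / M 1 1 := by
          rw [← h1]; field_simp
        congr 3
        · rw [h5]; field_simp
        · rw [h5]; field_simp; linear_combination -t * hd

theorem cell_mul_up (s : IsMatrixSl2 e f h) (t : ℂ) (M : Matrix (Fin 2) (Fin 2) ℂ)
    (hd : M.det = 1) (hM : M 1 1 ≠ 0) (hM' : M 1 0 * t + M 1 1 ≠ 0) :
    cell e f (M * !![1, t; 0, 1]) = cell e f M * expGL (t • e) := by
  have h0 : 1 + t * (M 1 0 / M 1 1) ≠ 0 := by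
    intro h; apply hM'; field_simp at h; linear_combination h
  have h1 : (1 + t * (M 1 0 / M 1 1)) * M 1 1 = M 1 0 * t + M 1 1 := by field_simp; ring
  rw [Matrix.det_fin_two] at hd
  have h2 : (M * !![1, t; 0, 1]) 0 1 = M 0 0 * t + M 0 1 := by
    simp [Matrix.mul_apply, Fin.sum_univ_two]
  have h3 : (M * !![1, t; 0, 1]) 1 0 = M 1 0 := by
    simp [Matrix.mul_apply, Fin.sum_univ_two]
  have h4 : (M * !![1, t; 0, 1]) 1 1 = M 1 0 * t + M 1 1 := by
    simp [Matrix.mul_apply, Fin.sum_univ_two]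
  symm
  calc cell e f M * expGL (t • e)
      = expGL ((M 0 1 / M 1 1) • e) * sh e f (M 1 1)⁻¹ *
          (expGL ((M 1 0 / M 1 1) • f) * expGL (t • e)) := by simp only [cell, mul_assoc]
    _ = (expGL ((M 0 1 / M 1 1) • e) *
          expGL (((M 1 1)⁻¹ ^ 2 * (t / (1 + t * (M 1 0 / M 1 1)))) • e)) *
          (sh e f (M 1 1)⁻¹ * sh e f (1 + t * (M 1 0 / M 1 1))⁻¹) *
          expGL ((M 1 0 / M 1 1 / (1 + t * (M 1 0 / M 1 1))) • f) := by
        rw [s.exp_f_mul_exp_e h0]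
        have := s.sh_mul_exp (inv_ne_zero hM) (t / (1 + t * (M 1 0 / M 1 1)))
        simp only [← mul_assoc]
        rw [mul_assoc _ (sh e f (M 1 1)⁻¹), this]
        simp only [mul_assoc]
    _ = cell e f (M * !![1, t; 0, 1]) := by
        rw [s.sh_mul (inv_ne_zero hM) (inv_ne_zero h0), ← mul_inv, mul_comm (M 1 1), h1, exp_mul,
          cell, h2, h3, h4]
        have h5 : 1 + t * (M 1 0 / M 1 1) = (M 1 0 * t + M 1 1) / M 1 1 := by
          rw [← h1]; field_simp
        have h6 : M 0 1 / M 1 1 + (M 1 1)⁻¹ ^ 2 * (t / (1 + t * (M 1 0 / M 1 1))) =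
            (M 0 0 * t + M 0 1) / (M 1 0 * t + M 1 1) := by
          rw [eq_div_iff hM', h5]
          have h8 : t / ((M 1 0 * t + M 1 1) / M 1 1) * (M 1 0 * t + M 1 1) = t * M 1 1 := by
            rw [div_div_eq_mul_div, div_mul_cancel₀ _ hM']
          rw [add_mul, mul_assoc _ (t / _), h8]
          field_simp
          linear_combination -t * hd
        have h7 : M 1 0 / M 1 1 / (1 + t * (M 1 0 / M 1 1)) = M 1 0 / (M 1 0 * t + M 1 1) := by
          rw [h5]; field_simp
        rw [h6, h7]

theorem exists_avoid (a b c d : ℂ) (h : a ≠ 0 ∨ b ≠ 0) (h' : c ≠ 0 ∨ d ≠ 0) :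
    ∃ r : ℂ, a * r + b ≠ 0 ∧ c * r + d ≠ 0 := by
  have key : ∀ a b : ℂ, (a ≠ 0 ∨ b ≠ 0) → {r : ℂ | a * r + b = 0}.Finite := by
    intro a b h
    refine (Set.finite_singleton (-b / a)).subset ?_
    intro r hr
    have hr : a * r + b = 0 := hr
    have ha : a ≠ 0 := by
      rintro rfl
      rcases h with h | h
      · exact h rfl
      · exact h (by simpa using hr)
    rw [Set.mem_singleton_iff]; field_simp; linear_combination hr
  obtain ⟨r, hr⟩ := ((key a b h).union (key c d h')).infinite_compl.nonempty
  exact ⟨r, fun h => hr (Or.inl h), fun h => hr (Or.inr h)⟩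

/-- The elements of the graph are given by the big cell formula after a right translation that
moves the first component into the big cell. -/
theorem mul_exp_eq_cell (s : IsMatrixSl2 e f h)
    {p : Matrix.SpecialLinearGroup (Fin 2) ℂ × GL (Fin n) ℂ} (hp : p ∈ slGraph e f) :
    ∀ r : ℂ, p.1.1 1 0 * r + p.1.1 1 1 ≠ 0 →
      p.2 * expGL (r • e) = cell e f (p.1.1 * !![1, r; 0, 1]) := by
  have row : ∀ M : Matrix.SpecialLinearGroup (Fin 2) ℂ, M.1 1 0 ≠ 0 ∨ M.1 1 1 ≠ 0 := by
    intro M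
    by_contra! hM
    have := M.2
    rw [Matrix.det_fin_two, hM.1, hM.2] at this
    simp at this
  have e11 : ∀ (M : Matrix (Fin 2) (Fin 2) ℂ) (r : ℂ),
      (M * !![1, r; 0, 1]) 1 1 = M 1 0 * r + M 1 1 := by
    intro M r; simp [Matrix.mul_apply, Fin.sum_univ_two]
  have det1 : ∀ (M : Matrix.SpecialLinearGroup (Fin 2) ℂ) (r : ℂ),
      (M.1 * !![1, r; 0, 1]).det = 1 := by
    intro M r; rw [Matrix.det_mul, M.2, Matrix.det_fin_two]; simp
  have step : ∀ (t : ℂ) (p : Matrix.SpecialLinearGroup (Fin 2) ℂ × GL (Fin n) ℂ),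
      (∀ r : ℂ, p.1.1 1 0 * r + p.1.1 1 1 ≠ 0 →
        p.2 * expGL (r • e) = cell e f (p.1.1 * !![1, r; 0, 1])) →
      ∀ r : ℂ, (lo t * p.1).1 1 0 * r + (lo t * p.1).1 1 1 ≠ 0 →
        expGL (t • f) * p.2 * expGL (r • e) = cell e f ((lo t * p.1).1 * !![1, r; 0, 1]) := by
    intro t p ih r hr
    obtain ⟨q, hq1, hq2⟩ := exists_avoid _ _ _ _ (row p.1) (row (lo t * p.1))
    have hlo : (lo t * p.1).1 = !![1, 0; t, 1] * p.1.1 := rfl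
    have h1 : expGL (t • f) * p.2 * expGL (q • e) =
        cell e f ((lo t * p.1).1 * !![1, q; 0, 1]) := by
      rw [mul_assoc, ih q hq1, hlo, mul_assoc, s.cell_lo_mul t _ (det1 _ _)]
      · rw [e11]; exact hq1
      · convert hq2 using 1
        simp [hlo, Matrix.mul_apply, Fin.sum_univ_two]; ring
    have h2 : expGL (r • e) = expGL (q • e) * expGL ((r - q) • e) := by
      rw [exp_mul]; congr 2; ring
    have h3 : (!![1, q; 0, 1] : Matrix (Fin 2) (Fin 2) ℂ) * !![1, r - q; 0, 1] =
        !![1, r; 0, 1] := by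
      ext i j; fin_cases i <;> fin_cases j <;> simp
    rw [h2, ← mul_assoc, h1, ← s.cell_mul_up (r - q) _ (det1 _ _), mul_assoc, h3]
    · rw [e11]; exact hq2
    · have h4 : ((lo t * p.1).1 * !![1, q; 0, 1]) 1 0 = (lo t * p.1).1 1 0 := by
        rw [Matrix.mul_apply, Fin.sum_univ_two]; simp
      rw [h4, e11]; convert hr using 1; ring
  have stepUp : ∀ (t : ℂ) (p : Matrix.SpecialLinearGroup (Fin 2) ℂ × GL (Fin n) ℂ),
      (∀ r : ℂ, p.1.1 1 0 * r + p.1.1 1 1 ≠ 0 →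
        p.2 * expGL (r • e) = cell e f (p.1.1 * !![1, r; 0, 1])) →
      ∀ r : ℂ, (up t * p.1).1 1 0 * r + (up t * p.1).1 1 1 ≠ 0 →
        expGL (t • e) * p.2 * expGL (r • e) = cell e f ((up t * p.1).1 * !![1, r; 0, 1]) := by
    intro t p ih r hr
    have hup : (up t * p.1).1 = !![1, t; 0, 1] * p.1.1 := rfl
    have h1 : p.1.1 1 0 * r + p.1.1 1 1 ≠ 0 := by
      convert hr using 1
      simp [hup, Matrix.mul_apply, Fin.sum_univ_two]
    rw [mul_assoc, ih r h1, hup, mul_assoc, cell_up_mul]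
    rw [e11]; exact h1
  have upinv : ∀ t, (up t)⁻¹ = up (-t) := by
    intro t
    rw [inv_eq_iff_mul_eq_one]
    refine Subtype.ext ?_
    change (up t).1 * (up (-t)).1 = 1
    ext i j; fin_cases i <;> fin_cases j <;> simp [up]
  have loinv : ∀ t, (lo t)⁻¹ = lo (-t) := by
    intro t
    rw [inv_eq_iff_mul_eq_one]
    refine Subtype.ext ?_
    change (lo t).1 * (lo (-t)).1 = 1
    ext i j; fin_cases i <;> fin_cases j <;> simp [lo]
  refine Subgroup.closure_induction_left (p := fun p _ => ∀ r : ℂ, p.1.1 1 0 * r + p.1.1 1 1 ≠ 0 →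
      p.2 * expGL (r • e) = cell e f (p.1.1 * !![1, r; 0, 1])) ?_ ?_ ?_ hp
  · intro r _
    simp [cell, sh_one, expGL_zero]
  · rintro x ⟨t, rfl | rfl⟩ y _ ih
    · exact stepUp t y ih
    · exact step t y ih
  · rintro x ⟨t, rfl | rfl⟩ y _ ih
    · have := stepUp (-t) y ih
      simpa only [Prod.fst_mul, Prod.snd_mul, Prod.fst_inv, Prod.snd_inv, upinv, exp_inv] using this
    · have := step (-t) y ih
      simpa only [Prod.fst_mul, Prod.snd_mul, Prod.fst_inv, Prod.snd_inv, loinv, exp_inv] using this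

theorem eq_cell (s : IsMatrixSl2 e f h)
    {p : Matrix.SpecialLinearGroup (Fin 2) ℂ × GL (Fin n) ℂ} (hp : p ∈ slGraph e f)
    (hd : p.1.1 1 1 ≠ 0) : p.2 = cell e f p.1.1 := by
  have := s.mul_exp_eq_cell hp 0 (by simpa using hd)
  have h1 : (!![1, 0; 0, 1] : Matrix (Fin 2) (Fin 2) ℂ) = 1 := Matrix.one_fin_two.symm
  rwa [exp_zero, mul_one, h1, mul_one] at this

/-- The linear map from `2 × 2` matrices to `gl_n` given on traceless matrices by the triple. -/
def slMap (e f h : Matrix (Fin n) (Fin n) ℂ) (m : Matrix (Fin 2) (Fin 2) ℂ) :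
    Matrix (Fin n) (Fin n) ℂ := m 0 0 • h + m 0 1 • e + m 1 0 • f

theorem coe_inv_sl (M : Matrix.SpecialLinearGroup (Fin 2) ℂ) :
    (M⁻¹).1 = !![M.1 1 1, -M.1 0 1; -M.1 1 0, M.1 0 0] := by
  rw [Matrix.SpecialLinearGroup.coe_inv, Matrix.adjugate_fin_two]

theorem coe_up (t : ℂ) : (up t).1 = !![1, t; 0, 1] := rfl

theorem coe_lo (t : ℂ) : (lo t).1 = !![1, 0; t, 1] := rfl

/-- The graph of the homomorphism intertwines the adjoint actions. -/
theorem Ad_slMap (s : IsMatrixSl2 e f h)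
    {p : Matrix.SpecialLinearGroup (Fin 2) ℂ × GL (Fin n) ℂ} (hp : p ∈ slGraph e f)
    (m : Matrix (Fin 2) (Fin 2) ℂ) (hm : m 1 1 = -m 0 0) :
    Ad p.2 (slMap e f h m) = slMap e f h (p.1.1 * m * (p.1⁻¹).1) ∧
      (p.1.1 * m * (p.1⁻¹).1) 1 1 = -(p.1.1 * m * (p.1⁻¹).1) 0 0 := by
  have tr : ∀ (M : Matrix.SpecialLinearGroup (Fin 2) ℂ) (m : Matrix (Fin 2) (Fin 2) ℂ),
      m 1 1 = -m 0 0 → (M.1 * m * (M⁻¹).1) 1 1 = -(M.1 * m * (M⁻¹).1) 0 0 := by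
    intro M m hm
    rw [coe_inv_sl]
    simp [Matrix.mul_apply, Fin.sum_univ_two, hm]; ring
  refine ⟨?_, tr _ _ hm⟩
  induction hp using Subgroup.closure_induction generalizing m with
  | mem x hx =>
    obtain ⟨t, rfl | rfl⟩ := hx
    · simp only [slMap, Ad_add, Ad_smul, s.Ad_exp_e_h, s.Ad_exp_e_f, Ad_exp_e_e,
        coe_inv_sl, coe_up]
      simp only [Matrix.mul_apply, Fin.sum_univ_two]
      simp [hm]
      match_scalars <;> ring
    · have h1 : Ad (expGL (t • f)) f = f := Ad_exp_e_e t
      simp only [slMap, Ad_add, Ad_smul, s.Ad_exp_f_h, s.Ad_exp_f_e, h1,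
        coe_inv_sl, coe_lo]
      simp only [Matrix.mul_apply, Fin.sum_univ_two]
      simp [hm]
      match_scalars <;> ring
  | one => simp [Ad_one]
  | mul x y hx hy ihx ihy =>
    rw [Prod.snd_mul, Ad_mul, ihy m hm, ihx _ (tr _ _ hm)]
    simp only [Prod.fst_mul, mul_inv_rev, Matrix.SpecialLinearGroup.coe_mul, mul_assoc]
  | inv x hx ih =>
    rw [Prod.snd_inv, Ad_inv_eq_iff, ih _ (tr _ _ hm)]
    congr 1
    have h1 : x.1.1 * (x.1⁻¹).1 = 1 := by
      rw [← Matrix.SpecialLinearGroup.coe_mul, mul_inv_cancel]; rfl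
    simp only [Prod.fst_inv, inv_inv, mul_assoc, h1, mul_one]
    rw [← mul_assoc, h1, one_mul]

end IsMatrixSl2

/-! ### The relations between the reflections of a root system -/

section Relations

variable {ι k V V' : Type*} [Field k] [AddCommGroup V] [AddCommGroup V']
  [Module k V] [Module k V'] (P : RootPairing ι k V V')
  {Q : Type*} [Group Q] {r : ι → Q}

theorem reflectionPerm_reflectionPerm (i j : ι) :
    P.reflectionPerm (P.reflectionPerm i j) =
      P.reflectionPerm i * P.reflectionPerm j * P.reflectionPerm i := by
  ext m
  apply P.root.injective
  simp [RootPairing.reflection_reflectionPerm]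

theorem reflectionPerm_mul_self (i : ι) : P.reflectionPerm i * P.reflectionPerm i = 1 := by
  ext; simp

theorem prod_mul_eq_of_conj (h2 : ∀ i, r i * r i = 1)
    (hc : ∀ i j, r i * r j * r i = r (P.reflectionPerm i j)) (l : List ι) (m : ι) :
    (l.map r).prod * r m = r ((l.map P.reflectionPerm).prod m) * (l.map r).prod := by
  induction l with
  | nil => simp
  | cons a l ih =>
    simp only [List.map_cons, List.prod_cons, mul_assoc, ih, Equiv.Perm.mul_apply, ← hc a]
    rw [← mul_assoc (r a) (r a), h2, one_mul]

variable [Finite ι] [CharZero k] [P.IsCrystallographic] [P.IsReduced]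

/-- If a product of simple reflections makes a positive root `m` negative, then some factor is the
reflection in the image of `m` under the factors to its right. -/
theorem exists_split_of_not_isPos (b : P.Base) (l : List ι) (hl : ∀ i ∈ l, i ∈ b.support) (m : ι)
    (hm : b.IsPos m) (h : ¬ b.IsPos ((l.map P.reflectionPerm).prod m)) :
    ∃ l₁ j l₂, l = l₁ ++ j :: l₂ ∧ (l₂.map P.reflectionPerm).prod m = j := by
  induction l with
  | nil => exact absurd hm (by simpa using h)
  | cons a l ih =>
    by_cases h' : b.IsPos ((l.map P.reflectionPerm).prod m)
    · refine ⟨[], a, l, rfl, ?_⟩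
      by_contra hne
      exact h (by simpa using h'.reflectionPerm (hl a (by simp)) (Ne.symm (Ne.symm hne)))
    · obtain ⟨l₁, j, l₂, rfl, hj⟩ := ih (fun i hi => hl i (by simp [hi])) h'
      exact ⟨a :: l₁, j, l₂, rfl, hj⟩

/-- A product of simple reflections is trivial only as a consequence of the relations `h2`, `hc`:
by the exchange property two factors cancel. -/
theorem prod_eq_one_of_simple (b : P.Base) (h2 : ∀ i, r i * r i = 1)
    (hc : ∀ i j, r i * r j * r i = r (P.reflectionPerm i j)) (N : ℕ) :
    ∀ l : List ι, l.length ≤ N → (∀ i ∈ l, i ∈ b.support) →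
      (l.map P.reflectionPerm).prod = 1 → (l.map r).prod = 1 := by
  induction N with
  | zero => intro l hl _ _; simp [List.length_eq_zero_iff.mp (Nat.le_zero.mp hl)]
  | succ N ih =>
    intro l hl hs h1
    rcases List.eq_nil_or_concat l with rfl | ⟨l', m, rfl⟩
    · simp
    have hm : m ∈ b.support := hs m (by simp)
    have hprod : (l'.map P.reflectionPerm).prod = P.reflectionPerm m := by
      simp only [List.concat_eq_append, List.map_append, List.prod_append, List.map_cons,
        List.map_nil, List.prod_cons, List.prod_nil, mul_one] at h1
      rw [mul_eq_one_iff_eq_inv.mp h1, RootPairing.reflectionPerm_inv]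
    have hpos := RootPairing.Base.isPos_of_mem_support (b := b) hm
    have hneg : ¬ b.IsPos ((l'.map P.reflectionPerm).prod m) := by
      rw [hprod]
      exact fun h => (RootPairing.Base.IsPos.neg_iff_not b m).mp h hpos
    obtain ⟨l₁, j, l₂, rfl, hj⟩ := exists_split_of_not_isPos P b l'
      (fun i hi => hs i (by simp [hi])) m hpos hneg
    have e1 := prod_mul_eq_of_conj P h2 hc l₂ m
    have e2 := prod_mul_eq_of_conj P (reflectionPerm_mul_self P)
      (fun i j => (reflectionPerm_reflectionPerm P i j).symm) l₂ m
    rw [hj] at e1 e2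
    have key := ih (l₁ ++ l₂) (by simp at hl ⊢; omega) (fun i hi => hs i (by
      simp at hi ⊢; tauto)) (by
      rw [← h1]
      simp only [List.concat_eq_append, List.map_append, List.prod_append, List.map_cons,
        List.map_nil, List.prod_cons, List.prod_nil, mul_one, mul_assoc, e2]
      rw [← mul_assoc (P.reflectionPerm j), reflectionPerm_mul_self, one_mul])
    rw [← key]
    simp only [List.concat_eq_append, List.map_append, List.prod_append, List.map_cons,
        List.map_nil, List.prod_cons, List.prod_nil, mul_one, mul_assoc, e1]
    rw [← mul_assoc (r j), h2, one_mul]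

/-- Let `r i` be involutions of a group, indexed by the roots and permuted by each other under
conjugation like the reflections. If a product of the `r i` corresponds to a trivial product of
reflections, then it is trivial. -/
theorem eq_one_of_mem_closure [P.IsRootSystem] (h2 : ∀ i, r i * r i = 1)
    (hc : ∀ i j, r i * r j * r i = r (P.reflectionPerm i j)) {q : Q}
    (hq : ((q, 1) : Q × Equiv.Perm ι) ∈
      Subgroup.closure (Set.range fun i => (r i, P.reflectionPerm i))) : q = 1 := by
  obtain ⟨b⟩ := P.nonempty_base
  set g : ι → Q × Equiv.Perm ι := fun i => (r i, P.reflectionPerm i) with hg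
  have g2 : ∀ i, g i * g i = 1 := fun i => Prod.ext (h2 i) (reflectionPerm_mul_self P i)
  have gc : ∀ i j, g i * g j * g i = g (P.reflectionPerm i j) := fun i j =>
    Prod.ext (hc i j) (reflectionPerm_reflectionPerm P i j).symm
  have simple : ∀ i, g i ∈ Subgroup.closure (g '' b.support) := by
    intro i
    refine b.induction_reflect i (p := fun i => g i ∈ Subgroup.closure (g '' b.support)) ?_ ?_ ?_
    · intro i hi; rw [← gc]; exact mul_mem (mul_mem hi hi) hi
    · intro i hi; exact Subgroup.subset_closure ⟨i, hi, rfl⟩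
    · intro i j hi hj
      rw [← gc]
      have := Subgroup.subset_closure (Set.mem_image_of_mem g (Finset.mem_coe.mpr hj))
      exact mul_mem (mul_mem this hi) this
  have hq' : ((q, 1) : Q × Equiv.Perm ι) ∈ Subgroup.closure (g '' b.support) := by
    refine (Subgroup.closure_le _).mpr ?_ hq
    rintro _ ⟨i, rfl⟩; exact simple i
  have list : ∀ x ∈ Subgroup.closure (g '' b.support),
      ∃ l : List ι, (∀ i ∈ l, i ∈ b.support) ∧ x = (l.map g).prod := by
    intro x hx
    induction hx using Subgroup.closure_induction_left with
    | one => exact ⟨[], by simp, by simp⟩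
    | mul_left x hx y _ ih =>
      obtain ⟨i, hi, rfl⟩ := hx
      obtain ⟨l, hl, rfl⟩ := ih
      exact ⟨i :: l, by simpa using ⟨hi, hl⟩, by simp⟩
    | inv_mul_cancel x hx y _ ih =>
      obtain ⟨i, hi, rfl⟩ := hx
      obtain ⟨l, hl, rfl⟩ := ih
      exact ⟨i :: l, by simpa using ⟨hi, hl⟩, by
        rw [List.map_cons, List.prod_cons, inv_eq_of_mul_eq_one_left (g2 i)]⟩
  obtain ⟨l, hl, e⟩ := list _ hq'
  have e1 : ∀ l : List ι, (l.map g).prod = ((l.map r).prod, (l.map P.reflectionPerm).prod) := by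
    intro l; induction l with
    | nil => rfl
    | cons a l ih => rw [List.map_cons, List.prod_cons, ih]; simp [hg]
  rw [e1, Prod.mk.injEq] at e
  rw [e.1]
  exact prod_eq_one_of_simple P b h2 hc _ l le_rfl hl e.2.symm

end Relations

/-! ### Root vectors of a Chevalley basis -/

section RootVectors

open LieAlgebra LieAlgebra.IsKilling LieModule

variable {L : Type*} [LieRing L] [LieAlgebra ℂ L] [FiniteDimensional ℂ L]
  [LieAlgebra.IsKilling ℂ L] {H : LieSubalgebra ℂ L} [H.IsCartanSubalgebra]

theorem negRoot_negRoot (α : H.root) : negRoot (negRoot α) = α :=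
  Subtype.ext (neg_neg α.1)

theorem isNonZero_root (α : H.root) : α.1.IsNonZero := (Finset.mem_filter.mp α.2).2

theorem coroot_negRoot (α : H.root) : coroot (negRoot α).1 = -coroot α.1 := coroot_neg α.1

theorem root_ext {α β : H.root} (h : (α.1 : H → ℂ) = β.1) : α = β :=
  Subtype.ext (DFunLike.coe_injective h)

/-- The numbers `β(α^∨)` are integers, hence fixed under the complex conjugation. -/
theorem conj_apply_coroot (α β : LieModule.Weight ℂ H L) :
    starRingEnd ℂ (β (coroot α)) = β (coroot α) := by
  rw [apply_coroot_eq_cast α β, map_intCast]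

theorem span_coroot : Submodule.span ℂ (Set.range fun α : H.root => coroot α.1) = ⊤ :=
  RootPairing.IsRootSystem.span_coroot_eq_top (P := rootSystem H)

theorem coroot_reflectionPerm (α β : H.root) :
    coroot ((Phi H).reflectionPerm α β).1 = coroot β.1 - (α.1 (coroot β.1)) • coroot α.1 := by
  have := RootPairing.coroot_reflectionPerm (Phi H) α β
  rw [RootPairing.coreflection_apply] at this
  exact this

theorem coe_reflectionPerm (α β : H.root) (h : H) :
    ((Phi H).reflectionPerm α β).1 h = β.1 h - β.1 (coroot α.1) * α.1 h := by
  have := congrArg (fun f : Module.Dual ℂ H => f h) (RootPairing.root_reflectionPerm (Phi H) α β)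
  simp only [RootPairing.reflection_apply, rootSystem_root_apply] at this
  simpa using this

/-- `[e, [f, y]]` is a nonnegative real multiple of a vector `y` of a root space. -/
theorem exists_lie_lie_eq_smul {α : LieModule.Weight ℂ H L} (hα : α.IsNonZero) {e f : L}
    (t : IsSl2Triple (coroot α : L) e f) (he : e ∈ rootSpace H α) (hf : f ∈ rootSpace H (-α))
    {μ : LieModule.Weight ℂ H L} (hμ : μ.IsNonZero) {y : L} (hy : y ∈ rootSpace H μ) :
    ∃ r : ℝ, 0 ≤ r ∧ ⁅e, ⁅f, y⁆⁆ = (r : ℂ) • y := by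
  obtain ⟨x, hx, x_ne0⟩ := (chainTop α μ).exists_ne_zero
  have prim : t.HasPrimitiveVectorWith x (chainLength α μ : ℂ) :=
    have := lie_mem_genWeightSpace_of_mem_genWeightSpace he hx
    ⟨x_ne0, (chainLength_smul _ _ hx).symm, by rwa [genWeightSpace_add_chainTop _ _ hα] at this⟩
  set k := chainTopCoeff α μ with hk
  have hkl : k ≤ chainLength α μ := chainTopCoeff_le_chainLength α μ
  have hne := prim.pow_toEnd_f_ne_zero_of_eq_nat rfl hkl
  have hmem := toEnd_pow_apply_mem hf hx k
  have hw : (k • (-α : H → ℂ) + chainTop α μ : H → ℂ) = μ := by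
    rw [coe_chainTop', smul_neg, neg_add_cancel_left]
  have hmem' : ((toEnd ℂ L L f) ^ k) x ∈ rootSpace H μ := by
    rw [← hw]; exact hmem
  obtain ⟨c, hc⟩ : ∃ c : ℂ, c • ((toEnd ℂ L L f) ^ k) x = y := by
    simpa using (finrank_eq_one_iff_of_nonzero' ⟨((toEnd ℂ L L f) ^ k) x, hmem'⟩
      (by simpa using hne)).mp (finrank_rootSpace_eq_one _ hμ) ⟨y, hy⟩
  refine ⟨((k : ℝ) + 1) * ((chainLength α μ : ℝ) - k), ?_, ?_⟩
  · have : (k : ℝ) ≤ chainLength α μ := by exact_mod_cast hkl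
    exact mul_nonneg (by positivity) (by linarith)
  · have := prim.lie_e_pow_succ_toEnd_f k
    rw [pow_succ', Module.End.mul_apply, toEnd_apply_apply] at this
    rw [← hc, lie_smul, lie_smul, this, smul_comm]
    push_cast
    rfl

theorem killingForm_lie (x y z : L) : killingForm ℂ L ⁅x, y⁆ z = killingForm ℂ L x ⁅y, z⁆ :=
  LieModule.traceForm_apply_lie_apply ℂ L L x y z

namespace ChevalleyData

variable {n : ℕ} (D : ChevalleyData H n)

theorem X_neg_mem (α : H.root) : D.X (negRoot α) ∈ rootSpace H (-α.1 : H → ℂ) :=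
  D.X_mem (negRoot α)

theorem coroot_lie_X (α β : H.root) :
    ⁅(coroot α.1 : L), D.X β⁆ = β.1 (coroot α.1) • D.X β :=
  lie_eq_smul_of_mem_rootSpace (D.X_mem β) (coroot α.1)

theorem X_ne_zero (α : H.root) : D.X α ≠ 0 := by
  intro h
  have := D.lie_X_neg α
  rw [h, zero_lie, eq_comm, ZeroMemClass.coe_eq_zero, coroot_eq_zero_iff] at this
  exact isNonZero_root α this

theorem isSl2Triple (α : H.root) :
    IsSl2Triple (coroot α.1 : L) (D.X α) (D.X (negRoot α)) where
  h_ne_zero := by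
    simp [isNonZero_root α]
  lie_e_f := D.lie_X_neg α
  lie_h_e_nsmul := by
    rw [D.coroot_lie_X, root_apply_coroot (isNonZero_root α), ← Nat.cast_smul_eq_nsmul ℂ]; simp
  lie_h_f_nsmul := by
    rw [D.coroot_lie_X, ← Nat.cast_smul_eq_nsmul ℂ, ← neg_smul]
    congr 1
    change -(α.1 (coroot α.1)) = _
    rw [root_apply_coroot (isNonZero_root α)]; simp

theorem exists_eq_smul_X (γ : H.root) {y : L} (hy : y ∈ rootSpace H γ.1) :
    ∃ c : ℂ, y = c • D.X γ := by
  obtain ⟨c, hc⟩ : ∃ c : ℂ, c • D.X γ = y := by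
    simpa using (finrank_eq_one_iff_of_nonzero' ⟨D.X γ, D.X_mem γ⟩
      (by simpa using D.X_ne_zero γ)).mp
        (finrank_rootSpace_eq_one _ (isNonZero_root γ)) ⟨y, hy⟩
  exact ⟨c, hc.symm⟩

/-- `κ(X_α, X_{-α})` is a positive real number: it is half of the sum of the squares of the
integers `β(α^∨)`. -/
theorem exists_killingForm_X (α : H.root) :
    ∃ r : ℝ, 0 < r ∧ killingForm ℂ L (D.X α) (D.X (negRoot α)) = r := by
  have h1 : killingForm ℂ L (coroot α.1 : L) (coroot α.1 : L) =
      2 * killingForm ℂ L (D.X α) (D.X (negRoot α)) := by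
    have := killingForm_lie (D.X α) (D.X (negRoot α)) (coroot α.1 : L)
    rw [D.lie_X_neg] at this
    rw [this, ← lie_skew, D.coroot_lie_X, map_neg, map_smul]
    change -(-(α.1 (coroot α.1)) • _) = _
    rw [root_apply_coroot (isNonZero_root α)]; simp
  have h2 : killingForm ℂ L (coroot α.1 : L) (coroot α.1 : L) =
      ∑ β ∈ H.root, (β (coroot α.1)) * (β (coroot α.1)) := by
    have := congrArg (fun B => B (coroot α.1) (coroot α.1))
      (restrict_killingForm_eq_sum (K := ℂ) (L := L) (H := H))
    simp only [LinearMap.sum_apply, LinearMap.smulRight_apply, LinearMap.smul_apply,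
      smul_eq_mul] at this
    exact this
  have h3 : ∑ β ∈ H.root, (β (coroot α.1)) * (β (coroot α.1)) =
      ((∑ β ∈ H.root, ((chainBotCoeff α.1 β - chainTopCoeff α.1 β : ℤ) : ℝ) ^ 2 : ℝ) : ℂ) := by
    push_cast
    refine Finset.sum_congr rfl fun β _ => ?_
    rw [apply_coroot_eq_cast α.1 β, sq]; push_cast; rfl
  set S : ℝ := ∑ β ∈ H.root, ((chainBotCoeff α.1 β - chainTopCoeff α.1 β : ℤ) : ℝ) ^ 2 with hS
  have hS0 : 0 ≤ S := Finset.sum_nonneg fun _ _ => sq_nonneg _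
  have h4 : killingForm ℂ L (D.X α) (D.X (negRoot α)) = ((S / 2 : ℝ) : ℂ) := by
    rw [h2, h3] at h1
    push_cast
    rw [h1]; ring
  refine ⟨S / 2, ?_, h4⟩
  rcases hS0.lt_or_eq with h | h
  · linarith
  · exfalso
    rw [← h] at h4
    have h5 := lie_eq_killingForm_smul_of_mem_rootSpace_of_mem_rootSpace_neg (D.X_mem α)
      (D.X_neg_mem α)
    rw [h4, D.lie_X_neg] at h5
    simp only [zero_div, Complex.ofReal_zero, zero_smul, ZeroMemClass.coe_eq_zero,
      coroot_eq_zero_iff] at h5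
    exact isNonZero_root α h5

/-- The structure constants of a Chevalley basis are real: `N²` is a nonnegative real number. -/
theorem conj_structure_constant {α β γ : H.root} {N : ℂ} (h1 : ⁅D.X α, D.X β⁆ = N • D.X γ)
    (h2 : ⁅D.X (negRoot α), D.X (negRoot β)⁆ = (-N) • D.X (negRoot γ)) :
    starRingEnd ℂ N = N := by
  obtain ⟨r, hr, e⟩ := exists_lie_lie_eq_smul (isNonZero_root α) (D.isSl2Triple α) (D.X_mem α)
    (D.X_neg_mem α) (isNonZero_root (negRoot β)) (D.X_mem (negRoot β))
  obtain ⟨a, ha, ea⟩ := D.exists_killingForm_X β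
  obtain ⟨b, hb, eb⟩ := D.exists_killingForm_X γ
  have h3 : killingForm ℂ L ⁅D.X β, D.X α⁆ ⁅D.X (negRoot α), D.X (negRoot β)⁆ = (r * a : ℝ) := by
    rw [killingForm_lie, e, map_smul, ea]; simp
  rw [← lie_skew, h1, h2] at h3
  simp only [map_neg, map_smul, LinearMap.neg_apply, LinearMap.smul_apply, eb, smul_eq_mul,
    neg_smul] at h3
  have h4 : N * N = ((r * a / b : ℝ) : ℂ) := by
    have : (b : ℂ) ≠ 0 := by exact_mod_cast hb.ne'
    push_cast at h3 ⊢
    field_simp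
    linear_combination h3
  have h5 : 0 ≤ r * a / b := by positivity
  have re := congrArg Complex.re h4
  have im := congrArg Complex.im h4
  simp only [Complex.mul_re, Complex.mul_im, Complex.ofReal_re, Complex.ofReal_im] at re im
  rw [Complex.conj_eq_iff_im]
  by_contra hne
  have h6 : N.re = 0 := by
    have : N.im * N.re = 0 := by linarith
    exact (mul_eq_zero.mp this).resolve_left hne
  rw [h6] at re
  have := mul_self_pos.mpr hne
  nlinarith

end ChevalleyData

end RootVectors

/-! ### The torus and the representatives of the reflections -/

section Torus

open LieAlgebra LieAlgebra.IsKilling LieModule IsMatrixSl2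

variable {L : Type*} [LieRing L] [LieAlgebra ℂ L] [FiniteDimensional ℂ L]
  [LieAlgebra.IsKilling ℂ L] {H : LieSubalgebra ℂ L} [H.IsCartanSubalgebra]

namespace ChevalleyData

variable {n : ℕ} (D : ChevalleyData H n)

/-- The matrix of the root vector `X_α`. -/
def E (α : H.root) : Matrix (Fin n) (Fin n) ℂ := D.ρ (D.X α)

/-- The matrix of the coroot `α^∨`. -/
def Hc (α : H.root) : Matrix (Fin n) (Fin n) ℂ := D.ρ (coroot α.1 : L)

theorem isMatrixSl2 (α : H.root) : IsMatrixSl2 (D.E α) (D.E (negRoot α)) (D.Hc α) where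
  ef := by rw [E, E, ← D.ρ_lie, D.lie_X_neg]; rfl
  he := by
    rw [E, Hc, ← D.ρ_lie, D.coroot_lie_X, map_smul, root_apply_coroot (isNonZero_root α)]
  hf := by
    rw [E, Hc, ← D.ρ_lie, D.coroot_lie_X, map_smul]
    change (-(α.1 (coroot α.1))) • _ = _
    rw [root_apply_coroot (isNonZero_root α)]

theorem x_eq (α : H.root) (t : ℂ) : D.x α t = expGL (t • D.E α) := rfl

theorem w_eq (α : H.root) (t : ℂˣ) : D.w α t = sw (D.E α) (D.E (negRoot α)) t := rfl

theorem omega_eq (α : H.root) : D.omega α = sw (D.E α) (D.E (negRoot α)) 1 := rfl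

theorem h_eq (α : H.root) (t : ℂˣ) : D.h α t = sh (D.E α) (D.E (negRoot α)) t := rfl

theorem x_inv (α : H.root) (t : ℂ) : (D.x α t)⁻¹ = D.x α (-t) := exp_inv t

theorem comm_rho (a b : H) : Commute (D.ρ a) (D.ρ b) := by
  have h : ⁅(a : L), (b : L)⁆ = 0 := by
    rw [← LieSubalgebra.coe_bracket, trivial_lie_zero]; rfl
  have := D.ρ_lie a b
  rw [h, map_zero, eq_comm, sub_eq_zero] at this
  exact this

/-- The torus consists of the exponentials of the elements of the Cartan subalgebra. -/
theorem mem_T_iff (g : GL (Fin n) ℂ) : g ∈ D.T ↔ ∃ a : H, g = expGL (D.ρ a) := by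
  constructor
  · intro hg
    refine Subgroup.closure_induction (p := fun g _ => ∃ a : H, g = expGL (D.ρ a)) ?_ ?_ ?_ ?_ hg
    · rintro g ⟨α, t, rfl⟩
      refine ⟨Complex.log t • coroot α.1, ?_⟩
      rw [h_eq, (D.isMatrixSl2 α).sh_eq_exp t.ne_zero, Hc]
      simp
    · exact ⟨0, by simp [expGL_zero]⟩
    · rintro _ _ _ _ ⟨a, rfl⟩ ⟨b, rfl⟩
      exact ⟨a + b, by rw [← expGL_add (D.comm_rho a b)]; simp⟩
    · rintro _ _ ⟨a, rfl⟩
      exact ⟨-a, by rw [← expGL_neg]; simp⟩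
  · rintro ⟨a, rfl⟩
    have key : ∀ c : ℂ, expGL (D.ρ ((c • a : H) : L)) ∈ D.T := by
      have ha : a ∈ Submodule.span ℂ (Set.range fun α : H.root => coroot α.1) := by
        rw [span_coroot]; trivial
      induction ha using Submodule.span_induction with
      | mem x hx =>
        obtain ⟨α, rfl⟩ := hx
        intro c
        refine Subgroup.subset_closure ⟨α, Units.mk0 (Complex.exp c) (Complex.exp_ne_zero c), ?_⟩
        rw [h_eq, Units.val_mk0, (D.isMatrixSl2 α).sh_exp, Hc]; simp
      | zero => intro c; simp [expGL_zero]
      | add x y _ _ hx hy =>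
        intro c
        have := mul_mem (hx c) (hy c)
        rw [← expGL_add (D.comm_rho _ _)] at this
        simpa using this
      | smul b x _ hx => intro c; rw [smul_smul]; exact hx _
    simpa using key 1

theorem Ad_T_rho {g : GL (Fin n) ℂ} (hg : g ∈ D.T) (a : H) : Ad g (D.ρ a) = D.ρ a := by
  obtain ⟨b, rfl⟩ := (D.mem_T_iff g).mp hg
  exact Ad_expGL_of_commute (D.comm_rho b a)

theorem Ad_T_E {g : GL (Fin n) ℂ} (hg : g ∈ D.T) (β : H.root) :
    ∃ c : ℂ, Ad g (D.E β) = c • D.E β := by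
  obtain ⟨b, rfl⟩ := (D.mem_T_iff g).mp hg
  refine ⟨Complex.exp (β.1 b), Ad_expGL_of_comm_smul ?_⟩
  rw [E, ← D.ρ_lie, ← map_smul]
  exact congrArg D.ρ (lie_eq_smul_of_mem_rootSpace (D.X_mem β) b)

theorem Ad_omega_rho (α : H.root) (a : H) :
    Ad (D.omega α) (D.ρ a) = D.ρ ((a - α.1 a • coroot α.1 : H) : L) := by
  have h1 : D.ρ a * D.E α - D.E α * D.ρ a = α.1 a • D.E α := by
    rw [E, ← D.ρ_lie, ← map_smul]
    exact congrArg D.ρ (lie_eq_smul_of_mem_rootSpace (D.X_mem α) a)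
  have h2 : D.ρ a * D.E (negRoot α) - D.E (negRoot α) * D.ρ a = (-α.1 a) • D.E (negRoot α) := by
    rw [E, ← D.ρ_lie, ← map_smul]
    exact congrArg D.ρ (lie_eq_smul_of_mem_rootSpace (D.X_mem (negRoot α)) a)
  rw [omega_eq, (D.isMatrixSl2 α).Ad_sw_of_weight one_ne_zero h1 h2, Hc]
  simp

theorem exists_Ad_x_rho (α : H.root) (t : ℂ) (y : L) : ∃ z : L, Ad (D.x α t) (D.ρ y) = D.ρ z := by
  have := Ad_expGL_mem (LinearMap.range D.ρ) (t • D.E α) (by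
    rintro _ ⟨y, rfl⟩
    exact ⟨⁅t • D.X α, y⁆, by rw [D.ρ_lie, map_smul]; rfl⟩) ⟨y, rfl⟩
  obtain ⟨z, hz⟩ := this
  exact ⟨z, hz.symm⟩

theorem weight_sub_smul (γ : LieModule.Weight ℂ H L) (a b : H) (c : ℂ) :
    γ (a - c • b) = γ a - c * γ b := by
  have := map_sub (Weight.toLinear ℂ H L γ) a (c • b)
  rw [map_smul] at this
  exact this

/-- `Ad(ω_α)` maps the root space of `β` to the one of `s_α(β)`. -/
theorem Ad_omega_E (α β : H.root) :
    ∃ c : ℂ, Ad (D.omega α) (D.E β) = c • D.E ((Phi H).reflectionPerm α β) := by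
  obtain ⟨y₁, h₁⟩ := D.exists_Ad_x_rho α 1 (D.X β)
  obtain ⟨y₂, h₂⟩ := D.exists_Ad_x_rho (negRoot α) (-((1 : ℂˣ) : ℂ)⁻¹) y₁
  obtain ⟨y, h₃⟩ := D.exists_Ad_x_rho α 1 y₂
  have hy : Ad (D.omega α) (D.E β) = D.ρ y := by
    rw [← h₃, ← h₂, ← h₁, ← Ad_mul, ← Ad_mul]; rfl
  have hmem : y ∈ rootSpace H ((Phi H).reflectionPerm α β).1 := by
    refine weightSpace_le_genWeightSpace L _ ((mem_weightSpace _ _).mpr fun a => ?_)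
    apply D.ρ_injective
    set a' : H := a - α.1 a • coroot α.1 with ha'
    have h4 : Ad (D.omega α) (D.ρ a') = D.ρ a := by
      rw [Ad_omega_rho]
      rw [ha', weight_sub_smul, root_apply_coroot (isNonZero_root α)]
      congr 2
      module
    have h5 : D.ρ ⁅(a' : L), D.X β⁆ = β.1 a' • D.E β := by
      rw [E, ← map_smul]
      exact congrArg D.ρ (lie_eq_smul_of_mem_rootSpace (D.X_mem β) a')
    have h6 : D.ρ ⁅(a : L), y⁆ = β.1 a' • D.ρ y := by
      rw [D.ρ_lie, ← hy, ← h4, ← Ad_mul_mul, ← Ad_mul_mul, ← Ad_sub, ← Ad_smul, ← h5, D.ρ_lie]; rfl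
    rw [map_smul, coe_reflectionPerm]
    refine h6.trans ?_
    rw [ha', weight_sub_smul, mul_comm (α.1 a)]
  obtain ⟨c, hc⟩ := D.exists_eq_smul_X _ hmem
  exact ⟨c, by rw [hy, hc, map_smul]; rfl⟩

theorem E_ne_zero (α : H.root) : D.E α ≠ 0 := by
  rw [E, Ne, map_eq_zero_iff _ D.ρ_injective]; exact D.X_ne_zero α

theorem Hc_injective : Function.Injective D.Hc := by
  intro α β h
  have := D.ρ_injective h
  rw [SetLike.coe_eq_coe, coroot_eq_iff] at this
  exact Subtype.ext this

theorem Hc_negRoot (α : H.root) : D.Hc (negRoot α) = -D.Hc α := by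
  rw [Hc, coroot_negRoot, Hc, ← map_neg]; rfl

/-- `g` acts on the root spaces and on the coroots by the permutation `π` of the roots. -/
structure Acts (π : Equiv.Perm H.root) (g : GL (Fin n) ℂ) : Prop where
  coroot : ∀ β, Ad g (D.Hc β) = D.Hc (π β)
  E : ∀ β, ∃ c : ℂ, Ad g (D.E β) = c • D.E (π β)

namespace Acts

variable {D} {π π' : Equiv.Perm H.root} {g g' : GL (Fin n) ℂ}

theorem mul (h : D.Acts π g) (h' : D.Acts π' g') : D.Acts (π * π') (g * g') where
  coroot β := by rw [Ad_mul, h'.coroot, h.coroot]; rfl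
  E β := by
    obtain ⟨c, hc⟩ := h'.E β
    obtain ⟨d, hd⟩ := h.E (π' β)
    exact ⟨c * d, by rw [Ad_mul, hc, Ad_smul, hd, smul_smul]; rfl⟩

theorem ne_zero {β : H.root} {c : ℂ} (h : Ad g (D.E β) = c • D.E (π β)) : c ≠ 0 := by
  rintro rfl
  rw [zero_smul] at h
  have := (Ad_inv_eq_iff g 0 (D.E β)).mpr h.symm
  exact D.E_ne_zero β (by rw [← this]; simp [Ad])

theorem inv (h : D.Acts π g) : D.Acts π⁻¹ g⁻¹ where
  coroot β := by rw [Ad_inv_eq_iff, h.coroot]; simp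
  E β := by
    obtain ⟨c, hc⟩ := h.E (π⁻¹ β)
    refine ⟨c⁻¹, ?_⟩
    rw [Ad_inv_eq_iff, Ad_smul, hc, smul_smul, inv_mul_cancel₀ (ne_zero hc)]; simp

theorem map_negRoot (h : D.Acts π g) (β : H.root) : π (negRoot β) = negRoot (π β) := by
  apply D.Hc_injective
  rw [← h.coroot, Hc_negRoot, Hc_negRoot, Ad_neg, h.coroot]

/-- The scalars at opposite roots are inverse to each other. -/
theorem E_negRoot (h : D.Acts π g) {β : H.root} {c : ℂ} (hc : Ad g (D.E β) = c • D.E (π β)) :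
    Ad g (D.E (negRoot β)) = c⁻¹ • D.E (negRoot (π β)) := by
  obtain ⟨d, hd⟩ := h.E (negRoot β)
  rw [h.map_negRoot] at hd
  have h1 := congrArg (Ad g) (D.isMatrixSl2 β).ef
  rw [Ad_sub, Ad_mul_mul, Ad_mul_mul, hc, hd, h.coroot, ← (D.isMatrixSl2 (π β)).ef] at h1
  simp only [smul_mul_assoc, mul_smul_comm, smul_smul] at h1
  rw [mul_comm d c, ← smul_sub, (D.isMatrixSl2 (π β)).ef] at h1
  have h2 : D.Hc (π β) ≠ 0 := by
    intro h0
    have := (map_eq_zero_iff _ D.ρ_injective).mp h0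
    rw [ZeroMemClass.coe_eq_zero, coroot_eq_zero_iff] at this
    exact isNonZero_root _ this
  have h3 : c * d = 1 := by
    have : (c * d - 1) • D.Hc (π β) = 0 := by rw [sub_smul, h1, one_smul, sub_self]
    exact sub_eq_zero.mp ((smul_eq_zero.mp this).resolve_right h2)
  rw [hd, eq_inv_of_mul_eq_one_right h3]

theorem exists_rho (h : D.Acts π g) (a : H) : ∃ b : H, Ad g (D.ρ a) = D.ρ b := by
  have ha : a ∈ Submodule.span ℂ (Set.range fun α : H.root => IsKilling.coroot α.1) := by
    rw [span_coroot]; trivial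
  induction ha using Submodule.span_induction with
  | mem x hx =>
    obtain ⟨α, rfl⟩ := hx
    exact ⟨IsKilling.coroot (π α).1, h.coroot α⟩
  | zero => exact ⟨0, by simp [Ad]⟩
  | add x y _ _ hx hy =>
    obtain ⟨b, hb⟩ := hx
    obtain ⟨c, hc⟩ := hy
    exact ⟨b + c, by push_cast; rw [map_add, map_add, Ad_add, hb, hc]⟩
  | smul c x _ hx =>
    obtain ⟨b, hb⟩ := hx
    exact ⟨c • b, by push_cast; rw [map_smul, map_smul, Ad_smul, hb]⟩

theorem conj_mem_T (h : D.Acts π g) {t : GL (Fin n) ℂ} (ht : t ∈ D.T) : g * t * g⁻¹ ∈ D.T := by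
  obtain ⟨a, rfl⟩ := (D.mem_T_iff t).mp ht
  obtain ⟨b, hb⟩ := h.exists_rho a
  exact (D.mem_T_iff _).mpr ⟨b, by rw [conj_expGL, hb]⟩

theorem mem_normalizer (h : D.Acts π g) : g ∈ Subgroup.normalizer (D.T : Set (GL (Fin n) ℂ)) := by
  rw [Subgroup.mem_normalizer_iff]
  intro t
  refine ⟨fun ht => h.conj_mem_T ht, fun ht => ?_⟩
  have := h.inv.conj_mem_T ht
  convert this using 1
  group

/-- `g ω_β g⁻¹` and `ω_{π β}` differ by an element of the torus. -/
theorem conj_omega (h : D.Acts π g) (β : H.root) :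
    ∃ t ∈ D.T, g * D.omega β * g⁻¹ = t * D.omega (π β) := by
  obtain ⟨c, hc⟩ := h.E β
  have hc0 := ne_zero hc
  refine ⟨D.h (π β) (Units.mk0 c hc0), Subgroup.subset_closure ⟨_, _, rfl⟩, ?_⟩
  have h2 : ∀ a b c g : GL (Fin n) ℂ, g * (a * b * c) * g⁻¹ =
      (g * a * g⁻¹) * (g * b * g⁻¹) * (g * c * g⁻¹) := by intros; group
  rw [omega_eq, sw, h2, conj_expGL, conj_expGL, Ad_smul, Ad_smul, hc, h.E_negRoot hc,
    ChevalleyData.h, inv_mul_cancel_right, w_eq, sw]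
  simp

end Acts

theorem acts_omega (α : H.root) : D.Acts ((Phi H).reflectionPerm α) (D.omega α) where
  coroot β := by rw [Hc, Ad_omega_rho, Hc, coroot_reflectionPerm]
  E β := D.Ad_omega_E α β

theorem acts_T {g : GL (Fin n) ℂ} (hg : g ∈ D.T) : D.Acts 1 g where
  coroot _ := D.Ad_T_rho hg _
  E β := D.Ad_T_E hg β

theorem omega_sq_mem (α : H.root) : D.omega α * D.omega α ∈ D.T := by
  have h1 : D.h α (-1) ∈ D.T := Subgroup.subset_closure ⟨_, _, rfl⟩
  have h2 : D.h α (-1) = (D.omega α * D.omega α)⁻¹ := by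
    rw [mul_inv_rev, h, w_eq, omega_eq, sw_inv]
    simp
  rw [h2] at h1
  simpa using inv_mem h1

end ChevalleyData

end Torus

theorem mk_mul_mk_mem {A B : Type*} [Group A] [Group B] {S : Subgroup (A × B)} {a a' : A} {b b' : B}
    (h : (a, b) ∈ S) (h' : (a', b') ∈ S) : (a * a', b * b') ∈ S := S.mul_mem h h'

theorem mk_inv_mem {A B : Type*} [Group A] [Group B] {S : Subgroup (A × B)} {a : A} {b : B}
    (h : (a, b) ∈ S) : (a⁻¹, b⁻¹) ∈ S := S.inv_mem h

/-- If the elements `ω i` satisfy the relations of the reflections modulo `T`, the group generated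
by the pairs (reflection, `ω i`) and by `T` is over the identity no larger than `T`. -/
theorem mem_of_one_mem_closure {ι R M N A B : Type*} [Finite ι] [Field R] [CharZero R]
    [AddCommGroup M] [Module R M] [AddCommGroup N] [Module R N] [Group A] [Group B]
    (P : RootPairing ι R M N) [P.IsCrystallographic] [P.IsReduced] [P.IsRootSystem] (T : Subgroup B)
    (π : A →* Equiv.Perm ι) {r : ι → A} (hr : ∀ i, π (r i) = P.reflectionPerm i) (ω : ι → B)
    (hω : ∀ i, ω i ∈ Subgroup.normalizer (T : Set B)) (h2 : ∀ i, ω i * ω i ∈ T)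
    (hc : ∀ i j, ∃ t ∈ T, ω i * ω j * (ω i)⁻¹ = t * ω (P.reflectionPerm i j)) {S : Set (A × B)}
    (hS : ∀ p ∈ S, (∃ i, p = (r i, ω i)) ∨ (p.1 = 1 ∧ p.2 ∈ T)) {g : B}
    (hg : (1, g) ∈ Subgroup.closure S) : g ∈ T := by
  set N := Subgroup.normalizer (T : Set B) with hN
  let Q := N ⧸ (T.subgroupOf N)
  let mk : N →* Q := QuotientGroup.mk' (T.subgroupOf N)
  let q : ι → Q := fun i => mk ⟨ω i, hω i⟩
  have mk1 : ∀ x : N, mk x = 1 ↔ x.1 ∈ T := by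
    intro x
    rw [QuotientGroup.mk'_apply, QuotientGroup.eq_one_iff, Subgroup.mem_subgroupOf]
  have r2 : ∀ i, q i * q i = 1 := fun i => by
    rw [← map_mul, mk1]
    exact h2 i
  have rc : ∀ i j, q i * q j * q i = q (P.reflectionPerm i j) := by
    intro i j
    obtain ⟨t, ht, e⟩ := hc i j
    have h1 : q i * q j * q i = q i * q j * (q i)⁻¹ := by
      rw [← mul_eq_one_iff_eq_inv.mp (r2 i)]
    rw [h1, ← map_inv, ← map_mul, ← map_mul, ← mul_inv_eq_one, ← map_inv, ← map_mul, mk1]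
    change ω i * ω j * (ω i)⁻¹ * (ω (P.reflectionPerm i j))⁻¹ ∈ T
    rw [e, mul_inv_cancel_right]; exact ht
  have key : ∀ p ∈ Subgroup.closure S, ∃ x : N, x.1 = p.2 ∧ ((mk x, π p.1) : Q × Equiv.Perm ι) ∈
      Subgroup.closure (Set.range fun i => (q i, P.reflectionPerm i)) := by
    intro p hp
    induction hp using Subgroup.closure_induction with
    | mem p hp =>
      rcases hS p hp with ⟨i, rfl⟩ | ⟨h1, h2⟩
      · exact ⟨⟨ω i, hω i⟩, rfl, Subgroup.subset_closure ⟨i, Prod.ext rfl (hr i).symm⟩⟩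
      · refine ⟨⟨p.2, Subgroup.le_normalizer h2⟩, rfl, ?_⟩
        rw [(mk1 ⟨p.2, Subgroup.le_normalizer h2⟩).mpr h2, h1, map_one]
        exact one_mem _
    | one =>
      refine ⟨1, rfl, ?_⟩
      rw [Prod.fst_one, map_one, map_one]
      exact one_mem _
    | mul p p' _ _ hp hq =>
      obtain ⟨x, hx, hp⟩ := hp
      obtain ⟨y, hy, hq⟩ := hq
      refine ⟨x * y, by rw [Subgroup.coe_mul, hx, hy, Prod.snd_mul], ?_⟩
      rw [Prod.fst_mul, map_mul, map_mul]
      exact mul_mem hp hq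
    | inv p _ hp =>
      obtain ⟨x, hx, hp⟩ := hp
      refine ⟨x⁻¹, by rw [Subgroup.coe_inv, hx, Prod.snd_inv], ?_⟩
      rw [Prod.fst_inv, map_inv, map_inv]
      exact inv_mem hp
  obtain ⟨x, rfl, h⟩ := key _ hg
  rw [map_one] at h
  exact (mk1 _).mp (eq_one_of_mem_closure P r2 rc h)

theorem act_mem_of_mem_closure {A Y : Type*} [Group A] {act : A → Y → Y} (one : ∀ y, act 1 y = y)
    (mul : ∀ a b y, act (a * b) y = act a (act b y)) {S : Set A} {V : Set Y}
    (h1 : ∀ a ∈ S, ∀ y ∈ V, act a y ∈ V) (h2 : ∀ a ∈ S, a⁻¹ ∈ S) {a : A}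
    (ha : a ∈ Subgroup.closure S) {y : Y} (hy : y ∈ V) : act a y ∈ V := by
  induction ha using Subgroup.closure_induction_left with
  | one => rw [one]; exact hy
  | mul_left p hp q _ hq => rw [mul]; exact h1 p hp _ hq
  | inv_mul_cancel p hp q _ hq => rw [mul]; exact h1 _ (h2 p hp) _ hq

section WeylGraph

open LieAlgebra LieAlgebra.IsKilling LieModule IsMatrixSl2

variable {L : Type*} [LieRing L] [LieAlgebra ℂ L] [FiniteDimensional ℂ L]
  [LieAlgebra.IsKilling ℂ L] {H : LieSubalgebra ℂ L} [H.IsCartanSubalgebra]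

/-- The permutation of the roots defined by an element of the Weyl group. -/
abbrev rootPerm (w : Weyl H) : Equiv.Perm H.root := (Phi H).weylGroupToPerm w

theorem rootPerm_refl (α : H.root) : rootPerm (refl α) = (Phi H).reflectionPerm α := rfl

theorem rootPerm_injective : Function.Injective (rootPerm (H := H)) := by
  intro w w' h
  have h1 : ∀ f : Module.Dual ℂ H, w • f = w' • f := by
    intro f
    have hf : f ∈ Submodule.span ℂ (Set.range (Phi H).root) := by
      rw [RootPairing.IsRootSystem.span_root_eq_top]; trivial
    induction hf using Submodule.span_induction with
    | mem x hx =>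
      obtain ⟨i, rfl⟩ := hx
      rw [RootPairing.weylGroup_apply_root, RootPairing.weylGroup_apply_root]
      exact congrArg (fun e : Equiv.Perm H.root => (Phi H).root (e i)) h
    | zero => rw [smul_zero, smul_zero]
    | add x y _ _ hx hy => rw [smul_add, smul_add, hx, hy]
    | smul c x _ hx => rw [smul_comm, smul_comm w', hx]
  apply Subtype.ext
  apply RootPairing.Equiv.weightHom_injective
  ext1 f
  exact h1 f

theorem refl_conj (w : Weyl H) (α : H.root) : w * refl α * w⁻¹ = refl (rootPerm w α) := by
  apply rootPerm_injective
  rw [rootPerm_refl, rootPerm, map_mul, map_mul, map_inv]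
  obtain ⟨w, hw⟩ := w
  induction hw using RootPairing.weylGroup.induction generalizing α with
  | mem i =>
    change (Phi H).reflectionPerm i * (Phi H).reflectionPerm α * ((Phi H).reflectionPerm i)⁻¹ =
      (Phi H).reflectionPerm ((Phi H).reflectionPerm i α)
    rw [reflectionPerm_reflectionPerm, ← mul_eq_one_iff_eq_inv.mp (reflectionPerm_mul_self _ i)]
  | one =>
    have h1 : (⟨1, one_mem _⟩ : Weyl H) = 1 := rfl
    rw [h1, map_one, one_mul, inv_one, mul_one]
    rfl
  | mul x y hx hy ihx ihy =>
    have h1 : (⟨x * y, mul_mem hx hy⟩ : Weyl H) = ⟨x, hx⟩ * ⟨y, hy⟩ := rfl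
    have h2 : rootPerm (⟨x, hx⟩ * ⟨y, hy⟩ : Weyl H) α =
        rootPerm ⟨x, hx⟩ (rootPerm ⟨y, hy⟩ α) := by rw [rootPerm, map_mul]; rfl
    have h3 := ihy α
    rw [← rootPerm_refl] at h3
    rw [h1, h2, map_mul, ← ihx]
    rw [show (Phi H).weylGroupToPerm (refl (rootPerm ⟨y, hy⟩ α)) = _ from h3.symm, mul_inv_rev]
    simp only [mul_assoc]

theorem refl_eq_refl_iff {α β : H.root} (h : refl α = refl β) : β = α ∨ β = negRoot α := by
  have h1 : (Phi H).reflectionPerm α = (Phi H).reflectionPerm β := congrArg rootPerm h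
  have h2 := (Phi H).pairing_smul_root_eq α β α h1
  rw [RootPairing.pairing_same] at h2
  have h3 : (α.1 : H → ℂ) = ((2 : ℂ)⁻¹ * (Phi H).pairing α β) • (β.1 : H → ℂ) := by
    funext a
    have h4 := LinearMap.congr_fun h2 a
    have h5 : 2 * α.1 a = (Phi H).pairing α β * β.1 a := h4
    rw [Pi.smul_apply, smul_eq_mul, mul_assoc, ← h5]
    ring
  rcases eq_neg_or_eq_of_eq_smul β.1 α.1 (isNonZero_root α) _ h3 with h4 | h4
  · right
    have h5 : α = negRoot β := Subtype.ext h4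
    rw [h5, negRoot_negRoot]
  · left; exact (Subtype.ext h4).symm

namespace ChevalleyData

variable {n : ℕ} (D : ChevalleyData H n)

/-! ### The group generated by the compact torus and the representatives of the reflections -/

theorem acts_of_mem_weylGraph {p : Weyl H × GL (Fin n) ℂ} (hp : p ∈ D.weylGraph) :
    D.Acts (rootPerm p.1) p.2 := by
  refine Subgroup.closure_induction (p := fun p _ => D.Acts (rootPerm p.1) p.2) ?_ ?_ ?_ ?_ hp
  · rintro p (⟨α, rfl⟩ | ⟨h1, h2⟩)
    · exact D.acts_omega α
    · rw [h1, rootPerm, map_one]; exact D.acts_T h2.1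
  · rw [Prod.fst_one, rootPerm, map_one]; exact D.acts_T (one_mem _)
  · intro p q _ _ hp hq
    rw [Prod.fst_mul, rootPerm, map_mul]; exact hp.mul hq
  · intro p _ hp
    rw [Prod.fst_inv, rootPerm, map_inv]; exact hp.inv

theorem x_mem_G (α : H.root) (t : ℂ) : D.x α t ∈ D.G := Subgroup.subset_closure ⟨α, t, rfl⟩

theorem x_mem_sigmaGraph (α : H.root) (t : ℂ) :
    (D.x α t, D.x (negRoot α) (-(starRingEnd ℂ t))) ∈ D.sigmaGraph :=
  Subgroup.subset_closure ⟨α, t, rfl⟩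

/-- `σ(w_α(t)) = w_α(t̄⁻¹)`. -/
theorem w_mem_sigmaGraph (α : H.root) (t : ℂˣ) :
    (D.w α t, sw (D.E α) (D.E (negRoot α)) (starRingEnd ℂ t)⁻¹) ∈ D.sigmaGraph := by
  have h1 := D.x_mem_sigmaGraph α t
  have h2 := D.x_mem_sigmaGraph (negRoot α) (-(t : ℂ)⁻¹)
  have h3 := mul_mem (mul_mem h1 h2) h1
  have hc : (starRingEnd ℂ t)⁻¹ ≠ 0 := by simp
  convert h3 using 1
  refine Prod.ext rfl ?_
  rw [← (D.isMatrixSl2 α).sw_swap hc, sw]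
  simp only [Prod.mk_mul_mk, negRoot_negRoot, x_eq, map_neg, map_inv₀, inv_inv, neg_neg, inv_neg]

theorem omega_mem_C (α : H.root) : D.omega α ∈ D.C := by
  refine ⟨mul_mem (mul_mem (D.x_mem_G _ _) (D.x_mem_G _ _)) (D.x_mem_G _ _), ?_⟩
  have := D.w_mem_sigmaGraph α 1
  rw [Units.val_one, map_one, inv_one] at this
  exact this

/-- `h_α(t)` is in the compact torus if `|t| = 1`. -/
theorem h_mem_K (α : H.root) (t : ℂˣ) (ht : (t : ℂ) * starRingEnd ℂ t = 1) : D.h α t ∈ D.K := by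
  have hG : ∀ t, D.w α t ∈ D.G := fun t =>
    mul_mem (mul_mem (D.x_mem_G _ _) (D.x_mem_G _ _)) (D.x_mem_G _ _)
  refine ⟨Subgroup.subset_closure ⟨_, _, rfl⟩, mul_mem (hG _) (inv_mem (hG _)), ?_⟩
  have h1 := D.w_mem_sigmaGraph α t
  rw [← eq_inv_of_mul_eq_one_left ht, ← w_eq] at h1
  exact mk_mul_mk_mem h1 (mk_inv_mem (D.omega_mem_C α).2)

theorem mem_C_of_mem_weylGraph {p : Weyl H × GL (Fin n) ℂ} (hp : p ∈ D.weylGraph) :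
    p.2 ∈ D.C := by
  have h : D.weylGraph ≤ D.C.comap (MonoidHom.snd _ _) := by
    refine (Subgroup.closure_le _).mpr ?_
    rintro p (⟨α, rfl⟩ | ⟨_, h2⟩)
    · exact D.omega_mem_C α
    · exact h2.2
  exact h hp

/-- The kernel of the homomorphism `𝒩 → W` is `K`. -/
theorem mem_K_of_one_mem_weylGraph {g : GL (Fin n) ℂ} (hg : (1, g) ∈ D.weylGraph) : g ∈ D.K := by
  refine ⟨?_, D.mem_C_of_mem_weylGraph hg⟩
  refine mem_of_one_mem_closure (Phi H) D.T (Phi H).weylGroupToPerm (r := refl) (fun _ => rfl)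
    D.omega (fun α => (D.acts_omega α).mem_normalizer) D.omega_sq_mem
    (fun α β => (D.acts_omega α).conj_omega β) ?_ hg
  rintro p (⟨α, rfl⟩ | ⟨h1, h2⟩)
  · exact Or.inl ⟨α, rfl⟩
  · exact Or.inr ⟨h1, h2.1⟩

theorem coset_one {g : GL (Fin n) ℂ} : g ∈ D.coset 1 ↔ g ∈ D.K :=
  ⟨D.mem_K_of_one_mem_weylGraph, fun h => Subgroup.subset_closure (Or.inr ⟨rfl, h⟩)⟩

theorem mul_mem_coset {w w' : Weyl H} {g g' : GL (Fin n) ℂ} (h : g ∈ D.coset w)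
    (h' : g' ∈ D.coset w') : g * g' ∈ D.coset (w * w') :=
  mk_mul_mk_mem (S := D.weylGraph) h h'

theorem inv_mem_coset {w : Weyl H} {g : GL (Fin n) ℂ} (h : g ∈ D.coset w) :
    g⁻¹ ∈ D.coset w⁻¹ :=
  mk_inv_mem (S := D.weylGraph) h

theorem conj_mem_K {w : Weyl H} {g k : GL (Fin n) ℂ} (h : g ∈ D.coset w) (hk : k ∈ D.K) :
    g * k * g⁻¹ ∈ D.K := by
  rw [← coset_one] at hk ⊢
  have := D.mul_mem_coset (D.mul_mem_coset h hk) (D.inv_mem_coset h)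
  rwa [mul_one, mul_inv_cancel] at this

/-! ### Elements fixed by `σ` act by scalars of absolute value one -/

/-- A linear form on matrices that picks the coefficient of `X_β`. -/
theorem exists_coeff (β : H.root) : ∃ f : Matrix (Fin n) (Fin n) ℂ →ₗ[ℂ] ℂ,
    f (D.E β) = 1 ∧ (∀ γ, γ ≠ β → f (D.E γ) = 0) ∧ ∀ a : H, f (D.ρ a) = 0 := by
  obtain ⟨r, hr, e⟩ := D.exists_killingForm_X β
  have hr' : (r : ℂ) ≠ 0 := by exact_mod_cast hr.ne'
  obtain ⟨g, hg⟩ := LinearMap.exists_leftInverse_of_injective D.ρ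
    (LinearMap.ker_eq_bot.mpr D.ρ_injective)
  have hg' : ∀ y, g (D.ρ y) = y := fun y => LinearMap.congr_fun hg y
  refine ⟨(r : ℂ)⁻¹ • ((killingForm ℂ L).flip (D.X (negRoot β))).comp g, ?_, ?_, ?_⟩
  · simp [E, hg', e, hr']
  · intro γ hγ
    have : killingForm ℂ L (D.X γ) (D.X (negRoot β)) = 0 := by
      refine killingForm_apply_eq_zero_of_mem_rootSpace_of_add_ne_zero ℂ L H (D.X_mem γ)
        (D.X_neg_mem β) ?_
      rw [← sub_eq_add_neg, sub_ne_zero]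
      exact fun h => hγ (root_ext h)
    simp [E, hg', this]
  · intro a
    have : killingForm ℂ L (a : L) (D.X (negRoot β)) = 0 := by
      refine killingForm_apply_eq_zero_of_mem_rootSpace_of_add_ne_zero ℂ L H (α := 0) ?_
        (D.X_neg_mem β) ?_
      · rw [rootSpace_zero_eq]; exact a.2
      · rw [zero_add, neg_ne_zero]; exact isNonZero_root β
    simp [hg', this]

/-- The graph, as a real subspace, of the differential of `σ` on the Lie algebra. -/
def sigmaLie : Submodule ℝ (Matrix (Fin n) (Fin n) ℂ × Matrix (Fin n) (Fin n) ℂ) :=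
  Submodule.span ℝ ({p | ∃ (α : H.root) (c : ℂ),
      p = (c • D.E α, (-starRingEnd ℂ c) • D.E (negRoot α))} ∪
    {p | ∃ (α : H.root) (c : ℂ), p = (c • D.Hc α, (-starRingEnd ℂ c) • D.Hc α)})

theorem E_mem_sigmaLie (α : H.root) (c : ℂ) :
    (c • D.E α, (-starRingEnd ℂ c) • D.E (negRoot α)) ∈ D.sigmaLie :=
  Submodule.subset_span (Or.inl ⟨α, c, rfl⟩)

theorem Hc_mem_sigmaLie (α : H.root) (c : ℂ) :
    (c • D.Hc α, (-starRingEnd ℂ c) • D.Hc α) ∈ D.sigmaLie :=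
  Submodule.subset_span (Or.inr ⟨α, c, rfl⟩)

/-- The commutators with `X_α` and `-X_{-α}` preserve the graph; for root vectors this holds since
the structure constants are real and change their signs when all roots are negated. -/
theorem comm_mem_sigmaLie (α : H.root) (t : ℂ)
    {y : Matrix (Fin n) (Fin n) ℂ × Matrix (Fin n) (Fin n) ℂ} (hy : y ∈ D.sigmaLie) :
    ((t • D.E α) * y.1 - y.1 * (t • D.E α),
      ((-starRingEnd ℂ t) • D.E (negRoot α)) * y.2 -
        y.2 * ((-starRingEnd ℂ t) • D.E (negRoot α))) ∈ D.sigmaLie := by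
  have br : ∀ (a b : ℂ) (x z : L), (a • D.ρ x) * (b • D.ρ z) - (b • D.ρ z) * (a • D.ρ x) =
      (a * b) • D.ρ ⁅x, z⁆ := by
    intro a b x z
    rw [D.ρ_lie, smul_sub, smul_mul_smul_comm, smul_mul_smul_comm, mul_comm b a]
  induction hy using Submodule.span_induction with
  | mem p hp =>
    rcases hp with ⟨β, c, rfl⟩ | ⟨β, c, rfl⟩
    · simp only [E, br]
      by_cases h0 : (α.1 : H → ℂ) + (β.1 : H → ℂ) = 0
      · have hβ : β = negRoot α := root_ext (by
          exact (neg_eq_of_add_eq_zero_right h0).symm)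
        subst hβ
        have := D.Hc_mem_sigmaLie α (t * c)
        rw [negRoot_negRoot, D.lie_X_neg, ← lie_skew, D.lie_X_neg]
        have e : (-starRingEnd ℂ t * -starRingEnd ℂ c) • D.ρ (-(coroot α.1 : L)) =
            (-starRingEnd ℂ (t * c)) • D.Hc α := by
          rw [map_mul, neg_mul_neg, map_neg, smul_neg, neg_smul]; rfl
        rw [e]
        exact this
      by_cases h1 : genWeightSpace L ((α.1 : H → ℂ) + (β.1 : H → ℂ)) = ⊥
      · have e1 : ⁅D.X α, D.X β⁆ = 0 := by
          have := lie_mem_genWeightSpace_of_mem_genWeightSpace (D.X_mem α) (D.X_mem β)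
          rw [h1] at this
          exact (LieSubmodule.mem_bot _).mp this
        have e2 : ⁅D.X (negRoot α), D.X (negRoot β)⁆ = 0 := by
          by_contra hne
          have h2 := lie_mem_genWeightSpace_of_mem_genWeightSpace (D.X_neg_mem α) (D.X_neg_mem β)
          have h3 : genWeightSpace L (-(α.1 : H → ℂ) + -(β.1 : H → ℂ)) ≠ ⊥ := by
            intro h; rw [h] at h2; exact hne ((LieSubmodule.mem_bot _).mp h2)
          let χ : LieModule.Weight ℂ H L := ⟨_, h3⟩
          have h4 := (-χ).genWeightSpace_ne_bot
          apply h4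
          rw [← h1]
          congr 1
          change -(-(α.1 : H → ℂ) + -(β.1 : H → ℂ)) = _
          rw [neg_add, neg_neg, neg_neg]
        rw [e1, e2, map_zero, smul_zero, smul_zero]
        exact zero_mem _
      · let χ : LieModule.Weight ℂ H L := ⟨_, h1⟩
        let γ : H.root := ⟨χ, Finset.mem_filter.mpr ⟨Finset.mem_univ _, h0⟩⟩
        obtain ⟨N, hN1, hN2⟩ := D.lie_X_X α β γ rfl
        have hN := D.conj_structure_constant hN1 hN2
        have := D.E_mem_sigmaLie γ (t * c * N)
        rw [hN1, hN2, map_smul, map_smul, smul_smul, smul_smul]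
        have e : -starRingEnd ℂ t * -starRingEnd ℂ c * -N = -starRingEnd ℂ (t * c * N) := by
          rw [map_mul, map_mul, hN]; ring
        rw [e]
        exact this
    · simp only [E, Hc, br]
      have e1 : ⁅D.X α, (coroot β.1 : L)⁆ = (-α.1 (coroot β.1)) • D.X α := by
        rw [← lie_skew, D.coroot_lie_X, neg_smul]
      have e2 : ⁅D.X (negRoot α), (coroot β.1 : L)⁆ = α.1 (coroot β.1) • D.X (negRoot α) := by
        rw [← lie_skew, D.coroot_lie_X, ← neg_smul]
        congr 1
        exact neg_neg _
      have := D.E_mem_sigmaLie α (t * c * (-α.1 (coroot β.1)))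
      rw [e1, e2, map_smul, map_smul, smul_smul, smul_smul]
      have e : -starRingEnd ℂ t * -starRingEnd ℂ c * α.1 (coroot β.1) =
          -starRingEnd ℂ (t * c * (-α.1 (coroot β.1))) := by
        rw [map_mul, map_mul, map_neg, conj_apply_coroot]; ring
      rw [e]
      exact this
  | zero =>
    simp only [Prod.fst_zero, Prod.snd_zero, mul_zero, zero_mul, sub_zero]
    exact zero_mem D.sigmaLie
  | add x y _ _ hx hy =>
    convert add_mem hx hy using 1
    refine Prod.ext ?_ ?_ <;> simp only [Prod.fst_add, Prod.snd_add, mul_add, add_mul] <;> abel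
  | smul c x _ hx =>
    convert D.sigmaLie.smul_mem c hx using 1
    refine Prod.ext ?_ ?_ <;>
      simp only [Prod.smul_fst, Prod.smul_snd, mul_smul_comm, smul_mul_assoc, smul_sub, smul_comm c]

theorem Ad_mem_sigmaLie {p : GL (Fin n) ℂ × GL (Fin n) ℂ} (hp : p ∈ D.sigmaGraph)
    {y : Matrix (Fin n) (Fin n) ℂ × Matrix (Fin n) (Fin n) ℂ} (hy : y ∈ D.sigmaLie) :
    (Ad p.1 y.1, Ad p.2 y.2) ∈ D.sigmaLie := by
  have step : ∀ (α : H.root) (t : ℂ) {y : Matrix (Fin n) (Fin n) ℂ × Matrix (Fin n) (Fin n) ℂ},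
      y ∈ D.sigmaLie →
        (Ad (D.x α t) y.1, Ad (D.x (negRoot α) (-starRingEnd ℂ t)) y.2) ∈ D.sigmaLie :=
    fun α t y hy => Ad_expGL_prod_mem D.sigmaLie _ _
      (fun z hz => D.comm_mem_sigmaLie α t hz) hy
  refine act_mem_of_mem_closure (act := fun p y => (Ad p.1 y.1, Ad p.2 y.2)) (V := D.sigmaLie)
    (fun y => by rw [Prod.fst_one, Prod.snd_one, Ad_one, Ad_one])
    (fun p q y => by rw [Prod.fst_mul, Prod.snd_mul, Ad_mul, Ad_mul]) ?_ ?_ hp hy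
  · rintro p ⟨α, t, rfl⟩ y hy
    exact step α t hy
  · rintro p ⟨α, t, rfl⟩
    exact ⟨α, -t, by rw [Prod.inv_mk, x_inv, x_inv, map_neg]⟩

theorem coeff_of_mem_sigmaLie {β : H.root} {f f' : Matrix (Fin n) (Fin n) ℂ →ₗ[ℂ] ℂ}
    (hf : f (D.E β) = 1 ∧ (∀ γ, γ ≠ β → f (D.E γ) = 0) ∧ ∀ a : H, f (D.ρ a) = 0)
    (hf' : f' (D.E (negRoot β)) = 1 ∧ (∀ γ, γ ≠ negRoot β → f' (D.E γ) = 0) ∧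
      ∀ a : H, f' (D.ρ a) = 0)
    {y : Matrix (Fin n) (Fin n) ℂ × Matrix (Fin n) (Fin n) ℂ} (hy : y ∈ D.sigmaLie) :
    f' y.2 = -starRingEnd ℂ (f y.1) := by
  induction hy using Submodule.span_induction with
  | mem p hp =>
    rcases hp with ⟨γ, c, rfl⟩ | ⟨γ, c, rfl⟩
    · by_cases h : γ = β
      · subst h; simp [hf.1, hf'.1]
      · have h' : negRoot γ ≠ negRoot β := by
          intro e; apply h; rw [← negRoot_negRoot γ, e, negRoot_negRoot]
        simp [hf.2.1 γ h, hf'.2.1 _ h']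
    · simp [Hc, hf.2.2, hf'.2.2]
  | zero => simp
  | add x y _ _ hx hy => simp [hx, hy]; ring
  | smul c x _ hx =>
    have e1 : ∀ z : Matrix (Fin n) (Fin n) ℂ, c • z = (c : ℂ) • z := fun z => by ext; simp
    rw [Prod.smul_fst, Prod.smul_snd, e1, e1, map_smul, map_smul, hx]
    simp

/-- The scalars by which the elements of `𝒩` permute the root vectors have absolute value one. -/
theorem conj_eq_inv {w : Weyl H} {g : GL (Fin n) ℂ} (h : g ∈ D.coset w) {β : H.root} {c : ℂ}
    (hc : Ad g (D.E β) = c • D.E (rootPerm w β)) : starRingEnd ℂ c = c⁻¹ := by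
  have ha := D.acts_of_mem_weylGraph h
  have h1 := D.Ad_mem_sigmaLie (D.mem_C_of_mem_weylGraph h).2 (D.E_mem_sigmaLie β 1)
  obtain ⟨f, hf⟩ := D.exists_coeff (rootPerm w β)
  obtain ⟨f', hf'⟩ := D.exists_coeff (negRoot (rootPerm w β))
  have h2 := D.coeff_of_mem_sigmaLie hf hf' h1
  have h3 := ha.E_negRoot hc
  simp only [Ad_smul, hc, h3, map_smul, hf.1, hf'.1, map_one, one_smul, smul_eq_mul, mul_one,
    neg_mul, one_mul, neg_inj] at h2
  exact h2.symm

end ChevalleyData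

end WeylGraph

/-! ### The subgroups `φ_α(SU₂)` and local sections -/

theorem conj_mem_of_mem_closure {A B : Type*} [Group A] [Group B] {S : Set (A × B)}
    {T : Subgroup (A × B)} {c : A} {d : B}
    (h : ∀ a b, (a, b) ∈ S → (c * a * c⁻¹, d * b * d⁻¹) ∈ T) {a : A} {b : B}
    (hab : (a, b) ∈ Subgroup.closure S) : (c * a * c⁻¹, d * b * d⁻¹) ∈ T := by
  have h1 : Subgroup.closure S ≤ T.comap (MulAut.conj (c, d)).toMonoidHom :=
    (Subgroup.closure_le _).mpr fun p hp => h p.1 p.2 hp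
  exact h1 hab

section Unitary

/-- The special unitary elements of `SL₂(ℂ)`. -/
abbrev IsSU (M : Matrix.SpecialLinearGroup (Fin 2) ℂ) : Prop :=
  (M : Matrix (Fin 2) (Fin 2) ℂ) ∈ Matrix.unitaryGroup (Fin 2) ℂ

theorem IsSU.coe_inv {M : Matrix.SpecialLinearGroup (Fin 2) ℂ} (h : IsSU M) :
    (M⁻¹).1 = star M.1 := by
  have h1 : M.1 * star M.1 = 1 := Matrix.mem_unitaryGroup_iff.mp h
  have h2 : (M⁻¹).1 * M.1 = 1 := congrArg Subtype.val (inv_mul_cancel M)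
  calc (M⁻¹).1 = (M⁻¹).1 * (M.1 * star M.1) := by rw [h1, mul_one]
    _ = star M.1 := by rw [← mul_assoc, h2, one_mul]

theorem IsSU.mul {M N : Matrix.SpecialLinearGroup (Fin 2) ℂ} (h : IsSU M) (h' : IsSU N) :
    IsSU (M * N) := by
  rw [IsSU, Matrix.SpecialLinearGroup.coe_mul]; exact mul_mem h h'

theorem IsSU.inv {M : Matrix.SpecialLinearGroup (Fin 2) ℂ} (h : IsSU M) : IsSU M⁻¹ := by
  rw [IsSU, h.coe_inv]; exact Unitary.star_mem h

theorem IsSU.entries {M : Matrix.SpecialLinearGroup (Fin 2) ℂ} (h : IsSU M) :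
    M.1 1 1 = starRingEnd ℂ (M.1 0 0) ∧ M.1 1 0 = -starRingEnd ℂ (M.1 0 1) := by
  have h1 := h.coe_inv
  rw [IsMatrixSl2.coe_inv_sl] at h1
  have h2 := congrFun (congrFun h1 0) 0
  have h3 := congrFun (congrFun h1 1) 0
  simp [Matrix.star_apply] at h2 h3
  exact ⟨h2, by rw [← h3, neg_neg]⟩

theorem IsSU.normSq {M : Matrix.SpecialLinearGroup (Fin 2) ℂ} (h : IsSU M) :
    M.1 0 0 * starRingEnd ℂ (M.1 0 0) + M.1 0 1 * starRingEnd ℂ (M.1 0 1) = 1 := by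
  have h1 := M.2
  rw [Matrix.det_fin_two, h.entries.1, h.entries.2] at h1
  linear_combination h1

/-- The antidiagonal element with upper entry `1`; it is sent to `ω_α`. -/
def antidiag : Matrix.SpecialLinearGroup (Fin 2) ℂ := ⟨!![0, 1; -1, 0], by simp⟩

/-- The antidiagonal element that exchanges the two unipotent subgroups of `SL₂(ℂ)`. -/
def swapI : Matrix.SpecialLinearGroup (Fin 2) ℂ :=
  ⟨!![0, Complex.I; Complex.I, 0], by simp [Matrix.det_fin_two]⟩

/-- The diagonal element with upper entry `z`, for `z ≠ 0`. -/
def diagSL (z : ℂˣ) : Matrix.SpecialLinearGroup (Fin 2) ℂ :=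
  ⟨!![(z : ℂ), 0; 0, ((z⁻¹ : ℂˣ) : ℂ)], by simp⟩

theorem isSU_antidiag : IsSU antidiag := by
  rw [IsSU, Matrix.mem_unitaryGroup_iff]
  ext i j
  fin_cases i <;> fin_cases j <;>
    simp [antidiag, Matrix.mul_apply, Matrix.star_apply, Fin.sum_univ_two]

theorem isSU_swapI : IsSU swapI := by
  rw [IsSU, Matrix.mem_unitaryGroup_iff]
  ext i j
  fin_cases i <;> fin_cases j <;>
    simp [swapI, Matrix.mul_apply, Matrix.star_apply, Fin.sum_univ_two]

theorem isSU_diagSL {z : ℂˣ} (hz : (z : ℂ) * starRingEnd ℂ z = 1) : IsSU (diagSL z) := by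
  have h2 : starRingEnd ℂ (z : ℂ) = (z : ℂ)⁻¹ := (inv_eq_of_mul_eq_one_right hz).symm
  rw [IsSU, Matrix.mem_unitaryGroup_iff]
  ext i j
  fin_cases i <;> fin_cases j <;>
    simp [diagSL, Matrix.mul_apply, Matrix.star_apply, Fin.sum_univ_two, h2]

namespace IsMatrixSl2

variable {n : ℕ} {e f h e' f' : Matrix (Fin n) (Fin n) ℂ}

theorem up_mem_slGraph (t : ℂ) : (up t, expGL (t • e)) ∈ slGraph e f :=
  Subgroup.subset_closure ⟨t, Or.inl rfl⟩

theorem lo_mem_slGraph (t : ℂ) : (lo t, expGL (t • f)) ∈ slGraph e f :=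
  Subgroup.subset_closure ⟨t, Or.inr rfl⟩

theorem conj_mem_slGraph {Δ : Matrix.SpecialLinearGroup (Fin 2) ℂ} {g : GL (Fin n) ℂ}
    (he : ∀ t, (Δ * up t * Δ⁻¹, g * expGL (t • e) * g⁻¹) ∈ slGraph e' f')
    (hf : ∀ t, (Δ * lo t * Δ⁻¹, g * expGL (t • f) * g⁻¹) ∈ slGraph e' f')
    {M : Matrix.SpecialLinearGroup (Fin 2) ℂ} {a : GL (Fin n) ℂ} (hp : (M, a) ∈ slGraph e f) :
    (Δ * M * Δ⁻¹, g * a * g⁻¹) ∈ slGraph e' f' := by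
  refine conj_mem_of_mem_closure ?_ hp
  rintro a b ⟨t, h | h⟩
  · cases h; exact he t
  · cases h; exact hf t

theorem swapI_conj_up (t : ℂ) : swapI * up t * swapI⁻¹ = lo t := by
  rw [mul_inv_eq_iff_eq_mul]
  refine Subtype.ext ?_
  rw [Matrix.SpecialLinearGroup.coe_mul, Matrix.SpecialLinearGroup.coe_mul]
  simp [swapI, up, lo, mul_comm]

theorem swapI_conj_lo (t : ℂ) : swapI * lo t * swapI⁻¹ = up t := by
  rw [mul_inv_eq_iff_eq_mul]
  refine Subtype.ext ?_
  rw [Matrix.SpecialLinearGroup.coe_mul, Matrix.SpecialLinearGroup.coe_mul]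
  simp [swapI, up, lo, mul_comm]

theorem diagSL_conj_up (z : ℂˣ) (t : ℂ) :
    diagSL z * up t * (diagSL z)⁻¹ = up (z ^ 2 * t) := by
  rw [mul_inv_eq_iff_eq_mul]
  refine Subtype.ext ?_
  rw [Matrix.SpecialLinearGroup.coe_mul, Matrix.SpecialLinearGroup.coe_mul]
  simp [diagSL, up]
  field_simp

theorem diagSL_conj_lo (z : ℂˣ) (t : ℂ) :
    diagSL z * lo t * (diagSL z)⁻¹ = lo (((z : ℂ) ^ 2)⁻¹ * t) := by
  rw [mul_inv_eq_iff_eq_mul]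
  refine Subtype.ext ?_
  rw [Matrix.SpecialLinearGroup.coe_mul, Matrix.SpecialLinearGroup.coe_mul]
  simp [diagSL, lo]
  field_simp

theorem swap_mem_slGraph {M : Matrix.SpecialLinearGroup (Fin 2) ℂ} {a : GL (Fin n) ℂ}
    (hp : (M, a) ∈ slGraph e f) : (swapI * M * swapI⁻¹, a) ∈ slGraph f e := by
  have := conj_mem_slGraph (Δ := swapI) (g := 1) (e' := f) (f' := e) (fun t => by
    rw [swapI_conj_up, one_mul, inv_one, mul_one]; exact lo_mem_slGraph t) (fun t => by
    rw [swapI_conj_lo, one_mul, inv_one, mul_one]; exact up_mem_slGraph t) hp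
  rwa [one_mul, inv_one, mul_one] at this

theorem Ad_mem_slGraph {g : GL (Fin n) ℂ} {z : ℂˣ} (he : Ad g e = ((z : ℂ) ^ 2) • e')
    (hf : Ad g f = (((z : ℂ) ^ 2)⁻¹) • f') {M : Matrix.SpecialLinearGroup (Fin 2) ℂ}
    {a : GL (Fin n) ℂ} (hp : (M, a) ∈ slGraph e f) :
    (diagSL z * M * (diagSL z)⁻¹, g * a * g⁻¹) ∈ slGraph e' f' := by
  refine conj_mem_slGraph (fun t => ?_) (fun t => ?_) hp
  · rw [diagSL_conj_up, conj_expGL, Ad_smul, he, smul_smul, mul_comm]; exact up_mem_slGraph _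
  · rw [diagSL_conj_lo, conj_expGL, Ad_smul, hf, smul_smul, mul_comm]; exact lo_mem_slGraph _

theorem antidiag_mem_slGraph : (antidiag, sw e f 1) ∈ slGraph e f := by
  have h : antidiag = up 1 * lo (-1) * up 1 := by
    refine Subtype.ext ?_
    rw [Matrix.SpecialLinearGroup.coe_mul, Matrix.SpecialLinearGroup.coe_mul]
    simp [antidiag, up, lo]
  rw [h, sw, inv_one]
  exact mk_mul_mk_mem (mk_mul_mk_mem (up_mem_slGraph _) (lo_mem_slGraph _)) (up_mem_slGraph _)

/-- The image of `h` under `Ad φ(M)`. -/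
theorem Ad_h_eq (s : IsMatrixSl2 e f h) {M : Matrix.SpecialLinearGroup (Fin 2) ℂ}
    {a : GL (Fin n) ℂ} (hp : (M, a) ∈ slGraph e f) : ∃ r : ℂ,
    Ad a h = (M.1 0 0 * M.1 1 1 + M.1 0 1 * M.1 1 0) • h + (-2 * M.1 0 0 * M.1 0 1) • e +
      r • f := by
  have := (s.Ad_slMap hp !![1, 0; 0, -1] (by simp)).1
  have h1 : slMap e f h !![1, 0; 0, -1] = h := by simp [slMap]
  rw [h1] at this
  refine ⟨(M.1 * (!![1, 0; 0, -1] : Matrix (Fin 2) (Fin 2) ℂ) * (M⁻¹).1 :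
    Matrix (Fin 2) (Fin 2) ℂ) 1 0, this.trans ?_⟩
  rw [slMap, coe_inv_sl]
  congr 3
  · simp [Matrix.mul_apply, Fin.sum_univ_two]
  · simp [Matrix.mul_apply, Fin.sum_univ_two]; ring

theorem continuousOn_sh : ContinuousOn (fun t => sh e f t) {t | t ≠ 0} := by
  have h1 : ∀ x : Matrix (Fin n) (Fin n) ℂ, Continuous fun t : ℂ => expGL (t • x) := fun x =>
    continuous_expGL.comp (continuous_id.smul continuous_const)
  refine ContinuousOn.mul (ContinuousOn.mul (ContinuousOn.mul ?_ ?_) ?_) continuousOn_const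
  · exact (h1 e).continuousOn
  · exact (h1 f).comp_continuousOn (continuousOn_inv₀.neg)
  · exact (h1 e).continuousOn

end IsMatrixSl2

end Unitary

section Interface

open LieAlgebra LieAlgebra.IsKilling LieModule IsMatrixSl2

variable {L : Type*} [LieRing L] [LieAlgebra ℂ L] [FiniteDimensional ℂ L]
  [LieAlgebra.IsKilling ℂ L] {H : LieSubalgebra ℂ L} [H.IsCartanSubalgebra]

namespace ChevalleyData

variable {n : ℕ} (D : ChevalleyData H n)

theorem phiGraph_eq (α : H.root) : D.phiGraph α = slGraph (D.E α) (D.E (negRoot α)) := by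
  rw [phiGraph, homGraph, slGraph]
  congr 1
  ext p
  refine exists_congr fun t => or_congr ?_ ?_
  · exact ⟨fun h => Prod.ext (Subtype.ext h.1) h.2, fun h => by rw [h]; exact ⟨rfl, rfl⟩⟩
  · exact ⟨fun h => Prod.ext (Subtype.ext h.1) h.2, fun h => by rw [h]; exact ⟨rfl, rfl⟩⟩

theorem mem_phiSU {α : H.root} {g : GL (Fin n) ℂ} : g ∈ D.phiSU α ↔
    ∃ M, IsSU M ∧ (M, g) ∈ slGraph (D.E α) (D.E (negRoot α)) := by
  rw [← phiGraph_eq]; rfl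

theorem phiSU_negRoot_subset (α : H.root) : D.phiSU (negRoot α) ⊆ D.phiSU α := by
  intro g hg
  rw [mem_phiSU] at hg ⊢
  obtain ⟨M, hM, h⟩ := hg
  rw [negRoot_negRoot] at h
  exact ⟨_, (isSU_swapI.mul hM).mul isSU_swapI.inv, swap_mem_slGraph h⟩

theorem mul_mem_phiSU {α : H.root} {g g' : GL (Fin n) ℂ} (h : g ∈ D.phiSU α)
    (h' : g' ∈ D.phiSU α) : g * g' ∈ D.phiSU α := by
  rw [mem_phiSU] at *
  obtain ⟨M, hM, h⟩ := h
  obtain ⟨M', hM', h'⟩ := h'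
  exact ⟨_, hM.mul hM', mk_mul_mk_mem h h'⟩

theorem inv_mem_phiSU {α : H.root} {g : GL (Fin n) ℂ} (h : g ∈ D.phiSU α) :
    g⁻¹ ∈ D.phiSU α := by
  rw [mem_phiSU] at *
  obtain ⟨M, hM, h⟩ := h
  exact ⟨_, hM.inv, mk_inv_mem h⟩

theorem omega_mem_phiSU (α : H.root) : D.omega α ∈ D.phiSU α :=
  D.mem_phiSU.mpr ⟨_, isSU_antidiag, antidiag_mem_slGraph⟩

theorem conj_mem_phiSU {w : Weyl H} {g : GL (Fin n) ℂ} (h : g ∈ D.coset w) {α : H.root}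
    {a : GL (Fin n) ℂ} (ha : a ∈ D.phiSU α) : g * a * g⁻¹ ∈ D.phiSU (rootPerm w α) := by
  have hact := D.acts_of_mem_weylGraph h
  obtain ⟨c, hc⟩ := hact.E α
  have hc0 := Acts.ne_zero hc
  have hc1 := D.conj_eq_inv h hc
  have hc2 := hact.E_negRoot hc
  obtain ⟨z, hz⟩ := IsAlgClosed.exists_pow_nat_eq c zero_lt_two
  have hz0 : z ≠ 0 := by rintro rfl; exact hc0 (by rw [← hz]; simp)
  have hz1 : z * starRingEnd ℂ z = 1 := by
    have h1 : ‖c‖ ^ 2 = 1 := by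
      have : c * starRingEnd ℂ c = 1 := by rw [hc1, mul_inv_cancel₀ hc0]
      rw [Complex.mul_conj'] at this
      exact_mod_cast this
    have h2 : ‖z‖ ^ 2 = 1 := by
      rw [← norm_pow, hz]
      exact (pow_eq_one_iff_of_nonneg (norm_nonneg c) two_ne_zero).mp h1
    rw [Complex.mul_conj', ← Complex.ofReal_pow, h2, Complex.ofReal_one]
  rw [mem_phiSU] at ha ⊢
  obtain ⟨M, hM, ha⟩ := ha
  have hd : IsSU (diagSL (Units.mk0 z hz0)) := isSU_diagSL hz1
  refine ⟨_, (hd.mul hM).mul hd.inv, Ad_mem_slGraph ?_ ?_ ha⟩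
  · rw [Units.val_mk0, hz]; exact hc
  · rw [Units.val_mk0, hz]; exact hc2

theorem mem_Crefl_refl {α : H.root} {g : GL (Fin n) ℂ} :
    g ∈ D.Crefl (refl α) ↔ ∃ a ∈ D.phiSU α, ∃ k ∈ D.K, g = a * k := by
  constructor
  · rintro ⟨β, hβ, a, ha, k, hk, rfl⟩
    refine ⟨a, ?_, k, hk, rfl⟩
    rcases refl_eq_refl_iff hβ with rfl | rfl
    · exact ha
    · refine D.phiSU_negRoot_subset _ ?_
      rwa [negRoot_negRoot]
  · rintro ⟨a, ha, k, hk, rfl⟩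
    exact ⟨α, rfl, a, ha, k, hk, rfl⟩

theorem exists_refl_of_mem_Crefl {t : Weyl H} {g : GL (Fin n) ℂ} (h : g ∈ D.Crefl t) :
    ∃ α, t = refl α := by
  obtain ⟨α, hα, -⟩ := h
  exact ⟨α, hα.symm⟩

theorem conj_mem_Crefl {w t : Weyl H} {g a : GL (Fin n) ℂ} (h : g ∈ D.coset w)
    (ha : a ∈ D.Crefl t) : g * a * g⁻¹ ∈ D.Crefl (w * t * w⁻¹) := by
  obtain ⟨α, rfl, a, ha, k, hk, rfl⟩ := ha
  rw [refl_conj]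
  refine ⟨_, rfl, _, D.conj_mem_phiSU h ha, _, D.conj_mem_K h hk, ?_⟩
  group

theorem Crefl_mul_mem {t : Weyl H} {a k : GL (Fin n) ℂ} (ha : a ∈ D.Crefl t) (hk : k ∈ D.K) :
    a * k ∈ D.Crefl t := by
  obtain ⟨α, rfl, a, ha, k', hk', rfl⟩ := ha
  exact ⟨α, rfl, a, ha, k' * k, mul_mem hk' hk, mul_assoc _ _ _⟩

theorem mul_mem_Crefl {t : Weyl H} {a k : GL (Fin n) ℂ} (hk : k ∈ D.K) (ha : a ∈ D.Crefl t) :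
    k * a ∈ D.Crefl t := by
  have h1 := D.conj_mem_Crefl (D.coset_one.mpr hk) ha
  rw [one_mul, inv_one, mul_one] at h1
  have := D.Crefl_mul_mem h1 hk
  rwa [inv_mul_cancel_right] at this

/-- The coefficients of `α^∨` and `X_α` in `Ad(g) α^∨`, extended to linear forms. -/
theorem exists_coordinates (α : H.root) : ∃ P Q : GL (Fin n) ℂ → ℂ, Continuous P ∧ Continuous Q ∧
    (∀ g, ∀ k ∈ D.K, P (g * k) = P g ∧ Q (g * k) = Q g) ∧
    ∀ (g : GL (Fin n) ℂ) (q p r : ℂ), Ad g (D.Hc α) = q • D.Hc α + p • D.E α + r • D.E (negRoot α) →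
      Q g = q ∧ P g = p := by
  obtain ⟨f, h1, h2, h3⟩ := D.exists_coeff α
  have hf : Continuous f := f.continuous_of_finiteDimensional
  have hA : Continuous fun g => Ad g (D.Hc α) := continuous_Ad _
  have hK : ∀ g, ∀ k ∈ D.K, Ad (g * k) (D.Hc α) = Ad g (D.Hc α) := by
    intro g k hk
    rw [Ad_mul, Hc, D.Ad_T_rho hk.1]
  have s := D.isMatrixSl2 α
  refine ⟨fun g => f (Ad g (D.Hc α)),
    fun g => f (Ad g (D.Hc α) * D.E α - D.E α * Ad g (D.Hc α)) / 2, hf.comp hA,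
    (hf.comp ((hA.mul continuous_const).sub (continuous_const.mul hA))).div_const 2,
    fun g k hk => by simp only [hK g k hk, and_self], fun g q p r hg => ?_⟩
  have hH : f (D.Hc α) = 0 := h3 _
  have hne : negRoot α ≠ α := by
    intro h
    have h4 : D.Hc α = 0 := by
      have := congrArg D.Hc h
      rw [Hc_negRoot] at this
      have h5 : (2 : ℂ) • D.Hc α = 0 := by
        rw [two_smul]
        nth_rewrite 1 [← this]
        exact neg_add_cancel _
      exact (smul_eq_zero.mp h5).resolve_left two_ne_zero
    have h5 := s.he
    rw [h4, zero_mul, mul_zero, sub_zero, eq_comm, smul_eq_zero] at h5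
    exact h5.elim two_ne_zero (D.E_ne_zero α)
  have hF : f (D.E (negRoot α)) = 0 := h2 _ hne
  constructor
  · have e1 : Ad g (D.Hc α) * D.E α - D.E α * Ad g (D.Hc α) =
        q • (D.Hc α * D.E α - D.E α * D.Hc α) -
          r • (D.E α * D.E (negRoot α) - D.E (negRoot α) * D.E α) := by
      rw [hg]
      simp only [add_mul, mul_add, smul_mul_assoc, mul_smul_comm, smul_sub]
      abel
    change f _ / 2 = q
    rw [e1, s.he, s.ef]
    simp [h1, hH]
  · change f _ = p
    rw [hg]
    simp [h1, hH, hF]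

theorem neg_div_one_add_eq {a b c : ℂ} (ha : a ≠ 0) (hc : c ≠ 0) :
    -(-2 * a * b) / (1 + (2 * (a * c) - 1)) = b / c := by
  have : 1 + (2 * (a * c) - 1) = 2 * (a * c) := by ring
  rw [this]
  field_simp

theorem div_mul_div_eq_one_of_mul_eq_sq {a c r : ℂ} (ha : a ≠ 0) (hc : c ≠ 0) (h : a * c = r ^ 2) :
    r / c * (r / a) = 1 := by
  field_simp
  linear_combination -h

theorem inv_sq_mul_neg_div_eq {a b c r : ℂ} (ha : a ≠ 0) (hr : r ≠ 0)
    (h : a * c = r ^ 2) :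
    ((r / c) ^ 2)⁻¹ * (-b / c) = -(b / a) := by
  field_simp
  linear_combination -b * h

/-- On the set of the `φ_α(M)k` with `M₁₁ ≠ 0` there is a retraction to `K`: its value at `g` is
the second factor of the decomposition of `g` for which `M₁₁ > 0`, and such an `M` can be
computed from `Ad(g) α^∨`. -/
theorem exists_retraction (α : H.root) : ∃ (U : Set (GL (Fin n) ℂ))
    (κ : GL (Fin n) ℂ → GL (Fin n) ℂ), IsOpen U ∧ ContinuousOn κ U ∧
    (∀ M g, IsSU M → (M, g) ∈ slGraph (D.E α) (D.E (negRoot α)) → M.1 0 0 ≠ 0 → g ∈ U) ∧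
    (∀ g ∈ D.Crefl (refl α), g ∈ U → κ g ∈ D.K) ∧
    ∀ g ∈ U, ∀ k ∈ D.K, g * k ∈ U ∧ κ (g * k) = κ g * k := by
  obtain ⟨P, Q, hP, hQ, hK, hPQ⟩ := D.exists_coordinates α
  have s := D.isMatrixSl2 α
  -- the parameters of the three factors of the big cell decomposition
  let u : GL (Fin n) ℂ → ℂ := fun g => -P g / (1 + ((Q g).re : ℂ))
  let d : GL (Fin n) ℂ → ℂ := fun g => ((√((1 + (Q g).re) / 2) : ℝ) : ℂ)
  let S : GL (Fin n) ℂ → GL (Fin n) ℂ := fun g =>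
    expGL (u g • D.E α) * sh (D.E α) (D.E (negRoot α)) (d g)⁻¹ *
      expGL ((-starRingEnd ℂ (u g)) • D.E (negRoot α))
  let U : Set (GL (Fin n) ℂ) := {g | -1 < (Q g).re}
  have hre : Continuous fun g => (Q g).re := Complex.continuous_re.comp hQ
  have hpos : ∀ g ∈ U, 0 < 1 + (Q g).re := by
    intro g (hg : -1 < (Q g).re); linarith
  have hd0 : ∀ g ∈ U, (d g)⁻¹ ≠ 0 := by
    intro g hg
    refine inv_ne_zero (Complex.ofReal_ne_zero.mpr (Real.sqrt_pos.mpr ?_).ne')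
    have := hpos g hg
    positivity
  have hu : ContinuousOn u U := by
    refine ContinuousOn.div hP.neg.continuousOn
      (continuous_const.add (Complex.continuous_ofReal.comp hre)).continuousOn fun g hg => ?_
    have := (hpos g hg).ne'
    exact_mod_cast this
  have hd : ContinuousOn d U := (Complex.continuous_ofReal.comp (Real.continuous_sqrt.comp
    ((continuous_const.add hre).div_const 2))).continuousOn
  have hS : ContinuousOn S U := by
    refine ContinuousOn.mul (ContinuousOn.mul ?_ ?_) ?_
    · exact continuous_expGL.comp_continuousOn (hu.smul continuousOn_const)
    · exact continuousOn_sh.comp (hd.inv₀ fun g hg => fun h => hd0 g hg (by rw [h, inv_zero])) hd0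
    · exact continuous_expGL.comp_continuousOn
        (((Complex.continuous_conj.comp_continuousOn hu).neg).smul continuousOn_const)
  -- `g` and `M` have the same parameters if `Q` and `P` are computed from `M`
  have hcoord : ∀ M g, IsSU M → (M, g) ∈ slGraph (D.E α) (D.E (negRoot α)) →
      ((Q g).re : ℂ) = 2 * (M.1 0 0 * starRingEnd ℂ (M.1 0 0)) - 1 ∧
        P g = -2 * M.1 0 0 * M.1 0 1 := by
    intro M g hM hg
    obtain ⟨r, hr⟩ := s.Ad_h_eq hg
    obtain ⟨e1, e2⟩ := hPQ _ _ _ _ hr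
    refine ⟨?_, e2⟩
    have e3 : Q g = ((2 * ‖M.1 0 0‖ ^ 2 - 1 : ℝ) : ℂ) := by
      have e4 := hM.normSq
      have e5 := Complex.mul_conj' (M.1 0 0)
      rw [e1, hM.entries.1, hM.entries.2]
      push_cast
      linear_combination -e4 + 2 * e5
    rw [e3, Complex.ofReal_re, Complex.mul_conj']
    push_cast
    ring
  refine ⟨U, fun g => (S g)⁻¹ * g, isOpen_lt continuous_const hre,
    hS.inv.mul continuousOn_id, ?_, ?_, ?_⟩
  · intro M g hM hg h0
    have h1 := (hcoord M g hM hg).1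
    rw [Complex.mul_conj'] at h1
    have h2 : (Q g).re = 2 * ‖M.1 0 0‖ ^ 2 - 1 := by exact_mod_cast h1
    have h3 : 0 < ‖M.1 0 0‖ := norm_pos_iff.mpr h0
    change -1 < (Q g).re
    rw [h2]
    have := pow_pos h3 2
    linarith
  · intro g hg hgU
    obtain ⟨a, ha, k, hk, rfl⟩ := D.mem_Crefl_refl.mp hg
    have haU : a ∈ U := by
      change -1 < (Q a).re
      rw [← (hK a k hk).2]; exact hgU
    have hSa : S (a * k) = S a := by
      simp only [S, u, d, hK a k hk]
    obtain ⟨M, hM, haM⟩ := D.mem_phiSU.mp ha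
    obtain ⟨h1, h2⟩ := hcoord M a hM haM
    rw [Complex.mul_conj'] at h1
    have h3 : (Q a).re = 2 * ‖M.1 0 0‖ ^ 2 - 1 := by exact_mod_cast h1
    have hn : 0 < ‖M.1 0 0‖ := by
      refine (norm_nonneg _).lt_of_ne fun h => ?_
      have := hpos a haU
      rw [h3, ← h] at this
      norm_num at this
    have ha0 : M.1 0 0 ≠ 0 := norm_pos_iff.mp hn
    have hda : d a = (‖M.1 0 0‖ : ℂ) := by
      simp only [d]
      rw [h3, show (1 + (2 * ‖M.1 0 0‖ ^ 2 - 1)) / 2 = ‖M.1 0 0‖ ^ 2 by ring,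
        Real.sqrt_sq hn.le]
    have hM11 : M.1 1 1 ≠ 0 := by
      rw [hM.entries.1]; exact (map_ne_zero _).mpr ha0
    have hnC : (‖M.1 0 0‖ : ℂ) ≠ 0 := Complex.ofReal_ne_zero.mpr hn.ne'
    have hnc : M.1 0 0 * starRingEnd ℂ (M.1 0 0) = (‖M.1 0 0‖ : ℂ) ^ 2 := Complex.mul_conj' _
    have hc0 : starRingEnd ℂ (M.1 0 0) ≠ 0 := (map_ne_zero _).mpr ha0
    have hua : u a = M.1 0 1 / M.1 1 1 := by
      simp only [u]
      rw [h1, h2, hM.entries.1, ← hnc]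
      exact neg_div_one_add_eq ha0 hc0
    set z : ℂ := (‖M.1 0 0‖ : ℂ) / M.1 1 1 with hz
    have hz0 : z ≠ 0 := div_ne_zero hnC hM11
    have hz1 : z * starRingEnd ℂ z = 1 := by
      rw [hz, hM.entries.1, map_div₀, Complex.conj_conj, Complex.conj_ofReal]
      exact div_mul_div_eq_one_of_mul_eq_sq ha0 hc0 hnc
    have key : a = S a * sh (D.E α) (D.E (negRoot α)) z := by
      have e1 := s.eq_cell haM hM11
      have e2 : sh (D.E α) (D.E (negRoot α)) (M.1 1 1)⁻¹ =
          sh (D.E α) (D.E (negRoot α)) (‖M.1 0 0‖ : ℂ)⁻¹ * sh (D.E α) (D.E (negRoot α)) z := by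
        rw [s.sh_mul (inv_ne_zero hnC) hz0]
        congr 1
        rw [hz]; field_simp
      refine e1.trans ?_
      change cell _ _ M.1 = expGL (u a • D.E α) * sh (D.E α) (D.E (negRoot α)) (d a)⁻¹ *
        expGL ((-starRingEnd ℂ (u a)) • D.E (negRoot α)) * sh (D.E α) (D.E (negRoot α)) z
      have e3 : (z ^ 2)⁻¹ * (M.1 1 0 / M.1 1 1) = -starRingEnd ℂ (u a) := by
        rw [hua, hz, hM.entries.2, hM.entries.1, map_div₀, Complex.conj_conj]
        exact inv_sq_mul_neg_div_eq ha0 hnC hnc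
      rw [cell, e2, ← hua, hda]
      simp only [mul_assoc]
      rw [s.sh_mul_exp_f hz0, e3]
    have hkey : (S a)⁻¹ * a = D.h α (Units.mk0 z hz0) := by
      rw [inv_mul_eq_iff_eq_mul]; exact key
    change (S (a * k))⁻¹ * (a * k) ∈ D.K
    rw [hSa, ← mul_assoc, hkey]
    exact mul_mem (D.h_mem_K α _ hz1) hk
  · intro g hg k hk
    refine ⟨?_, ?_⟩
    · change -1 < (Q (g * k)).re
      rw [(hK g k hk).2]; exact hg
    · simp only [S, u, d, hK g k hk]
      exact (mul_assoc _ g k).symm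

/-- Local sections of `C_t → C_t/K`, in the form of `K`-equivariant maps to `K`. -/
theorem exists_local_retraction {t : Weyl H} {g₀ : GL (Fin n) ℂ} (h₀ : g₀ ∈ D.Crefl t) :
    ∃ (U : Set (GL (Fin n) ℂ)) (κ : GL (Fin n) ℂ → GL (Fin n) ℂ),
      IsOpen U ∧ g₀ ∈ U ∧ ContinuousOn κ U ∧ (∀ g ∈ D.Crefl t, g ∈ U → κ g ∈ D.K) ∧
        ∀ g ∈ U, ∀ k ∈ D.K, g * k ∈ U ∧ κ (g * k) = κ g * k := by
  obtain ⟨α, rfl⟩ := D.exists_refl_of_mem_Crefl h₀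
  obtain ⟨U, κ, hU, hκ, hMU, hκK, hk⟩ := D.exists_retraction α
  obtain ⟨a, ha, k, hkK, rfl⟩ := D.mem_Crefl_refl.mp h₀
  obtain ⟨M, hM, haM⟩ := D.mem_phiSU.mp ha
  by_cases h0 : M.1 0 0 = 0
  · -- translate by the inverse of `ω_α`
    have h1 : (D.omega α)⁻¹ * a ∈ U := by
      refine hMU (antidiag⁻¹ * M) _ (isSU_antidiag.inv.mul hM)
        (mk_mul_mk_mem (mk_inv_mem antidiag_mem_slGraph) haM) ?_
      have h2 : (antidiag⁻¹ * M).1 0 0 = -M.1 1 0 := by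
        rw [Matrix.SpecialLinearGroup.coe_mul, coe_inv_sl]
        simp [antidiag, Matrix.mul_apply, Fin.sum_univ_two]
      rw [h2, hM.entries.2, neg_neg]
      have h3 := hM.normSq
      rw [h0, zero_mul, zero_add] at h3
      exact right_ne_zero_of_mul (h3.trans_ne one_ne_zero)
    have hc : Continuous fun g => (D.omega α)⁻¹ * g := continuous_const_mul _
    refine ⟨(fun g => (D.omega α)⁻¹ * g) ⁻¹' U, fun g => κ ((D.omega α)⁻¹ * g), hU.preimage hc,
      ?_, hκ.comp hc.continuousOn (Set.mapsTo_preimage _ _), ?_, ?_⟩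
    · change (D.omega α)⁻¹ * (a * k) ∈ U
      rw [← mul_assoc]; exact (hk _ h1 k hkK).1
    · intro g hg hgU
      refine hκK _ ?_ hgU
      obtain ⟨a, ha, k, hkK, rfl⟩ := D.mem_Crefl_refl.mp hg
      exact D.mem_Crefl_refl.mpr ⟨_, D.mul_mem_phiSU (D.inv_mem_phiSU (D.omega_mem_phiSU α)) ha,
        k, hkK, (mul_assoc _ _ _).symm⟩
    · intro g hg k hkK
      have := hk _ hg k hkK
      rw [mul_assoc] at this
      exact this
  · exact ⟨U, κ, hU, (hk _ (hMU M a hM haM h0) k hkK).1, hκ, hκK, hk⟩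

end ChevalleyData

end Interface

/-! ### Ordered products and predecessors -/

open ChevalleyData (pred extend)

section OrderedProd

variable {J M : Type*} [LinearOrder J] [Finite J] [Monoid M]

theorem orderedProd_eq_of_list {S : Set J} {l : List J} (hl : l.Pairwise (· ≤ ·)) (hn : l.Nodup)
    (hS : ∀ j, j ∈ l ↔ j ∈ S) (g : J → M) : orderedProd S g = (l.map g).prod := by
  have h : S.toFinite.toFinset.sort (· ≤ ·) = l := by
    refine List.Perm.eq_of_pairwise' (Finset.pairwise_sort _ _) hl ?_
    rw [List.perm_ext_iff_of_nodup (Finset.sort_nodup _ _) hn]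
    intro j
    rw [Finset.mem_sort, Set.Finite.mem_toFinset, hS]
  rw [orderedProd, h]

theorem exists_list (S : Set J) : ∃ l : List J, l.Pairwise (· ≤ ·) ∧ l.Nodup ∧ ∀ j, j ∈ l ↔ j ∈ S :=
  ⟨S.toFinite.toFinset.sort (· ≤ ·), Finset.pairwise_sort _ _, Finset.sort_nodup _ _,
    fun j => by rw [Finset.mem_sort, Set.Finite.mem_toFinset]⟩

theorem orderedProd_union {A B : Set J} (h : ∀ a ∈ A, ∀ b ∈ B, a < b) (g : J → M) :
    orderedProd (A ∪ B) g = orderedProd A g * orderedProd B g := by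
  obtain ⟨l, h1, h2, h3⟩ := exists_list A
  obtain ⟨m, k1, k2, k3⟩ := exists_list B
  rw [orderedProd_eq_of_list h1 h2 h3, orderedProd_eq_of_list k1 k2 k3,
    orderedProd_eq_of_list (l := l ++ m), List.map_append, List.prod_append]
  · refine List.pairwise_append.mpr ⟨h1, k1, fun a ha b hb => ?_⟩
    exact (h a ((h3 a).mp ha) b ((k3 b).mp hb)).le
  · refine List.nodup_append.mpr ⟨h2, k2, fun a ha b hb => ?_⟩
    exact (h a ((h3 a).mp ha) b ((k3 b).mp hb)).ne
  · intro j; rw [List.mem_append, h3, k3]; rfl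

theorem orderedProd_empty (g : J → M) : orderedProd ∅ g = 1 :=
  orderedProd_eq_of_list (l := []) List.Pairwise.nil List.nodup_nil (by simp) g

theorem orderedProd_singleton (a : J) (g : J → M) : orderedProd {a} g = g a := by
  rw [orderedProd_eq_of_list (l := [a]) (List.pairwise_singleton _ _) (List.nodup_singleton _)
    (by simp)]
  simp

theorem orderedProd_image {J' : Type*} [LinearOrder J'] [Finite J'] {e : J' → J}
    (he : StrictMono e) (S : Set J') (g : J → M) :
    orderedProd (e '' S) g = orderedProd S fun j => g (e j) := by
  obtain ⟨l, h1, h2, h3⟩ := exists_list S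
  rw [orderedProd_eq_of_list h1 h2 h3, orderedProd_eq_of_list (l := l.map e), List.map_map]
  · rfl
  · exact List.pairwise_map.mpr (h1.imp fun h => he.monotone h)
  · exact h2.map he.injective
  · intro j; simp [h3]

theorem orderedProd_mem {A B : Type*} [Group A] [Group B] {N : Subgroup (A × B)} {S : Set J}
    {u : J → A} {g : J → B} (h : ∀ j ∈ S, (u j, g j) ∈ N) :
    (orderedProd S u, orderedProd S g) ∈ N := by
  obtain ⟨l, h1, h2, h3⟩ := exists_list S
  rw [orderedProd_eq_of_list h1 h2 h3, orderedProd_eq_of_list h1 h2 h3]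
  have h4 : ∀ j ∈ l, (u j, g j) ∈ N := fun j hj => h j ((h3 j).mp hj)
  clear h1 h2 h3
  induction l with
  | nil => exact N.one_mem
  | cons a l ih =>
    rw [List.map_cons, List.map_cons, List.prod_cons, List.prod_cons]
    exact mk_mul_mk_mem (h4 a List.mem_cons_self) (ih fun j hj => h4 j (List.mem_cons_of_mem a hj))

theorem continuous_orderedProd [TopologicalSpace M] [ContinuousMul M] (S : Set J) :
    Continuous fun g : J → M => orderedProd S g :=
  continuous_list_prod _ fun j _ => continuous_apply j

end OrderedProd

section Pred

variable {I : Type*} [LinearOrder I] [Finite I]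

/-- The largest element of a set, `-∞` for the empty set. -/
abbrev setMax (S : Set I) : WithBot I := S.toFinite.toFinset.max

theorem setMax_eq_bot {S : Set I} : setMax S = ⊥ ↔ ∀ j, j ∉ S := by
  rw [setMax, Finset.max_eq_bot, Set.Finite.toFinset_eq_empty, Set.eq_empty_iff_forall_notMem]

theorem setMax_eq_coe {S : Set I} {j : I} :
    setMax S = (j : WithBot I) ↔ j ∈ S ∧ ∀ l ∈ S, l ≤ j := by
  constructor
  · intro h
    refine ⟨(Set.Finite.mem_toFinset _).mp (Finset.mem_of_max h), fun l hl => ?_⟩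
    exact Finset.le_max_of_eq ((Set.Finite.mem_toFinset _).mpr hl) h
  · rintro ⟨h1, h2⟩
    refine le_antisymm (Finset.max_le fun l hl => ?_)
      (Finset.le_max ((Set.Finite.mem_toFinset _).mpr h1))
    exact WithBot.coe_le_coe.mpr (h2 l ((Set.Finite.mem_toFinset _).mp hl))

theorem pred_eq_bot {i : I} : pred i = ⊥ ↔ ∀ j, ¬ j < i := setMax_eq_bot

theorem pred_eq_coe {i j : I} : pred i = (j : WithBot I) ↔ j < i ∧ ∀ l < i, l ≤ j := setMax_eq_coe

theorem extend_bot {M : Type*} [One M] (k : I → M) : extend k ⊥ = 1 := rfl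

theorem extend_coe {M : Type*} [One M] (k : I → M) (j : I) : extend k (j : WithBot I) = k j := rfl

theorem extend_mul {M : Type*} [Monoid M] (k l : I → M) (j : WithBot I) :
    extend (fun i => k i * l i) j = extend k j * extend l j := by
  cases j
  · exact (one_mul 1).symm
  · rfl

theorem extend_one {M : Type*} [One M] (j : WithBot I) : extend (fun _ => (1 : M)) j = 1 := by
  cases j <;> rfl

theorem extend_mem {G : Type*} [Group G] {K : Subgroup G} {k : I → G} (hk : ∀ i, k i ∈ K)
    (j : WithBot I) : extend k j ∈ K := by
  cases j
  · exact one_mem K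
  · exact hk _

/-- Induction along a finite linear order, over the elements that are at least `a`. -/
theorem Icc_induction {a : I} {p : I → Prop} (h0 : p a)
    (h : ∀ (b j : I), pred b = (j : WithBot I) → a ≤ j → p j → p b) {b : I} (hb : a ≤ b) : p b := by
  induction b using WellFoundedLT.induction with
  | ind b ih =>
    rcases hb.eq_or_lt with rfl | hab
    · exact h0
    · cases hj : pred b with
      | bot => exact absurd hab (pred_eq_bot.mp hj a)
      | coe j =>
        obtain ⟨h1, h2⟩ := pred_eq_coe.mp hj
        exact h b j hj (h2 a hab) (ih j h1 (h2 a hab))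

theorem orderedProd_Icc_self {M : Type*} [Monoid M] (a : I) (g : I → M) :
    orderedProd (Set.Icc a a) g = g a := by
  rw [Set.Icc_self, orderedProd_singleton]

theorem orderedProd_Icc_succ {M : Type*} [Monoid M] {a b j : I} (h : pred b = (j : WithBot I))
    (haj : a ≤ j) (g : I → M) :
    orderedProd (Set.Icc a b) g = orderedProd (Set.Icc a j) g * g b := by
  obtain ⟨h1, h2⟩ := pred_eq_coe.mp h
  have : Set.Icc a b = Set.Icc a j ∪ {b} := by
    ext x
    simp only [Set.mem_Icc, Set.mem_union, Set.mem_singleton_iff]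
    constructor
    · rintro ⟨hx, hx'⟩
      rcases hx'.eq_or_lt with e | e
      · exact Or.inr e
      · exact Or.inl ⟨hx, h2 x e⟩
    · rintro (⟨hx, hx'⟩ | rfl)
      · exact ⟨hx, (hx'.trans_lt h1).le⟩
      · exact ⟨(haj.trans_lt h1).le, le_rfl⟩
  rw [this, orderedProd_union, orderedProd_singleton]
  rintro x ⟨_, hx⟩ y rfl
  exact hx.trans_lt h1

theorem orderedProd_Iio_mul_Icc {M : Type*} [Monoid M] {a b : I} (h : a ≤ b) (g : I → M) :
    orderedProd (Set.Iio a) g * orderedProd (Set.Icc a b) g =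
      orderedProd (Set.Iio b) g * g b := by
  rw [← orderedProd_union, ← orderedProd_singleton b g, ← orderedProd_union]
  · congr 1
    ext x
    simp only [Set.mem_union, Set.mem_Iio, Set.mem_Icc, Set.mem_singleton_iff]
    constructor
    · rintro (hx | ⟨_, hx⟩)
      · exact Or.inl (hx.trans_le h)
      · exact hx.lt_or_eq
    · rintro (hx | rfl)
      · exact (lt_or_ge x a).imp id fun h => ⟨h, hx.le⟩
      · exact Or.inr ⟨h, le_rfl⟩
  · rintro x hx y rfl; exact hx
  · rintro x hx y ⟨hy, _⟩; exact lt_of_lt_of_le hx hy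

open Classical in
/-- Recursion along a function `p` that decreases the indices. -/
theorem exists_extend_recursion {M : Type*} [One M] {p : I → WithBot I}
    (hp : ∀ (i j : I), p i = (j : WithBot I) → j < i) (Φ : I → M → M) :
    ∃ k : I → M, ∀ i, k i = Φ i (extend k (p i)) := by
  let F : ∀ i : I, (∀ j, j < i → M) → M := fun i ih =>
    Φ i (if h : ∃ j : I, p i = (j : WithBot I) then ih h.choose (hp i _ h.choose_spec) else 1)
  have wf : WellFounded ((· < ·) : I → I → Prop) := wellFounded_lt
  refine ⟨wf.fix F, fun i => ?_⟩
  rw [wf.fix_eq]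
  change Φ i _ = Φ i _
  congr 1
  split_ifs with h
  · conv_rhs => rw [h.choose_spec]
    rfl
  · cases hj : p i with
    | bot => rfl
    | coe j => exact absurd ⟨j, hj⟩ h

/-- A sequence defined by such a recursion depends continuously on parameters. -/
theorem continuousAt_of_extend_recursion {M X : Type*} [One M] [TopologicalSpace M]
    [TopologicalSpace X] {p : I → WithBot I} (hp : ∀ (i j : I), p i = (j : WithBot I) → j < i)
    {k : X → I → M} {x : X}
    (h : ∀ i, ContinuousAt (fun x => extend (k x) (p i)) x → ContinuousAt (fun x => k x i) x)
    (i : I) : ContinuousAt (fun x => k x i) x := by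
  induction i using WellFoundedLT.induction with
  | ind i ih =>
    refine h i ?_
    cases hj : p i with
    | bot => exact continuousAt_const
    | coe j => exact ih j (hp i j hj)

end Pred

section Act

variable {I : Type*} [LinearOrder I] [Finite I] {G : Type*} [Group G]

/-- The right action `(ck)_i = k_{i-1}⁻¹ c_i k_i`. -/
def act (c k : I → G) (i : I) : G := (extend k (pred i))⁻¹ * c i * k i

theorem orderedProd_act (c k : I → G) {a b : I} (h : a ≤ b) :
    orderedProd (Set.Icc a b) (act c k) =
      (extend k (pred a))⁻¹ * orderedProd (Set.Icc a b) c * k b := by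
  refine Icc_induction (p := fun b => orderedProd (Set.Icc a b) (act c k) =
      (extend k (pred a))⁻¹ * orderedProd (Set.Icc a b) c * k b) ?_ ?_ h
  · rw [orderedProd_Icc_self, orderedProd_Icc_self]; rfl
  · intro b j hj haj ih
    rw [orderedProd_Icc_succ hj haj, ih, orderedProd_Icc_succ hj haj, act, hj, extend_coe]
    group

theorem act_one (c : I → G) : act c (fun _ => 1) = c := by
  funext i
  rw [act, extend_one]
  group

end Act

section Nested

variable {I : Type*} [LinearOrder I] {R : Set (I × I)} (F : Set R)

theorem isNested_RF (hR : IsNested R) : IsNested (RF F) where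
  le r hr := hR.le _ hr.1
  endpoints r hr r' hr' hne := by
    have h1 : (((r.1 : I), (r.2 : I)) : I × I) ≠ ((r'.1 : I), (r'.2 : I)) := by
      intro h
      rw [Prod.mk.injEq] at h
      exact hne (Prod.ext (Subtype.ext h.1) (Subtype.ext h.2))
    have h2 := hR.endpoints _ hr.1 _ hr'.1 h1
    rw [Set.disjoint_left] at h2 ⊢
    rintro x hx hx'
    refine h2 (a := x.1) ?_ ?_
    · rcases hx with rfl | rfl
      · exact Or.inl rfl
      · exact Or.inr rfl
    · rcases hx' with rfl | rfl
      · exact Or.inl rfl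
      · exact Or.inr rfl
  nested r hr r' hr' := by
    rcases hR.nested _ hr.1 _ hr'.1 with h | h | h
    · left
      rw [Set.disjoint_left] at h ⊢
      exact fun x hx hx' => h (a := x.1) hx hx'
    · exact Or.inr (Or.inl fun x hx => h (a := x.1) hx)
    · exact Or.inr (Or.inr fun x hx => h (a := x.1) hx)

variable {F}

/-- `b` is not in an interval of `F`, except possibly as its first element. -/
def IsStart (F : Set R) (b : I) : Prop := ∀ f ∈ F, b ∈ Set.Icc f.1.1 f.1.2 → b = f.1.1

theorem isStart_of_mem_compl {b : I} (hb : b ∈ compl F) : IsStart F b :=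
  fun f hf h => absurd h (hb f hf)

theorem eq_of_mem_Icc (hF : F.PairwiseDisjoint fun f => Set.Icc f.1.1 f.1.2) {f f' : R}
    (hf : f ∈ F) (hf' : f' ∈ F) {i : I} (hi : i ∈ Set.Icc f.1.1 f.1.2)
    (hi' : i ∈ Set.Icc f'.1.1 f'.1.2) : f = f' := by
  by_contra h
  exact Set.disjoint_left.mp (hF hf hf' h) hi hi'

end Nested

/-! ### The projection along a set of disjoint intervals -/

section Projection

variable {I : Type*} [LinearOrder I] {R : Set (I × I)} {F : Set R}

theorem isStart_fst (hF : F.PairwiseDisjoint fun f => Set.Icc f.1.1 f.1.2)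
    (hle : ∀ r ∈ R, r.1 ≤ r.2) {f : R} (hf : f ∈ F) : IsStart F f.1.1 := by
  intro f' hf' h
  rw [eq_of_mem_Icc hF hf' hf h ⟨le_rfl, hle _ f.2⟩]

variable [Finite I]

/-- What precedes an element of `I^F` or the first element of an interval of `F` is an element of
`I^F`, the last element of an interval of `F`, or nothing. -/
theorem IsStart.cases {b : I} (hb : IsStart F b) : pred b = ⊥ ∨
    (∃ j ∈ compl F, pred b = (j : WithBot I)) ∨
      ∃ f ∈ F, f.1.1 ≤ f.1.2 ∧ pred b = (f.1.2 : WithBot I) := by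
  cases hj : pred b with
  | bot => exact Or.inl rfl
  | coe j =>
    right
    obtain ⟨h1, h2⟩ := pred_eq_coe.mp hj
    by_cases hc : j ∈ compl F
    · exact Or.inl ⟨j, hc, rfl⟩
    · right
      simp only [compl, Set.mem_ofPred_eq, not_forall, not_not] at hc
      obtain ⟨f, hf, h3, h4⟩ := hc
      refine ⟨f, hf, h3.trans h4, ?_⟩
      rw [WithBot.coe_inj]
      refine le_antisymm h4 (h2 _ ?_)
      by_contra h5
      have := hb f hf ⟨h3.trans h1.le, not_lt.mp h5⟩
      rw [this] at h1
      exact absurd h3 (not_le.mpr h1)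

/-- Induction over `I^F` and the first elements of the intervals of `F`. -/
theorem IsStart.induction (hF : F.PairwiseDisjoint fun f => Set.Icc f.1.1 f.1.2)
    (hle : ∀ r ∈ R, r.1 ≤ r.2) {p : I → Prop} (bot : ∀ b, pred b = ⊥ → p b)
    (compl : ∀ b, ∀ j ∈ compl F, pred b = (j : WithBot I) → p j → p b)
    (last : ∀ b, IsStart F b → ∀ f ∈ F, f.1.1 ≤ f.1.2 → pred b = (f.1.2 : WithBot I) →
      p f.1.1 → p b)
    {b : I} (hb : IsStart F b) : p b := by
  induction b using WellFoundedLT.induction with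
  | ind b ih =>
    rcases hb.cases with h | ⟨j, hj, h⟩ | ⟨f, hf, hf', h⟩
    · exact bot b h
    · exact compl b j hj h (ih j (pred_eq_coe.mp h).1 (isStart_of_mem_compl hj))
    · exact last b hb f hf hf' h
        (ih _ (hf'.trans_lt (pred_eq_coe.mp h).1) (isStart_fst hF hle hf))

/-- The lexicographic order of the pairs in `R`. -/
abbrev lexOrder (R : Set (I × I)) : LinearOrder R :=
  LinearOrder.lift' (fun f : R => toLex f.1) (toLex.injective.comp Subtype.val_injective)

theorem prodBefore_eq {M : Type*} [Monoid M] (u : R → M) (i : I) : prodBefore F u i =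
    @orderedProd R M (lexOrder R) _ _ {f : R | f ∈ F ∧ f.1.2 < i} u := rfl

theorem prodBefore_congr {M : Type*} [Monoid M] {i j : I} (u : R → M)
    (h : ∀ f ∈ F, f.1.2 < i ↔ f.1.2 < j) : prodBefore F u i = prodBefore F u j := by
  have : {f : R | f ∈ F ∧ f.1.2 < i} = {f : R | f ∈ F ∧ f.1.2 < j} :=
    Set.ext fun f => and_congr_right fun hf => h f hf
  rw [prodBefore, prodBefore, this]

theorem prodBefore_of_forall {M : Type*} [Monoid M] {i : I} (u : R → M)
    (h : ∀ f ∈ F, ¬ f.1.2 < i) : prodBefore F u i = 1 := by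
  have : {f : R | f ∈ F ∧ f.1.2 < i} = ∅ :=
    Set.eq_empty_iff_forall_notMem.mpr fun f hf => h f hf.1 hf.2
  rw [prodBefore_eq, this]
  exact @orderedProd_empty _ _ (lexOrder R) _ _ u

theorem prodBefore_of_pred_eq_last {M : Type*} [Monoid M]
    (hF : F.PairwiseDisjoint fun f => Set.Icc f.1.1 f.1.2) (hle : ∀ r ∈ R, r.1 ≤ r.2) {b : I}
    {f : R} (hf : f ∈ F) (h : pred b = (f.1.2 : WithBot I)) (u : R → M) :
    prodBefore F u b = prodBefore F u f.1.1 * u f := by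
  obtain ⟨h1, h2⟩ := pred_eq_coe.mp h
  have hf' := hle _ f.2
  have key : {g : R | g ∈ F ∧ g.1.2 < b} = {g : R | g ∈ F ∧ g.1.2 < f.1.1} ∪ {f} := by
    ext g
    simp only [Set.mem_ofPred_eq, Set.mem_union, Set.mem_singleton_iff]
    constructor
    · rintro ⟨hg, hgb⟩
      rcases lt_or_ge g.1.2 f.1.1 with h3 | h3
      · exact Or.inl ⟨hg, h3⟩
      · exact Or.inr (eq_of_mem_Icc hF hg hf ⟨hle _ g.2, le_rfl⟩ ⟨h3, h2 _ hgb⟩)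
    · rintro (⟨hg, h3⟩ | rfl)
      · exact ⟨hg, h3.trans (hf'.trans_lt h1)⟩
      · exact ⟨hf, h1⟩
  have hlt : ∀ g ∈ {g : R | g ∈ F ∧ g.1.2 < f.1.1}, ∀ g' ∈ ({f} : Set R),
      (lexOrder R).lt g g' := by
    rintro g ⟨hg, h3⟩ g' rfl
    exact Prod.Lex.toLex_lt_toLex.mpr (Or.inl ((hle _ g.2).trans_lt h3))
  rw [prodBefore_eq, key, @orderedProd_union _ _ (lexOrder R) _ _ _ _ hlt,
    @orderedProd_singleton _ _ (lexOrder R)]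
  rfl

theorem prodBefore_mem {A B : Type*} [Group A] [Group B] {N : Subgroup (A × B)} {v : R → A}
    {u : R → B} (h : ∀ f ∈ F, (v f, u f) ∈ N) (i : I) :
    (prodBefore F v i, prodBefore F u i) ∈ N :=
  @orderedProd_mem _ (lexOrder R) _ _ _ _ _ _ {f : R | f ∈ F ∧ f.1.2 < i} _ _ fun f hf => h f hf.1

theorem prodBefore_of_pred_eq_bot {M : Type*} [Monoid M] {b : I} (h : pred b = ⊥) (u : R → M) :
    prodBefore F u b = 1 :=
  prodBefore_of_forall u fun _ _ => pred_eq_bot.mp h _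

theorem prodBefore_of_pred_eq_compl {M : Type*} [Monoid M] (hle : ∀ r ∈ R, r.1 ≤ r.2) {b j : I}
    (hj : j ∈ compl F) (h : pred b = (j : WithBot I)) (u : R → M) :
    prodBefore F u b = prodBefore F u j := by
  obtain ⟨h1, h2⟩ := pred_eq_coe.mp h
  refine prodBefore_congr u fun f hf => ⟨fun h3 => ?_, fun h3 => h3.trans h1⟩
  refine (h2 _ h3).lt_of_ne fun h4 => hj f hf ?_
  rw [← h4]
  exact ⟨hle _ f.2, le_rfl⟩

/-- The elements of `I^F` that are less than `b`. -/
def complBefore (F : Set R) (b : I) : Set (compl F) := {x | x.1 < b}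

theorem complBefore_of_pred_eq_bot {b : I} (h : pred b = ⊥) : complBefore F b = ∅ :=
  Set.eq_empty_iff_forall_notMem.mpr fun x hx => pred_eq_bot.mp h x.1 hx

theorem complBefore_of_pred_eq_compl {b j : I} (hj : j ∈ compl F) (h : pred b = (j : WithBot I)) :
    complBefore F b = complBefore F j ∪ {⟨j, hj⟩} := by
  obtain ⟨h1, h2⟩ := pred_eq_coe.mp h
  ext x
  simp only [complBefore, Set.mem_ofPred_eq, Set.mem_union, Set.mem_singleton_iff, Subtype.ext_iff]
  exact ⟨fun hx => (h2 _ hx).lt_or_eq, fun hx => hx.elim (fun hx => hx.trans h1) fun hx => hx ▸ h1⟩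

theorem complBefore_of_pred_eq_last {b : I} {f : R} (hf : f ∈ F) (hf' : f.1.1 ≤ f.1.2)
    (h : pred b = (f.1.2 : WithBot I)) : complBefore F b = complBefore F f.1.1 := by
  obtain ⟨h1, h2⟩ := pred_eq_coe.mp h
  ext x
  simp only [complBefore, Set.mem_ofPred_eq]
  refine ⟨fun hx => ?_, fun hx => hx.trans (hf'.trans_lt h1)⟩
  by_contra h3
  exact x.2 f hf ⟨not_lt.mp h3, h2 _ hx⟩

/-- The last element of `I^F` before `b`. -/
abbrev complPred (F : Set R) (b : I) : WithBot (compl F) := setMax (complBefore F b)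

theorem complPred_coe (b : compl F) : complPred F b.1 = pred b := rfl

theorem complPred_of_pred_eq_bot {b : I} (h : pred b = ⊥) : complPred F b = ⊥ := by
  rw [setMax_eq_bot, complBefore_of_pred_eq_bot h]; exact fun _ => id

theorem complPred_of_pred_eq_compl {b j : I} (hj : j ∈ compl F) (h : pred b = (j : WithBot I)) :
    complPred F b = ((⟨j, hj⟩ : compl F) : WithBot (compl F)) := by
  rw [setMax_eq_coe, complBefore_of_pred_eq_compl hj h]
  refine ⟨Or.inr rfl, ?_⟩
  rintro l (hl | rfl)
  · exact le_of_lt hl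
  · exact le_rfl

variable {G : Type*} [Group G]

/-- The sequence `c^F_i = u^i c_i (u^i)⁻¹`, `i ∈ I^F`, for representatives `u_f` of the `v_f`. -/
def proj (F : Set R) (u : R → G) (c : I → G) (i : compl F) : G :=
  prodBefore F u i.1 * c i.1 * (prodBefore F u i.1)⁻¹

/-- The products of `c` along the intervals of `F` are the `u_f`. -/
def Balanced (F : Set R) (u : R → G) (c : I → G) : Prop :=
  ∀ f ∈ F, orderedProd (Set.Icc f.1.1 f.1.2) c = u f

theorem orderedProd_complBefore (hF : F.PairwiseDisjoint fun f => Set.Icc f.1.1 f.1.2)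
    (hle : ∀ r ∈ R, r.1 ≤ r.2) {u : R → G} {c : I → G} (hc : Balanced F u c) {b : I}
    (hb : IsStart F b) : orderedProd (complBefore F b) (proj F u c) =
      orderedProd (Set.Iio b) c * (prodBefore F u b)⁻¹ := by
  have hIio : ∀ {b j : I}, pred b = (j : WithBot I) → ∀ {a : I}, a ≤ j →
      orderedProd (Set.Iio b) c = orderedProd (Set.Iio a) c * orderedProd (Set.Icc a j) c := by
    intro b j h a haj
    obtain ⟨h1, h2⟩ := pred_eq_coe.mp h
    rw [← orderedProd_union]
    · congr 1
      ext x
      simp only [Set.mem_union, Set.mem_Iio, Set.mem_Icc]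
      constructor
      · intro hx
        exact (lt_or_ge x a).imp id fun h => ⟨h, h2 _ hx⟩
      · rintro (hx | ⟨_, hx⟩)
        · exact hx.trans (haj.trans_lt h1)
        · exact hx.trans_lt h1
    · rintro x hx y ⟨hy, _⟩; exact lt_of_lt_of_le hx hy
  refine hb.induction hF hle (p := fun b => orderedProd (complBefore F b) (proj F u c) =
      orderedProd (Set.Iio b) c * (prodBefore F u b)⁻¹) ?_ ?_ ?_
  · intro b h
    have h1 : Set.Iio b = ∅ := Set.eq_empty_iff_forall_notMem.mpr fun x hx => pred_eq_bot.mp h x hx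
    rw [complBefore_of_pred_eq_bot h, prodBefore_of_pred_eq_bot h, h1, orderedProd_empty,
      orderedProd_empty, inv_one, mul_one]
  · intro b j hj h ih
    rw [complBefore_of_pred_eq_compl hj h, prodBefore_of_pred_eq_compl hle hj h,
      orderedProd_union, orderedProd_singleton, ih, hIio h le_rfl, orderedProd_Icc_self, proj]
    · group
    · rintro x hx y rfl; exact hx
  · intro b _ f hf hf' h ih
    rw [complBefore_of_pred_eq_last hf hf' h, prodBefore_of_pred_eq_last hF hle hf h, ih,
      hIio h hf', hc f hf]
    group

/-- The products of `c` and of `c^F` along intervals with end points in `I^F`. -/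
theorem orderedProd_proj (hF : F.PairwiseDisjoint fun f => Set.Icc f.1.1 f.1.2)
    (hle : ∀ r ∈ R, r.1 ≤ r.2) {u : R → G} {c : I → G} (hc : Balanced F u c) {a b : compl F}
    (hab : a ≤ b) : orderedProd (Set.Icc a b) (proj F u c) =
      prodBefore F u a.1 * orderedProd (Set.Icc a.1 b.1) c * (prodBefore F u b.1)⁻¹ := by
  have h1 := orderedProd_Iio_mul_Icc hab (proj F u c)
  have h2 := orderedProd_Iio_mul_Icc (a := a.1) (b := b.1) hab c
  have ha := orderedProd_complBefore hF hle hc (isStart_of_mem_compl a.2)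
  have hb := orderedProd_complBefore hF hle hc (isStart_of_mem_compl b.2)
  change orderedProd (Set.Iio a) _ = _ at ha
  change orderedProd (Set.Iio b) _ = _ at hb
  rw [ha, hb, proj] at h1
  have h3 : orderedProd (Set.Icc a b) (proj F u c) = prodBefore F u a.1 *
      ((orderedProd (Set.Iio a.1) c)⁻¹ * (orderedProd (Set.Iio b.1) c * c b.1)) *
        (prodBefore F u b.1)⁻¹ := by
    rw [← mul_right_inj, h1]
    group
  rw [h3, ← h2, inv_mul_cancel_left]

/-- The sequence `k` lifts `m`: it acts on balanced sequences compatibly with the action of `m` on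
their projections and keeps them balanced. -/
structure IsLift (F : Set R) (u : R → G) (m : compl F → G) (k : I → G) : Prop where
  onCompl : ∀ i : compl F, m i = prodBefore F u i.1 * k i.1 * (prodBefore F u i.1)⁻¹
  last : ∀ f ∈ F, k f.1.2 = (u f)⁻¹ * extend k (pred f.1.1) * u f

theorem IsLift.extend_eq (hF : F.PairwiseDisjoint fun f => Set.Icc f.1.1 f.1.2)
    (hle : ∀ r ∈ R, r.1 ≤ r.2) {u : R → G} {m : compl F → G} {k : I → G} (h : IsLift F u m k)
    {b : I} (hb : IsStart F b) :
    extend m (complPred F b) =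
      prodBefore F u b * extend k (pred b) * (prodBefore F u b)⁻¹ := by
  refine hb.induction hF hle (p := fun b => extend m (complPred F b) =
      prodBefore F u b * extend k (pred b) * (prodBefore F u b)⁻¹) ?_ ?_ ?_
  · intro b hb
    rw [complPred_of_pred_eq_bot hb, hb, extend_bot, extend_bot, mul_one, mul_inv_cancel]
  · intro b j hj hb _
    rw [complPred_of_pred_eq_compl hj hb, hb, extend_coe, extend_coe, h.onCompl,
      prodBefore_of_pred_eq_compl hle hj hb]
  · intro b _ f hf hf' hb ih
    have h1 : complPred F b = complPred F f.1.1 := by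
      rw [complPred, complBefore_of_pred_eq_last hf hf' hb]
    rw [h1, ih, hb, extend_coe, h.last f hf, prodBefore_of_pred_eq_last hF hle hf hb]
    group

theorem IsLift.proj_act (hF : F.PairwiseDisjoint fun f => Set.Icc f.1.1 f.1.2)
    (hle : ∀ r ∈ R, r.1 ≤ r.2) {u : R → G} {m : compl F → G} {k : I → G} (h : IsLift F u m k)
    (c : I → G) : proj F u (act c k) = act (proj F u c) m := by
  funext i
  rw [act, ← complPred_coe, h.extend_eq hF hle (isStart_of_mem_compl i.2), h.onCompl, proj, proj,
    act]
  group

theorem balanced_act_iff (hle : ∀ r ∈ R, r.1 ≤ r.2) {u : R → G} {c : I → G}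
    (hc : Balanced F u c) (k : I → G) : Balanced F u (act c k) ↔
      ∀ f ∈ F, k f.1.2 = (u f)⁻¹ * extend k (pred f.1.1) * u f := by
  refine forall₂_congr fun f hf => ?_
  rw [orderedProd_act _ _ (hle _ f.2), hc f hf]
  constructor
  · intro h
    rw [mul_assoc, inv_mul_eq_iff_eq_mul, ← eq_inv_mul_iff_mul_eq] at h
    rw [h, mul_assoc]
  · intro h
    rw [h]; group

theorem isLift_of_balanced (hle : ∀ r ∈ R, r.1 ≤ r.2) {u : R → G} {c k : I → G}
    (hc : Balanced F u c) (hk : Balanced F u (act c k)) : IsLift F u (proj F u k) k :=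
  ⟨fun _ => rfl, (balanced_act_iff hle hc k).mp hk⟩

/-- The restriction of a sequence to the interval of `f`. -/
def res (f : R) (c : I → G) (i : Set.Icc f.1.1 f.1.2) : G := c i.1

theorem orderedProd_res (f : R) (c : I → G) (a b : Set.Icc f.1.1 f.1.2) :
    orderedProd (Set.Icc a b) (res f c) = orderedProd (Set.Icc a.1 b.1) c := by
  have h1 : StrictMono (Subtype.val : Set.Icc f.1.1 f.1.2 → I) := Subtype.strictMono_coe _
  have h2 := orderedProd_image h1 (Set.Icc a b) c
  have h3 : Subtype.val '' Set.Icc a b = Set.Icc a.1 b.1 := by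
    ext x
    constructor
    · rintro ⟨y, hy, rfl⟩; exact hy
    · rintro ⟨h4, h5⟩
      exact ⟨⟨x, a.2.1.trans h4, h5.trans b.2.2⟩, ⟨h4, h5⟩, rfl⟩
  rw [h3] at h2
  exact h2.symm

theorem pred_Icc_cases {f : R} (i : Set.Icc f.1.1 f.1.2) :
    (i.1 = f.1.1 ∧ pred i = ⊥) ∨ ∃ j : Set.Icc f.1.1 f.1.2,
      pred i = (j : WithBot (Set.Icc f.1.1 f.1.2)) ∧ pred i.1 = (j.1 : WithBot I) := by
  rcases i.2.1.eq_or_lt with h | h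
  · left
    refine ⟨h.symm, pred_eq_bot.mpr fun j hj => ?_⟩
    have : j.1 < i.1 := hj
    rw [← h] at this
    exact absurd j.2.1 (not_le.mpr this)
  · right
    cases hj : pred i.1 with
    | bot => exact absurd h (pred_eq_bot.mp hj _)
    | coe j =>
      obtain ⟨h1, h2⟩ := pred_eq_coe.mp hj
      refine ⟨⟨j, h2 _ h, h1.le.trans i.2.2⟩, pred_eq_coe.mpr ⟨h1, fun l hl => h2 l.1 hl⟩, rfl⟩

theorem res_act (f : R) (c k : I → G) (h : extend k (pred f.1.1) = 1) :
    res f (act c k) = act (res f c) (res f k) := by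
  funext i
  rw [act, res, act]
  rcases pred_Icc_cases i with ⟨h1, h2⟩ | ⟨j, h1, h2⟩
  · rw [h2, h1, h, extend_bot, res, res, h1]
  · rw [h1, h2]; rfl

end Projection

/-! ### A criterion for local triviality -/

open Topology

/-- Let `π : X → B` and `ψ : Y → B' × Z` be open quotient maps. Suppose that over an open set `V'`
of `B'` the classes in `B` can be represented, continuously, by points of a subset `P` of `X` on
which the fibres of `π` are those of a map `Ψ : X → B' × Z`, and that `ψ` can be lifted along `Ψ` to
a map with values in `P`. Then `B → B'` is trivial over `V'`, with fibre `Z`. -/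
theorem exists_trivialization {X Y B B' Z : Type*} [TopologicalSpace X] [TopologicalSpace Y]
    [TopologicalSpace B] [TopologicalSpace B'] [TopologicalSpace Z] {π : X → B}
    (hπ : IsOpenQuotientMap π) {ψ : Y → B' × Z} (hψ : IsOpenQuotientMap ψ) {p : B → B'}
    (hp : Continuous p) {V' : Set B'} (hV' : IsOpen V') {Ψ : X → B' × Z} (hΨ : Continuous Ψ)
    (hΨ1 : ∀ x, (Ψ x).1 = p (π x)) {P : Set X}
    (hP : ∀ x ∈ P, ∀ x' ∈ P, π x = π x' ↔ Ψ x = Ψ x') {N : X → X}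
    (hN : ∀ x, p (π x) ∈ V' → ContinuousAt N x ∧ π (N x) = π x ∧ N x ∈ P) {A : Y → X}
    (hA : ∀ y, (ψ y).1 ∈ V' → ContinuousAt A y ∧ Ψ (A y) = ψ y ∧ A y ∈ P) :
    ∃ e : Bundle.Trivialization Z p, e.baseSet = V' := by
  choose rep hrep using hπ.surjective
  choose lift hlift using hψ.surjective
  have hrepV : ∀ {b}, p b ∈ V' → p (π (rep b)) ∈ V' := fun {b} hb => by rwa [hrep]
  have hliftV : ∀ {z : B' × Z}, z.1 ∈ V' → (ψ (lift z)).1 ∈ V' := fun {z} hz => by rwa [hlift]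
  have h1 : ∀ x, p (π x) ∈ V' → Ψ (N (rep (π x))) = Ψ (N x) := by
    intro x hx
    have h2 := hN _ (hrepV hx)
    have h3 := hN _ hx
    rw [← hP _ h2.2.2 _ h3.2.2, h2.2.1, h3.2.1, hrep]
  have h2 : ∀ y, (ψ y).1 ∈ V' → π (A (lift (ψ y))) = π (A y) := by
    intro y hy
    have h2 := hA _ (hliftV hy)
    have h3 := hA _ hy
    rw [hP _ h2.2.2 _ h3.2.2, h2.2.1, h3.2.1, hlift]
  have h3 : ∀ b, p b ∈ V' → (Ψ (N (rep b))).1 = p b := by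
    intro b hb
    rw [hΨ1, (hN _ (hrepV hb)).2.1, hrep]
  have h4 : ∀ z : B' × Z, z.1 ∈ V' → p (π (A (lift z))) = z.1 := by
    intro z hz
    rw [← hΨ1, (hA _ (hliftV hz)).2.1, hlift]
  refine ⟨{
    toFun := fun b => Ψ (N (rep b))
    invFun := fun z => π (A (lift z))
    source := p ⁻¹' V'
    target := V' ×ˢ Set.univ
    map_source' := fun b hb => ⟨by rw [h3 b hb]; exact hb, trivial⟩
    map_target' := fun z hz => by
      change p _ ∈ V'
      rw [h4 z hz.1]; exact hz.1
    left_inv' := ?_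
    right_inv' := ?_
    open_source := hV'.preimage hp
    open_target := hV'.prod isOpen_univ
    continuousOn_toFun := ?_
    continuousOn_invFun := ?_
    baseSet := V'
    open_baseSet := hV'
    source_eq := rfl
    target_eq := rfl
    proj_toFun := h3 }, rfl⟩
  · intro b hb
    have hb' : (Ψ (N (rep b))).1 ∈ V' := by rw [h3 b hb]; exact hb
    have h5 := hN _ (hrepV hb)
    have h6 := hA _ (hliftV hb')
    rw [(hP _ h6.2.2 _ h5.2.2).mpr (by rw [h6.2.1, hlift]), h5.2.1, hrep]
  · intro z hz
    have hz' : p (π (A (lift z))) ∈ V' := by rw [h4 z hz.1]; exact hz.1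
    have h5 := hN _ (hrepV hz')
    have h6 := hA _ (hliftV hz.1)
    rw [(hP _ h5.2.2 _ h6.2.2).mp (by rw [h5.2.1, hrep]), h6.2.1, hlift]
  · intro b hb
    refine ContinuousAt.continuousWithinAt ?_
    obtain ⟨x, rfl⟩ := hπ.surjective b
    rw [← hπ.continuousAt_comp_iff]
    have hopen : p ∘ π ⁻¹' V' ∈ 𝓝 x := (hV'.preimage (hp.comp hπ.continuous)).mem_nhds hb
    refine (hΨ.continuousAt.comp (hN x hb).1).congr ?_
    filter_upwards [hopen] with y hy
    exact (h1 y hy).symm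
  · intro z hz
    refine ContinuousAt.continuousWithinAt ?_
    obtain ⟨y, rfl⟩ := hψ.surjective z
    rw [← hψ.continuousAt_comp_iff]
    have hopen : (fun y => (ψ y).1) ⁻¹' V' ∈ 𝓝 y :=
      (hV'.preimage (continuous_fst.comp hψ.continuous)).mem_nhds hz.1
    refine (hπ.continuous.continuousAt.comp (hA y hz.1).1).congr ?_
    filter_upwards [hopen] with y' hy'
    exact (h2 y' hy').symm

/-! ### Sequences with prescribed cosets -/

/-- The properties of the groups `K`, `𝒩` (given as the graph of `𝒩 → W`) and of the sets `C_t` on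
which the projections of Bott–Samelson varieties depend. -/
structure CosetSystem (G W : Type*) [Group G] [TopologicalSpace G] [Group W] where
  /-- The group `K`, the kernel of `𝒩 → W`. -/
  K : Subgroup G
  /-- The graph of `𝒩 → W`: `(w, g) ∈ N` says that `g` is in the coset of `w`. -/
  N : Subgroup (W × G)
  /-- The set `C_t`. -/
  Cr : W → Set G
  one_mem_iff : ∀ g, (1, g) ∈ N ↔ g ∈ K
  Cr_mul : ∀ {t a k}, a ∈ Cr t → k ∈ K → a * k ∈ Cr t
  mul_Cr : ∀ {t a k}, k ∈ K → a ∈ Cr t → k * a ∈ Cr t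
  conj_Cr : ∀ {w g t a}, (w, g) ∈ N → a ∈ Cr t → g * a * g⁻¹ ∈ Cr (w * t * w⁻¹)
  /-- Local sections of `C_t → C_t/K`, as `K`-equivariant maps `κ` to `K`: the section sends the
  class of `g` to `g κ(g)⁻¹`. -/
  exists_local : ∀ {t g₀}, g₀ ∈ Cr t → ∃ (U : Set G) (κ : G → G),
    IsOpen U ∧ g₀ ∈ U ∧ ContinuousOn κ U ∧ (∀ g ∈ Cr t, g ∈ U → κ g ∈ K) ∧
      ∀ g ∈ U, ∀ k ∈ K, g * k ∈ U ∧ κ (g * k) = κ g * k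

section Topology

variable {I : Type*} [LinearOrder I] [Finite I] {G : Type*} [Group G] [TopologicalSpace G]
  [IsTopologicalGroup G]

theorem continuousAt_extend {X : Type*} [TopologicalSpace X] {k : X → I → G} {x : X}
    (hk : ContinuousAt k x) (j : WithBot I) : ContinuousAt (fun x => extend (k x) j) x := by
  cases j
  · exact continuousAt_const
  · exact (continuousAt_pi.mp hk) _

theorem continuousAt_act {X : Type*} [TopologicalSpace X] {c k : X → I → G} {x : X}
    (hc : ContinuousAt c x) (hk : ContinuousAt k x) : ContinuousAt (fun x => act (c x) (k x)) x :=
  continuousAt_pi.mpr fun i =>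
    ((continuousAt_extend hk (pred i)).inv.mul (continuousAt_pi.mp hc i)).mul
      (continuousAt_pi.mp hk i)

theorem continuous_proj {R : Set (I × I)} (F : Set R) (u : R → G) :
    Continuous fun c : I → G => proj F u c :=
  continuous_pi fun i => (continuous_const.mul (continuous_apply i.1)).mul continuous_const

theorem continuous_res {R : Set (I × I)} (f : R) : Continuous fun c : I → G => res f c :=
  continuous_pi fun i => continuous_apply i.1

/-- The elements of `I^F` and the last elements of the intervals of `F` determine sequences `k`
that change `c` into a balanced sequence and lift `m` if `c` was balanced. -/
theorem exists_gauge {R : Set (I × I)} {F : Set R}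
    (hF : F.PairwiseDisjoint fun f => Set.Icc f.1.1 f.1.2) (hle : ∀ r ∈ R, r.1 ≤ r.2) (u : R → G) :
    ∃ k : (I → G) × (compl F → G) → I → G, Continuous k ∧
      (∀ x, ∀ i : compl F, k x i.1 = (prodBefore F u i.1)⁻¹ * x.2 i * prodBefore F u i.1) ∧
      (∀ x, ∀ f ∈ F, k x f.1.2 =
        (orderedProd (Set.Icc f.1.1 f.1.2) x.1)⁻¹ * extend (k x) (pred f.1.1) * u f) ∧
      ∀ x i, i ∉ compl F → (∀ f ∈ F, i ≠ f.1.2) → k x i = 1 := by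
  classical
  let p : I → WithBot I := fun i => if h : ∃ f ∈ F, i = f.1.2 then pred h.choose.1.1 else ⊥
  have hmem : ∀ {f : R}, f.1.2 ∈ Set.Icc f.1.1 f.1.2 := fun {f} => ⟨hle _ f.2, le_rfl⟩
  have huniq : ∀ {f}, f ∈ F → ∀ h : ∃ f' ∈ F, f.1.2 = f'.1.2, h.choose = f := by
    intro f hf h
    exact eq_of_mem_Icc hF h.choose_spec.1 hf (i := f.1.2)
      ⟨(hle _ h.choose.2).trans_eq h.choose_spec.2.symm, h.choose_spec.2.le⟩ hmem
  have hlast : ∀ {f}, f ∈ F → p f.1.2 = pred f.1.1 := by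
    intro f hf
    have h : ∃ f' ∈ F, f.1.2 = f'.1.2 := ⟨f, hf, rfl⟩
    simp only [p]
    rw [dif_pos h, huniq hf h]
  have hp : ∀ (i j : I), p i = (j : WithBot I) → j < i := by
    intro i j h
    by_cases hi : ∃ f ∈ F, i = f.1.2
    · obtain ⟨f, hf, rfl⟩ := hi
      rw [hlast hf] at h
      exact (pred_eq_coe.mp h).1.trans_le (hle _ f.2)
    · simp only [p] at h
      rw [dif_neg hi] at h
      exact absurd h.symm (WithBot.coe_ne_bot)
  have hnl : ∀ i : compl F, ¬ ∃ f ∈ F, i.1 = f.1.2 := by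
    rintro i ⟨f, hf, h⟩
    refine i.2 f hf ?_
    rw [h]; exact hmem
  let Φ : (I → G) × (compl F → G) → I → G → G := fun x i y =>
    if h : i ∈ compl F then (prodBefore F u i)⁻¹ * x.2 ⟨i, h⟩ * prodBefore F u i
    else if h : ∃ f ∈ F, i = f.1.2 then
      (orderedProd (Set.Icc h.choose.1.1 h.choose.1.2) x.1)⁻¹ * y * u h.choose
    else 1
  choose k hk using fun x => exists_extend_recursion hp (Φ x)
  have h1 : ∀ x, ∀ i : compl F,
      k x i.1 = (prodBefore F u i.1)⁻¹ * x.2 i * prodBefore F u i.1 := by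
    intro x i
    rw [hk]
    simp only [Φ]
    rw [dif_pos i.2]
  have h2 : ∀ x, ∀ f ∈ F, k x f.1.2 =
      (orderedProd (Set.Icc f.1.1 f.1.2) x.1)⁻¹ * extend (k x) (pred f.1.1) * u f := by
    intro x f hf
    have h : ∃ f' ∈ F, f.1.2 = f'.1.2 := ⟨f, hf, rfl⟩
    rw [hk, hlast hf]
    simp only [Φ]
    rw [dif_neg (fun h => h f hf hmem), dif_pos h, huniq hf h]
  have h3 : ∀ x i, i ∉ compl F → (∀ f ∈ F, i ≠ f.1.2) → k x i = 1 := by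
    intro x i hi hi'
    rw [hk]
    simp only [Φ]
    rw [dif_neg hi, dif_neg]
    rintro ⟨f, hf, h⟩
    exact hi' f hf h
  refine ⟨k, ?_, h1, h2, h3⟩
  rw [continuous_iff_continuousAt]
  intro x
  refine continuousAt_pi.mpr fun i => continuousAt_of_extend_recursion hp ?_ i
  intro i hi
  by_cases hc : i ∈ compl F
  · have : (fun x => k x i) = fun x => (prodBefore F u i)⁻¹ * x.2 ⟨i, hc⟩ * prodBefore F u i :=
      funext fun x => h1 x ⟨i, hc⟩
    rw [this]
    exact ((continuous_const.mul ((continuous_apply _).comp continuous_snd)).mul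
      continuous_const).continuousAt
  · by_cases hl : ∃ f ∈ F, i = f.1.2
    · obtain ⟨f, hf, rfl⟩ := hl
      rw [hlast hf] at hi
      have : (fun x => k x f.1.2) = fun x =>
          (orderedProd (Set.Icc f.1.1 f.1.2) x.1)⁻¹ * extend (k x) (pred f.1.1) * u f :=
        funext fun x => h2 x f hf
      rw [this]
      exact (((continuous_orderedProd _).comp continuous_fst).inv.continuousAt.mul hi).mul
        continuousAt_const
    · have : (fun x => k x i) = fun _ => 1 :=
        funext fun x => h3 x i hc fun f hf h => hl ⟨f, hf, h⟩
      rw [this]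
      exact continuousAt_const

/-- Sequences on `I` are the same as sequences on `I^F` together with sequences on the intervals
of `F`. -/
theorem exists_assemble {R : Set (I × I)} {F : Set R}
    (hF : F.PairwiseDisjoint fun f => Set.Icc f.1.1 f.1.2) (u : R → G) :
    ∃ A : (compl F → G) × (∀ f : F, Set.Icc f.1.1.1 f.1.1.2 → G) → I → G, Continuous A ∧
      ∀ x, proj F u (A x) = x.1 ∧ ∀ f : F, res f.1 (A x) = x.2 f := by
  classical
  have hex : ∀ {i}, i ∉ compl F → ∃ f : F, i ∈ Set.Icc f.1.1.1 f.1.1.2 := by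
    intro i hi
    simp only [compl, Set.mem_ofPred_eq, not_forall, not_not] at hi
    obtain ⟨f, hf, h⟩ := hi
    exact ⟨⟨f, hf⟩, h⟩
  let A : (compl F → G) × (∀ f : F, Set.Icc f.1.1.1 f.1.1.2 → G) → I → G := fun x i =>
    if h : i ∈ compl F then (prodBefore F u i)⁻¹ * x.1 ⟨i, h⟩ * prodBefore F u i
    else x.2 (hex h).choose ⟨i, (hex h).choose_spec⟩
  have h1 : ∀ x, ∀ i : compl F, A x i.1 = (prodBefore F u i.1)⁻¹ * x.1 i * prodBefore F u i.1 :=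
    fun x i => dif_pos i.2
  have h2 : ∀ x, ∀ f : F, ∀ i : Set.Icc f.1.1.1 f.1.1.2, A x i.1 = x.2 f i := by
    intro x f i
    have hi : i.1 ∉ compl F := fun h => h f.1 f.2 i.2
    have h3 : A x i.1 = x.2 (hex hi).choose ⟨i, (hex hi).choose_spec⟩ := dif_neg hi
    have h4 : (hex hi).choose = f :=
      Subtype.ext (eq_of_mem_Icc hF (hex hi).choose.2 f.2 (hex hi).choose_spec i.2)
    rw [h3]
    generalize hex hi = h5 at h4
    revert h4
    generalize h5.choose_spec = h6
    revert h6
    generalize h5.choose = g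
    rintro h6 rfl
    rfl
  refine ⟨A, continuous_pi fun i => ?_, fun x => ⟨funext fun i => ?_, fun f => funext (h2 x f)⟩⟩
  · by_cases hi : i ∈ compl F
    · have : (fun x => A x i) = fun x => (prodBefore F u i)⁻¹ * x.1 ⟨i, hi⟩ * prodBefore F u i :=
        funext fun x => h1 x ⟨i, hi⟩
      rw [this]
      exact (continuous_const.mul ((continuous_apply _).comp continuous_fst)).mul continuous_const
    · obtain ⟨f, hf⟩ := hex hi
      have : (fun x => A x i) = fun x => x.2 f ⟨i, hf⟩ := funext fun x => h2 x f ⟨i, hf⟩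
      rw [this]
      exact (continuous_apply _).comp ((continuous_apply f).comp continuous_snd)
  · rw [proj, h1]; group

variable {W : Type*} [Group W]

namespace CosetSystem

variable (S : CosetSystem G W)

/-- Equivariant maps to `K^I`, locally in the space of sequences; they exist since the maps
`C_t → C_t/K` have local sections. -/
theorem exists_equivariant {t : I → W} {d₀ : I → G} (h₀ : ∀ i, d₀ i ∈ S.Cr (t i)) :
    ∃ (V : Set (I → G)) (θ : (I → G) → I → G), IsOpen V ∧ d₀ ∈ V ∧ (∀ d ∈ V, ContinuousAt θ d) ∧
      (∀ d ∈ V, (∀ i, d i ∈ S.Cr (t i)) → ∀ i, θ d i ∈ S.K) ∧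
      ∀ d ∈ V, ∀ m : I → G, (∀ i, m i ∈ S.K) →
        act d m ∈ V ∧ θ (act d m) = fun i => θ d i * m i := by
  have hloc : ∀ i, ∃ (U : Set G) (κ : G → G), IsOpen U ∧ d₀ i ∈ U ∧ κ (d₀ i) = 1 ∧
      ContinuousOn κ U ∧ (∀ g ∈ S.Cr (t i), g ∈ U → κ g ∈ S.K) ∧
      ∀ g ∈ U, ∀ k ∈ S.K, g * k ∈ U ∧ κ (g * k) = κ g * k := by
    intro i
    obtain ⟨U, κ, h1, h2, h3, h4, h5⟩ := S.exists_local (h₀ i)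
    refine ⟨U, fun g => (κ (d₀ i))⁻¹ * κ g, h1, h2, inv_mul_cancel _, continuousOn_const.mul h3,
      fun g hg hgU => mul_mem (inv_mem (h4 _ (h₀ i) h2)) (h4 g hg hgU), fun g hg k hk => ?_⟩
    refine ⟨(h5 g hg k hk).1, ?_⟩
    change (κ (d₀ i))⁻¹ * κ (g * k) = (κ (d₀ i))⁻¹ * κ g * k
    rw [(h5 g hg k hk).2, mul_assoc]
  choose U κ hU h₀U hκ₀ hκ hκK hκk using hloc
  have hp : ∀ (i j : I), pred i = (j : WithBot I) → j < i := fun i j h => (pred_eq_coe.mp h).1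
  choose θ hθ using fun d : I → G => exists_extend_recursion hp fun i y => κ i (y * d i)
  let V : Set (I → G) := {d | ∀ i, extend (θ d) (pred i) * d i ∈ U i}
  have ind : ∀ {q : I → Prop}, (∀ i, (∀ j : I, pred i = (j : WithBot I) → q j) → q i) →
      ∀ i, q i := by
    intro q h i
    induction i using WellFoundedLT.induction with
    | ind i ih => exact h i fun j hj => ih j (hp i j hj)
  have hcont : ∀ d ∈ V, ContinuousAt θ d := by
    intro d hd
    refine continuousAt_pi.mpr fun i => continuousAt_of_extend_recursion hp ?_ i
    intro i hi
    have h1 : (fun d => θ d i) = fun d => κ i (extend (θ d) (pred i) * d i) :=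
      funext fun d => hθ d i
    rw [h1]
    exact ContinuousAt.comp (g := κ i) ((hκ i).continuousAt ((hU i).mem_nhds (hd i)))
      (hi.mul (continuous_apply i).continuousAt)
  refine ⟨V, θ, ?_, ?_, hcont, ?_, ?_⟩
  · rw [isOpen_iff_mem_nhds]
    intro d hd
    have h1 : ∀ i, ∀ᶠ d' in 𝓝 d, extend (θ d') (pred i) * d' i ∈ U i := by
      intro i
      have h2 : ContinuousAt (fun d' : I → G => extend (θ d') (pred i) * d' i) d :=
        (continuousAt_extend (hcont d hd) _).mul (continuous_apply i).continuousAt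
      exact h2.eventually ((hU i).mem_nhds (hd i))
    exact Filter.eventually_all.mpr h1
  · have h1 : ∀ i, θ d₀ i = 1 := by
      refine ind fun i hi => ?_
      rw [hθ]
      have h2 : extend (θ d₀) (pred i) = 1 := by
        cases hj : pred i with
        | bot => rfl
        | coe j => exact hi j hj
      rw [h2, one_mul, hκ₀]
    intro i
    have h2 : extend (θ d₀) (pred i) = 1 := by
      cases hj : pred i with
      | bot => rfl
      | coe j => exact h1 j
    rw [h2, one_mul]
    exact h₀U i
  · intro d hd hdC
    refine ind fun i hi => ?_
    rw [hθ]
    refine hκK i _ (S.mul_Cr ?_ (hdC i)) (hd i)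
    cases hj : pred i with
    | bot => exact one_mem _
    | coe j => exact hi j hj
  · intro d hd m hm
    have h1 : ∀ i, extend (θ (act d m)) (pred i) = extend (θ d) (pred i) * extend m (pred i) →
        extend (θ (act d m)) (pred i) * act d m i = extend (θ d) (pred i) * d i * m i := by
      intro i h
      rw [h, act]
      group
    have h2 : ∀ i, θ (act d m) i = θ d i * m i := by
      refine ind fun i hi => ?_
      rw [hθ, h1, (hκk i _ (hd i) _ (hm i)).2, ← hθ]
      cases hj : pred i with
      | bot => exact (one_mul _).symm
      | coe j => exact hi j hj
    have h3 : θ (act d m) = fun i => θ d i * m i := funext h2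
    refine ⟨fun i => ?_, h3⟩
    rw [h1 i (by rw [h3, extend_mul])]
    exact (hκk i _ (hd i) _ (hm i)).1

theorem conj_mem {w : W} {g k : G} (hg : (w, g) ∈ S.N) (hk : k ∈ S.K) : g * k * g⁻¹ ∈ S.K := by
  rw [← S.one_mem_iff] at hk ⊢
  have := mk_mul_mk_mem (mk_mul_mk_mem hg hk) (mk_inv_mem hg)
  rwa [mul_one, mul_inv_cancel] at this

theorem inv_mul_mul_mem {w : W} {g g' k : G} (hg : (w, g) ∈ S.N) (hg' : (w, g') ∈ S.N)
    (hk : k ∈ S.K) : g⁻¹ * k * g' ∈ S.K := by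
  rw [← S.one_mem_iff] at hk ⊢
  have := mk_mul_mk_mem (mk_mul_mk_mem (mk_inv_mem hg) hk) hg'
  rwa [mul_one, inv_mul_cancel] at this

theorem mul_mem_coset {w : W} {g k k' : G} (hg : (w, g) ∈ S.N) (hk : k ∈ S.K) (hk' : k' ∈ S.K) :
    (w, k⁻¹ * g * k') ∈ S.N := by
  rw [← S.one_mem_iff] at hk hk'
  have := mk_mul_mk_mem (mk_mul_mk_mem (mk_inv_mem hk) hg) hk'
  rwa [mul_one, inv_one, one_mul] at this

/-- The sequences in `∏ C_{s_i}` with products along the intervals of `R` in prescribed cosets. -/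
def IsSeq (s : I → W) {R : Set (I × I)} (v : R → W) (c : I → G) : Prop :=
  (∀ i, c i ∈ S.Cr (s i)) ∧ ∀ r : R, (v r, orderedProd (Set.Icc r.1.1 r.1.2) c) ∈ S.N

variable {S} {s : I → W} {R : Set (I × I)} {v : R → W} {c : I → G}

theorem IsSeq.act (hc : S.IsSeq s v c) (hle : ∀ r ∈ R, r.1 ≤ r.2) {k : I → G}
    (hk : ∀ i, k i ∈ S.K) : S.IsSeq s v (act c k) := by
  refine ⟨fun i => S.Cr_mul (S.mul_Cr (inv_mem (extend_mem hk _)) (hc.1 i)) (hk i), fun r => ?_⟩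
  rw [orderedProd_act _ _ (hle _ r.2)]
  exact S.mul_mem_coset (hc.2 r) (extend_mem hk _) (hk _)

theorem IsSeq.res (hc : S.IsSeq s v c) (f : R) : S.IsSeq (sRes s f) (vRes v f) (res f c) :=
  ⟨fun i => hc.1 i.1, fun r => by rw [orderedProd_res]; exact hc.2 (Rf.toR f r)⟩

variable {F : Set R} {u : R → G}

theorem prodBefore_mem_N (hu : ∀ r, (v r, u r) ∈ S.N) (i : I) :
    (prodBefore F v i, prodBefore F u i) ∈ S.N := prodBefore_mem (fun f _ => hu f) i

theorem IsSeq.proj (hc : S.IsSeq s v c) (hF : F.PairwiseDisjoint fun f => Set.Icc f.1.1 f.1.2)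
    (hle : ∀ r ∈ R, r.1 ≤ r.2) (hu : ∀ r, (v r, u r) ∈ S.N) (hb : Balanced F u c) :
    S.IsSeq (sF F s v) (vF F v) (proj F u c) := by
  refine ⟨fun i => S.conj_Cr (prodBefore_mem_N hu _) (hc.1 i), fun r => ?_⟩
  rw [orderedProd_proj hF hle hb (show r.1.1 ≤ r.1.2 from hle _ r.2.1)]
  exact mk_mul_mk_mem (mk_mul_mk_mem (prodBefore_mem_N hu _) (hc.2 (RF.toR F r)))
    (mk_inv_mem (prodBefore_mem_N hu _))

theorem isSeq_of_proj_of_res (hR : IsNested R)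
    (hF : F.PairwiseDisjoint fun f => Set.Icc f.1.1 f.1.2) (hu : ∀ r, (v r, u r) ∈ S.N)
    (hb : Balanced F u c) (h1 : S.IsSeq (sF F s v) (vF F v) (BottSamelson.proj F u c))
    (h2 : ∀ f ∈ F, S.IsSeq (sRes s f) (vRes v f) (BottSamelson.res f c)) : S.IsSeq s v c := by
  constructor
  · intro i
    by_cases hi : i ∈ compl F
    · have h3 := S.conj_Cr (mk_inv_mem (prodBefore_mem_N (F := F) hu i)) (h1.1 ⟨i, hi⟩)
      rw [sF, BottSamelson.proj] at h3
      convert h3 using 1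
      · group
      · group
    · simp only [compl, Set.mem_ofPred_eq, not_forall, not_not] at hi
      obtain ⟨f, hf, h⟩ := hi
      exact (h2 f hf).1 ⟨i, h⟩
  · intro r
    by_cases hr : ∀ f ∈ F, ¬ Set.Icc r.1.1 r.1.2 ⊆ Set.Icc f.1.1 f.1.2
    · obtain ⟨ha, hb'⟩ := mem_compl_of_not_subset F hR r hr
      have h3 := h1.2 ⟨(⟨r.1.1, ha⟩, ⟨r.1.2, hb'⟩), r.2, hr⟩
      rw [orderedProd_proj hF hR.le hb (show (⟨r.1.1, ha⟩ : compl F) ≤ ⟨r.1.2, hb'⟩ from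
        hR.le _ r.2), vF] at h3
      have h4 := mk_mul_mk_mem (mk_mul_mk_mem (mk_inv_mem (prodBefore_mem_N (F := F) hu r.1.1)) h3)
        (prodBefore_mem_N (F := F) hu r.1.2)
      convert h4 using 2
      · change v r = _ * (_ * v r * _) * _
        group
      · group
    · simp only [not_forall, not_not] at hr
      obtain ⟨f, hf, h⟩ := hr
      have ha := h (show r.1.1 ∈ Set.Icc r.1.1 r.1.2 from ⟨le_rfl, hR.le _ r.2⟩)
      have hb' := h (show r.1.2 ∈ Set.Icc r.1.1 r.1.2 from ⟨hR.le _ r.2, le_rfl⟩)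
      have h3 := (h2 f hf).2 ⟨(⟨r.1.1, ha⟩, ⟨r.1.2, hb'⟩), r.2⟩
      rw [orderedProd_res] at h3
      exact h3

/-- Sequences on the interval of `f` can be made balanced. -/
theorem exists_balance (f : R) (hf : f.1.1 ≤ f.1.2) (hu : ∀ r, (v r, u r) ∈ S.N) :
    ∃ β : (Set.Icc f.1.1 f.1.2 → G) → Set.Icc f.1.1 f.1.2 → G, Continuous β ∧
      ∀ e, orderedProd (Set.Icc ⟨f.1.1, le_rfl, hf⟩ ⟨f.1.2, hf, le_rfl⟩) (β e) = u f ∧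
        (S.IsSeq (sRes s f) (vRes v f) e →
          ∃ k : Set.Icc f.1.1 f.1.2 → G, (∀ i, k i ∈ S.K) ∧ β e = BottSamelson.act e k) := by
  classical
  let a : Set.Icc f.1.1 f.1.2 := ⟨f.1.1, le_rfl, hf⟩
  let b : Set.Icc f.1.1 f.1.2 := ⟨f.1.2, hf, le_rfl⟩
  have hab : a ≤ b := hf
  have ha : pred a = ⊥ := pred_eq_bot.mpr fun j => not_lt.mpr j.2.1
  let k : (Set.Icc f.1.1 f.1.2 → G) → Set.Icc f.1.1 f.1.2 → G := fun e i =>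
    if i = b then (orderedProd (Set.Icc a b) e)⁻¹ * u f else 1
  have hk : Continuous k := continuous_pi fun i => by
    by_cases h : i = b
    · simp only [k, if_pos h]
      exact (continuous_orderedProd _).inv.mul continuous_const
    · simp only [k, if_neg h]
      exact continuous_const
  refine ⟨fun e => BottSamelson.act e (k e), ?_, fun e => ⟨?_, fun he => ⟨k e, fun i => ?_, rfl⟩⟩⟩
  · exact continuous_iff_continuousAt.mpr fun e =>
      continuousAt_act continuousAt_id hk.continuousAt
  · change orderedProd (Set.Icc a b) _ = _
    rw [orderedProd_act _ _ hab, ha, extend_bot]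
    simp only [k, if_true]
    group
  · by_cases h : i = b
    · simp only [k, if_pos h]
      have h1 : (v f, orderedProd (Set.Icc a b) e) ∈ S.N := he.2 ⟨(a, b), f.2⟩
      have := S.inv_mul_mul_mem h1 (hu f) (one_mem _)
      rwa [mul_one] at this
    · simp only [k, if_neg h]
      exact one_mem _

end CosetSystem

end Topology

/-! ### Equivalence of sequences and the projection of the quotients -/

theorem continuousAt_subtype_iff {X Y : Type*} [TopologicalSpace X] [TopologicalSpace Y]
    {q : Y → Prop} {f : X → Subtype q} {x : X} :
    ContinuousAt f x ↔ ContinuousAt (fun x => (f x).1) x :=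
  (show IsInducing (Subtype.val : Subtype q → Y) from ⟨rfl⟩).continuousAt_iff

namespace CosetSystem

section Quotients

variable {I : Type*} [LinearOrder I] [Finite I] {G : Type*} [Group G] [TopologicalSpace G]
  [IsTopologicalGroup G] {W : Type*} [Group W] {S : CosetSystem G W} {s : I → W} {R : Set (I × I)}
  {v : R → W} {F : Set R} {u : R → G}

/-- Sequences `c`, `c'` that represent the same point of the quotient. -/
def Rel (S : CosetSystem G W) (c c' : I → G) : Prop :=
  ∃ k : I → G, (∀ i, k i ∈ S.K) ∧ c' = act c k

/-- Equivalent balanced sequences have equivalent projections. -/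
theorem rel_proj (hF : F.PairwiseDisjoint fun f => Set.Icc f.1.1 f.1.2) (hle : ∀ r ∈ R, r.1 ≤ r.2)
    (hu : ∀ r, (v r, u r) ∈ S.N) {c c' : I → G} (hc : Balanced F u c) (hc' : Balanced F u c')
    (h : S.Rel c c') : S.Rel (proj F u c) (proj F u c') := by
  obtain ⟨k, hk, rfl⟩ := h
  exact ⟨proj F u k, fun i => S.conj_mem (prodBefore_mem_N hu _) (hk _),
    (isLift_of_balanced hle hc hc').proj_act hF hle c⟩

/-- The class of a balanced sequence whose projection is normalized by an equivariant map `θ` is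
determined by the classes of its projection and its restrictions to the intervals of `F`. -/
theorem rel_iff_of_normalized (hF : F.PairwiseDisjoint fun f => Set.Icc f.1.1 f.1.2)
    (hle : ∀ r ∈ R, r.1 ≤ r.2) (hu : ∀ r, (v r, u r) ∈ S.N) {V : Set (compl F → G)}
    {θ : (compl F → G) → compl F → G} (hθ : ∀ d ∈ V, ∀ m : compl F → G, (∀ i, m i ∈ S.K) →
      θ (act d m) = fun i => θ d i * m i)
    {c c' : I → G} (hc : Balanced F u c) (hc' : Balanced F u c') (hV : proj F u c ∈ V)
    (h1 : θ (proj F u c) = fun _ => 1) (h1' : θ (proj F u c') = fun _ => 1) :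
    S.Rel c c' ↔ S.Rel (proj F u c) (proj F u c') ∧ ∀ f : F, S.Rel (res f.1 c) (res f.1 c') := by
  constructor
  · rintro ⟨k, hk, rfl⟩
    have hlift := isLift_of_balanced hle hc hc'
    have hkK : ∀ i, proj F u k i ∈ S.K := fun i => S.conj_mem (prodBefore_mem_N hu _) (hk _)
    have h2 := hlift.proj_act hF hle c
    refine ⟨⟨_, hkK, h2⟩, fun f => ⟨res f.1 k, fun i => hk i.1, res_act f.1 c k ?_⟩⟩
    have h3 : ∀ i, proj F u k i = 1 := by
      intro i
      rw [h2, hθ _ hV _ hkK, h1] at h1'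
      have := congrFun h1' i
      rwa [one_mul] at this
    have h4 := hlift.extend_eq hF hle (isStart_fst hF hle f.2)
    rw [show proj F u k = fun _ => 1 from funext h3, extend_one] at h4
    exact conj_eq_one_iff.mp h4.symm
  · rintro ⟨⟨m, hm, h2⟩, h3⟩
    choose k hk hk' using h3
    have h4 : proj F u c' = proj F u c := by
      rw [h2, hθ _ hV _ hm, h1] at h1'
      have : m = fun _ => 1 := funext fun i => by
        have := congrFun h1' i
        rwa [one_mul] at this
      rw [h2, this, act_one]
    have hcompl : ∀ i ∈ compl F, c' i = c i := by
      intro i hi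
      have := congrFun h4 ⟨i, hi⟩
      rw [proj, proj] at this
      exact mul_left_cancel (mul_right_cancel this)
    have hlast : ∀ f : F, ∀ i : Set.Icc f.1.1.1 f.1.1.2, i.1 = f.1.1.2 → k f i = 1 := by
      intro f i hi
      let a : Set.Icc f.1.1.1 f.1.1.2 := ⟨f.1.1.1, le_rfl, hle _ f.1.2⟩
      have ha : pred a = ⊥ := pred_eq_bot.mpr fun j => not_lt.mpr j.2.1
      have h5 := orderedProd_act (res f.1 c) (k f) (a := a) (b := i) i.2.1
      rw [← hk', orderedProd_res, orderedProd_res, ha, extend_bot, hi, hc' _ f.2, hc _ f.2, inv_one,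
        one_mul] at h5
      exact mul_eq_left.mp h5.symm
    obtain ⟨A, -, hA⟩ := exists_assemble hF u
    let K : I → G := A (fun _ => 1, k)
    have hK1 : ∀ i ∈ compl F, K i = 1 := by
      intro i hi
      have := congrFun (hA (fun _ => 1, k)).1 ⟨i, hi⟩
      exact conj_eq_one_iff.mp this
    have hK2 : ∀ f : F, ∀ i : Set.Icc f.1.1.1 f.1.1.2, K i.1 = k f i := by
      intro f i
      exact congrFun ((hA (fun _ => 1, k)).2 f) i
    have hKl : ∀ f ∈ F, f.1.1 ≤ f.1.2 → K f.1.2 = 1 := by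
      intro f hf hf'
      rw [hK2 ⟨f, hf⟩ ⟨f.1.2, hf', le_rfl⟩, hlast ⟨f, hf⟩ _ rfl]
    have hKs : ∀ b, IsStart F b → extend K (pred b) = 1 := by
      intro b hb
      rcases hb.cases with h | ⟨j, hj, h⟩ | ⟨f, hf, hf', h⟩
      · rw [h]; rfl
      · rw [h]; exact hK1 j hj
      · rw [h]; exact hKl f hf hf'
    have hcases : ∀ i, i ∈ compl F ∨ ∃ f : F, i ∈ Set.Icc f.1.1.1 f.1.1.2 := by
      intro i
      by_cases hi : i ∈ compl F
      · exact Or.inl hi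
      · simp only [compl, Set.mem_ofPred_eq, not_forall, not_not] at hi
        obtain ⟨f, hf, h⟩ := hi
        exact Or.inr ⟨⟨f, hf⟩, h⟩
    refine ⟨K, fun i => ?_, funext fun i => ?_⟩
    · rcases hcases i with hi | ⟨f, hi⟩
      · rw [hK1 i hi]; exact one_mem _
      · rw [hK2 f ⟨i, hi⟩]; exact hk f _
    · rcases hcases i with hi | ⟨f, hi⟩
      · rw [act, hKs i (isStart_of_mem_compl hi), hK1 i hi, hcompl i hi]
        group
      · have h6 := res_act f.1 c K (hKs _ (isStart_fst hF hle f.2))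
        have h7 : res f.1 K = k f := funext (hK2 f)
        have h8 : res f.1 c' ⟨i, hi⟩ = res f.1 (act c K) ⟨i, hi⟩ := by rw [hk', h6, h7]
        exact h8

/-- The sequences `C(s,v)`. -/
abbrev Seq (S : CosetSystem G W) (s : I → W) (v : R → W) : Type _ := {c : I → G // S.IsSeq s v c}

theorem gauge_mem (hle : ∀ r ∈ R, r.1 ≤ r.2) (hu : ∀ r, (v r, u r) ∈ S.N) {c : I → G}
    (hc : S.IsSeq s v c) {m : compl F → G} (hm : ∀ i, m i ∈ S.K) {k : I → G}
    (h1 : ∀ i : compl F, k i.1 = (prodBefore F u i.1)⁻¹ * m i * prodBefore F u i.1)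
    (h2 : ∀ f ∈ F, k f.1.2 =
      (orderedProd (Set.Icc f.1.1 f.1.2) c)⁻¹ * extend k (pred f.1.1) * u f)
    (h3 : ∀ i, i ∉ compl F → (∀ f ∈ F, i ≠ f.1.2) → k i = 1) (i : I) : k i ∈ S.K := by
  induction i using WellFoundedLT.induction with
  | ind i ih =>
    by_cases hi : i ∈ compl F
    · rw [h1 ⟨i, hi⟩]
      exact S.inv_mul_mul_mem (prodBefore_mem_N hu _) (prodBefore_mem_N hu _) (hm _)
    · by_cases hl : ∃ f ∈ F, i = f.1.2
      · obtain ⟨f, hf, rfl⟩ := hl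
        rw [h2 f hf]
        refine S.inv_mul_mul_mem (hc.2 f) (hu f) ?_
        cases hj : pred f.1.1 with
        | bot => exact one_mem _
        | coe j => exact ih j ((pred_eq_coe.mp hj).1.trans_le (hle _ f.2))
      · rw [h3 i hi fun f hf h => hl ⟨f, hf, h⟩]
        exact one_mem _

/-- Every sequence is equivalent to a balanced one, which can be chosen continuously. -/
theorem exists_balanced (hF : F.PairwiseDisjoint fun f => Set.Icc f.1.1 f.1.2)
    (hle : ∀ r ∈ R, r.1 ≤ r.2) (hu : ∀ r, (v r, u r) ∈ S.N) :
    ∃ β : S.Seq s v → S.Seq s v, Continuous β ∧ ∀ c, Balanced F u (β c).1 ∧ S.Rel c.1 (β c).1 := by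
  obtain ⟨g, hg, hg1, hg2, hg3⟩ := exists_gauge hF hle u
  have hK : ∀ c : S.Seq s v, ∀ i, g (c.1, fun _ => 1) i ∈ S.K := by
    exact fun c => gauge_mem hle hu c.2 (fun _ => one_mem _) (hg1 _) (hg2 _) (hg3 _)
  refine ⟨fun c => ⟨act c.1 (g (c.1, fun _ => 1)), c.2.act hle (hK c)⟩, ?_, fun c => ⟨?_, ?_⟩⟩
  · refine Continuous.subtype_mk (continuous_iff_continuousAt.mpr fun c => ?_) _
    exact continuousAt_act continuous_subtype_val.continuousAt
      (hg.comp (continuous_subtype_val.prodMk continuous_const)).continuousAt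
  · intro f hf
    rw [orderedProd_act _ _ (hle _ f.2), hg2 _ f hf]
    group
  · exact ⟨_, hK c, rfl⟩

/-- Balanced sequences can be changed so that their projections are changed by a given sequence. -/
theorem exists_act_balanced (hF : F.PairwiseDisjoint fun f => Set.Icc f.1.1 f.1.2)
    (hle : ∀ r ∈ R, r.1 ≤ r.2) (hu : ∀ r, (v r, u r) ∈ S.N) :
    ∃ γ : (I → G) × (compl F → G) → I → G, Continuous γ ∧ ∀ c, S.IsSeq s v c → Balanced F u c →
      ∀ m, (∀ i, m i ∈ S.K) → S.IsSeq s v (γ (c, m)) ∧ Balanced F u (γ (c, m)) ∧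
        S.Rel c (γ (c, m)) ∧ proj F u (γ (c, m)) = act (proj F u c) m := by
  obtain ⟨g, hg, hg1, hg2, hg3⟩ := exists_gauge hF hle u
  refine ⟨fun x => act x.1 (g x), continuous_iff_continuousAt.mpr fun x =>
    continuousAt_act continuous_fst.continuousAt hg.continuousAt, fun c hc hb m hm => ?_⟩
  have hK : ∀ i, g (c, m) i ∈ S.K := gauge_mem hle hu hc hm (hg1 _) (hg2 _) (hg3 _)
  have h1 : ∀ f ∈ F, g (c, m) f.1.2 = (u f)⁻¹ * extend (g (c, m)) (pred f.1.1) * u f := by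
    intro f hf
    rw [hg2 _ f hf, hb f hf]
  refine ⟨hc.act hle hK, (balanced_act_iff hle hb _).mpr h1, ⟨_, hK, rfl⟩, ?_⟩
  refine IsLift.proj_act hF hle ⟨fun i => ?_, h1⟩ c
  rw [hg1]
  group

/-- The projection along `F` and its local triviality, for quotients `B`, `B'`, `B_f` of the spaces
of sequences on `I`, on `I^F` and on the intervals `[f]`. -/
theorem exists_projection {B B' : Type*} {Bf : F → Type*} [TopologicalSpace B]
    [TopologicalSpace B'] [∀ f, TopologicalSpace (Bf f)] (hR : IsNested R)
    (hF : F.PairwiseDisjoint fun f => Set.Icc f.1.1 f.1.2) (hu : ∀ r, (v r, u r) ∈ S.N)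
    {π : S.Seq s v → B} (hπ : IsOpenQuotientMap π) (hπr : ∀ c c', π c = π c' ↔ S.Rel c.1 c'.1)
    {π' : S.Seq (sF F s v) (vF F v) → B'} (hπ' : IsOpenQuotientMap π')
    (hπr' : ∀ c c', π' c = π' c' ↔ S.Rel c.1 c'.1)
    {πf : ∀ f : F, S.Seq (sRes s f.1) (vRes v f.1) → Bf f} (hπf : ∀ f, IsOpenQuotientMap (πf f))
    (hπrf : ∀ f c c', πf f c = πf f c' ↔ S.Rel c.1 c'.1) :
    ∃ p : B → B', (∀ (c : S.Seq s v) (hb : Balanced F u c.1),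
        p (π c) = π' ⟨proj F u c.1, c.2.proj hF hR.le hu hb⟩) ∧
      ∀ b, ∃ e : Bundle.Trivialization (∀ f, Bf f) p, b ∈ e.baseSet := by
  classical
  have hle := hR.le
  obtain ⟨β, hβ, hβ'⟩ := exists_balanced (S := S) (s := s) hF hle hu
  have hπβ : ∀ c, π (β c) = π c := fun c => ((hπr _ _).mpr (hβ' c).2).symm
  let q : S.Seq s v → B' := fun c => π' ⟨proj F u (β c).1, (β c).2.proj hF hle hu (hβ' c).1⟩
  have hproj : Continuous fun c => proj F u (β c).1 :=
    (continuous_proj F u).comp (continuous_subtype_val.comp hβ)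
  have hq : Continuous q := hπ'.continuous.comp (hproj.subtype_mk _)
  have hqb : ∀ c (hb : Balanced F u c.1) c', π c' = π c →
      q c' = π' ⟨proj F u c.1, c.2.proj hF hle hu hb⟩ := by
    intro c hb c' h
    exact (hπr' _ _).mpr (rel_proj hF hle hu (hβ' c').1 hb ((hπr _ _).mp ((hπβ c').trans h)))
  choose rep hrep using hπ.surjective
  let p : B → B' := fun b => q (rep b)
  have hpq : ∀ c, p (π c) = q c := fun c => hqb (β c) (hβ' c).1 _ ((hrep _).trans (hπβ c).symm)
  have hp : Continuous p := by
    rw [← hπ.continuous_comp_iff]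
    exact hq.congr fun c => (hpq c).symm
  refine ⟨p, fun c hb => hqb c hb _ (hrep _), fun b => ?_⟩
  obtain ⟨d₀, hd₀⟩ := hπ'.surjective b
  obtain ⟨V, θ, hV, h₀V, hθ, hθK, hθm⟩ := S.exists_equivariant d₀.2.1
  let V' : Set B' := π' '' {d | d.1 ∈ V}
  have hV' : IsOpen V' := hπ'.isOpenMap _ (hV.preimage continuous_subtype_val)
  have hmemV' : ∀ d, π' d ∈ V' ↔ d.1 ∈ V := by
    intro d
    constructor
    · rintro ⟨d₁, h₁, h⟩
      obtain ⟨m, hm, h₂⟩ := (hπr' _ _).mp h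
      rw [h₂]
      exact (hθm _ h₁ m hm).1
    · exact fun h => ⟨d, h, rfl⟩
  have hθi : ∀ d ∈ V, S.IsSeq (sF F s v) (vF F v) d → ∀ i, (θ d i)⁻¹ ∈ S.K :=
    fun d hd hdS i => inv_mem (hθK d hd hdS.1 i)
  have hθ1 : ∀ d ∈ V, S.IsSeq (sF F s v) (vF F v) d →
      act d (fun i => (θ d i)⁻¹) ∈ V ∧ θ (act d fun i => (θ d i)⁻¹) = fun _ => 1 := by
    intro d hd hdS
    obtain ⟨h1, h2⟩ := hθm d hd _ (hθi d hd hdS)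
    exact ⟨h1, h2.trans (funext fun i => mul_inv_cancel _)⟩
  have hθinv : ∀ d ∈ V, ContinuousAt (fun d i => (θ d i)⁻¹) d := fun d hd =>
    continuousAt_pi.mpr fun i => (continuousAt_pi.mp (hθ d hd) i).inv
  let Ψ : S.Seq s v → B' × ∀ f, Bf f := fun c => (q c, fun f => πf f ⟨res f.1 c.1, c.2.res f.1⟩)
  have hΨ : Continuous Ψ := hq.prodMk (continuous_pi fun f => (hπf f).continuous.comp
    (((continuous_res f.1).comp continuous_subtype_val).subtype_mk _))
  let P : Set (S.Seq s v) :=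
    {c | Balanced F u c.1 ∧ proj F u c.1 ∈ V ∧ θ (proj F u c.1) = fun _ => 1}
  have hP : ∀ c ∈ P, ∀ c' ∈ P, π c = π c' ↔ Ψ c = Ψ c' := by
    rintro c ⟨hb, hcV, h1⟩ c' ⟨hb', -, h1'⟩
    rw [hπr, rel_iff_of_normalized hF hle hu (fun d hd m hm => (hθm d hd m hm).2) hb hb' hcV h1 h1',
      Prod.ext_iff, funext_iff]
    refine and_congr ?_ (forall_congr' fun f => (hπrf f ⟨res f.1 c.1, c.2.res f.1⟩
      ⟨res f.1 c'.1, c'.2.res f.1⟩).symm)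
    change _ ↔ q c = q c'
    rw [hqb c hb c rfl, hqb c' hb' c' rfl, hπr']
  obtain ⟨γ, hγ, hγ'⟩ := exists_act_balanced (S := S) (s := s) hF hle hu
  let ν : S.Seq s v → I → G := fun c =>
    γ ((β c).1, fun i => (θ (proj F u (β c).1) i)⁻¹)
  have hν : ∀ c, proj F u (β c).1 ∈ V → S.IsSeq s v (ν c) ∧ Balanced F u (ν c) ∧
      S.Rel (β c).1 (ν c) ∧
        proj F u (ν c) = act (proj F u (β c).1) fun i => (θ (proj F u (β c).1) i)⁻¹ := fun c hc =>
    hγ' _ (β c).2 (hβ' c).1 _ (hθi _ hc ((β c).2.proj hF hle hu (hβ' c).1))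
  let N : S.Seq s v → S.Seq s v := fun c =>
    if h : proj F u (β c).1 ∈ V then ⟨ν c, (hν c h).1⟩ else c
  have hN : ∀ c, p (π c) ∈ V' → ContinuousAt N c ∧ π (N c) = π c ∧ N c ∈ P := by
    intro c hc
    rw [hpq, hmemV'] at hc
    have hNc : N c = ⟨ν c, (hν c hc).1⟩ := dif_pos hc
    obtain ⟨-, h1, h2, h3⟩ := hν c hc
    refine ⟨?_, ?_, ?_⟩
    · rw [continuousAt_subtype_iff]
      have h4 : ContinuousAt ν c := by
        refine hγ.continuousAt.comp (ContinuousAt.prodMk ?_ ?_)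
        · exact (continuous_subtype_val.comp hβ).continuousAt
        · exact ContinuousAt.comp (g := fun d i => (θ d i)⁻¹) (hθinv _ hc) hproj.continuousAt
      refine h4.congr ?_
      filter_upwards [(hV.preimage hproj).mem_nhds hc] with c' hc'
      exact congrArg Subtype.val (dif_pos hc' : N c' = ⟨ν c', (hν c' hc').1⟩).symm
    · rw [hNc, ← hπβ c, eq_comm, hπr]
      exact h2
    · rw [hNc]
      refine ⟨h1, ?_⟩
      change proj F u (ν c) ∈ V ∧ θ (proj F u (ν c)) = _
      rw [h3]
      exact hθ1 _ hc ((β c).2.proj hF hle hu (hβ' c).1)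
  obtain ⟨A, hA, hA'⟩ := exists_assemble hF u
  choose βf hβf hβf' using fun f : F =>
    exists_balance (S := S) (s := s) f.1 (hle _ f.1.2) hu
  let Y := S.Seq (sF F s v) (vF F v) × ∀ f : F, S.Seq (sRes s f.1) (vRes v f.1)
  let ψ : Y → B' × ∀ f, Bf f := Prod.map π' (Pi.map πf)
  let α : Y → I → G := fun y =>
    A (act y.1.1 fun i => (θ y.1.1 i)⁻¹, fun f => βf f (y.2 f).1)
  have hαp : ∀ y, proj F u (α y) = act y.1.1 fun i => (θ y.1.1 i)⁻¹ := fun y => (hA' _).1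
  have hαr : ∀ y, ∀ f : F, res f.1 (α y) = βf f (y.2 f).1 := fun y f => (hA' _).2 f
  have hαb : ∀ y, Balanced F u (α y) := by
    intro y f hf
    have h1 := (hβf' ⟨f, hf⟩ (y.2 ⟨f, hf⟩).1).1
    rw [← hαr, orderedProd_res] at h1
    exact h1
  have hαrel : ∀ y, ∀ f : F, S.Rel (y.2 f).1 (res f.1 (α y)) := by
    intro y f
    rw [hαr]
    exact (hβf' f _).2 (y.2 f).2
  have hα : ∀ y : Y, y.1.1 ∈ V → S.IsSeq s v (α y) := by
    intro y hy
    refine isSeq_of_proj_of_res hR hF hu (hαb y) ?_ ?_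
    · rw [hαp]
      exact y.1.2.act (isNested_RF F hR).le (hθi _ hy y.1.2)
    · intro f hf
      obtain ⟨k, hk, h⟩ := hαrel y ⟨f, hf⟩
      rw [h]
      exact (y.2 ⟨f, hf⟩).2.act (fun r hr => hle _ hr) hk
  let A' : Y → S.Seq s v := fun y =>
    if h : y.1.1 ∈ V then ⟨α y, hα y h⟩ else ⟨α (d₀, y.2), hα (d₀, y.2) h₀V⟩
  have hA1 : ∀ y, (ψ y).1 ∈ V' → ContinuousAt A' y ∧ Ψ (A' y) = ψ y ∧ A' y ∈ P := by
    intro y hy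
    have hy' : y.1.1 ∈ V := (hmemV' _).mp hy
    have hAy : A' y = ⟨α y, hα y hy'⟩ := dif_pos hy'
    have hcont : Continuous fun y : Y => y.1.1 := continuous_subtype_val.comp continuous_fst
    refine ⟨?_, ?_, ?_⟩
    · rw [continuousAt_subtype_iff]
      have h4 : ContinuousAt α y := by
        refine hA.continuousAt.comp (ContinuousAt.prodMk ?_ ?_)
        · refine continuousAt_act hcont.continuousAt ?_
          exact ContinuousAt.comp (g := fun d i => (θ d i)⁻¹) (hθinv _ hy') hcont.continuousAt
        · exact continuousAt_pi.mpr fun f => ((hβf f).comp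
            (continuous_subtype_val.comp ((continuous_apply f).comp continuous_snd))).continuousAt
      refine h4.congr ?_
      filter_upwards [(hV.preimage hcont).mem_nhds hy'] with y' hy'
      exact congrArg Subtype.val (dif_pos hy' : A' y' = ⟨α y', hα y' hy'⟩).symm
    · rw [hAy]
      refine Prod.ext ?_ (funext fun f => ?_)
      · change q ⟨α y, hα y hy'⟩ = π' y.1
        rw [hqb _ (hαb y) _ rfl, eq_comm, hπr']
        exact ⟨_, hθi _ hy' y.1.2, hαp y⟩
      · exact ((hπrf f _ _).mpr (hαrel y f)).symm
    · rw [hAy]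
      refine ⟨hαb y, ?_⟩
      change proj F u (α y) ∈ V ∧ θ (proj F u (α y)) = _
      rw [hαp]
      exact hθ1 _ hy' y.1.2
  obtain ⟨e, he⟩ := exists_trivialization hπ (hπ'.prodMap (IsOpenQuotientMap.piMap hπf)) hp hV' hΨ
    (fun c => (hpq c).symm) hP hN hA1
  refine ⟨e, ?_⟩
  rw [he, ← hd₀, hmemV']
  exact h₀V

end Quotients

end CosetSystem

/-! ### Bott–Samelson varieties of a Chevalley group -/

namespace ChevalleyData

variable {L : Type*} [LieRing L] [LieAlgebra ℂ L] [FiniteDimensional ℂ L]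
  [LieAlgebra.IsKilling ℂ L] {H : LieSubalgebra ℂ L} [H.IsCartanSubalgebra] {n : ℕ}
  (D : ChevalleyData H n)

/-- The groups `K`, `𝒩` and the sets `C_t` of a Chevalley group. -/
abbrev cosetSystem : CosetSystem (GL (Fin n) ℂ) (Weyl H) where
  K := D.K
  N := D.weylGraph
  Cr := D.Crefl
  one_mem_iff _ := D.coset_one
  Cr_mul := D.Crefl_mul_mem
  mul_Cr := D.mul_mem_Crefl
  conj_Cr := D.conj_mem_Crefl
  exists_local := D.exists_local_retraction

variable {I : Type*} [LinearOrder I] [Finite I] (s : I → Weyl H) {R : Set (I × I)}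
  (v : R → Weyl H)

/-- The quotient map from `C(s,v)` to `BS_c(s,v)`. -/
def toBS (c : D.cosetSystem.Seq s v) : D.BSNested s v :=
  ⟨Quotient.mk (D.orbitSetoid s) ⟨c.1, c.2.1⟩, ⟨c.1, c.2.1⟩, c.2.2, rfl⟩

variable {s} in
theorem mk_eq_mk_iff (c c' : D.CSeq s) :
    Quotient.mk (D.orbitSetoid s) c = Quotient.mk (D.orbitSetoid s) c' ↔
      D.cosetSystem.Rel c.1 c'.1 := by
  rw [Quotient.eq]
  exact exists_congr fun k => and_congr_right fun _ => funext_iff.symm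

theorem toBS_eq_iff (c c' : D.cosetSystem.Seq s v) :
    D.toBS s v c = D.toBS s v c' ↔ D.cosetSystem.Rel c.1 c'.1 := by
  rw [Subtype.ext_iff]
  exact D.mk_eq_mk_iff _ _

theorem isOpenMap_mk : IsOpenMap (Quotient.mk (D.orbitSetoid s)) := by
  intro U hU
  have hmem : ∀ (k : I → GL (Fin n) ℂ), (∀ i, k i ∈ D.K) → ∀ (c : D.CSeq s) (i : I),
      act c.1 k i ∈ D.Crefl (s i) := fun k hk c i =>
    D.Crefl_mul_mem (D.mul_mem_Crefl (inv_mem (extend_mem hk _)) (c.2 i)) (hk i)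
  have h1 : Quotient.mk (D.orbitSetoid s) ⁻¹' (Quotient.mk (D.orbitSetoid s) '' U) =
      ⋃ k : {k : I → GL (Fin n) ℂ // ∀ i, k i ∈ D.K},
        (fun c : D.CSeq s => (⟨act c.1 k.1, hmem k.1 k.2 c⟩ : D.CSeq s)) ⁻¹' U := by
    ext c
    rw [Set.mem_iUnion]
    constructor
    · rintro ⟨c', hc', h⟩
      obtain ⟨k, hk, e⟩ := (D.mk_eq_mk_iff c c').mp h.symm
      refine ⟨⟨k, hk⟩, ?_⟩
      have h2 : (⟨act c.1 k, hmem k hk c⟩ : D.CSeq s) = c' := Subtype.ext e.symm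
      change (⟨act c.1 k, hmem k hk c⟩ : D.CSeq s) ∈ U
      rwa [h2]
    · rintro ⟨k, hk⟩
      exact ⟨_, hk, ((D.mk_eq_mk_iff _ _).mpr ⟨k.1, k.2, rfl⟩).symm⟩
  have h2 : IsOpen (Quotient.mk (D.orbitSetoid s) ⁻¹' (Quotient.mk (D.orbitSetoid s) '' U)) := by
    rw [h1]
    refine isOpen_iUnion fun k => hU.preimage (Continuous.subtype_mk ?_ _)
    exact continuous_iff_continuousAt.mpr fun c =>
      continuousAt_act continuous_subtype_val.continuousAt continuousAt_const
  exact h2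

theorem isOpenQuotientMap_toBS (hle : ∀ r ∈ R, r.1 ≤ r.2) : IsOpenQuotientMap (D.toBS s v) where
  surjective := by
    rintro ⟨_, c, hc, rfl⟩
    exact ⟨⟨c.1, c.2, hc⟩, rfl⟩
  continuous := Continuous.subtype_mk
    (continuous_quotient_mk'.comp (continuous_subtype_val.subtype_mk _)) _
  isOpenMap := by
    rintro _ ⟨U, hU, rfl⟩
    have h1 := D.isOpenMap_mk s _ (hU.preimage continuous_subtype_val)
    convert h1.preimage (continuous_subtype_val (p := fun b => b ∈ D.BSNested s v)) using 1
    ext b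
    constructor
    · rintro ⟨c, hc, rfl⟩
      exact ⟨⟨c.1, c.2.1⟩, hc, rfl⟩
    · rintro ⟨c', hc', h⟩
      obtain ⟨_, c, hc, rfl⟩ := b
      obtain ⟨k, hk, e⟩ := (D.mk_eq_mk_iff c c').mp h.symm
      have h2 : D.cosetSystem.IsSeq s v c'.1 := by
        have h3 : D.cosetSystem.IsSeq s v c.1 := ⟨c.2, hc⟩
        rw [e]
        exact h3.act hle hk
      exact ⟨⟨c'.1, h2⟩, hc', Subtype.ext h⟩

end ChevalleyData

end BottSamelson

end

theorem theorem1 {L : Type*} [LieRing L] [LieAlgebra ℂ L] [FiniteDimensional ℂ L]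
    [LieAlgebra.IsSemisimple ℂ L] {H : LieSubalgebra ℂ L} [H.IsCartanSubalgebra] {n : ℕ}
    (D : BottSamelson.ChevalleyData H n)
    (dot : BottSamelson.Weyl H → GL (Fin n) ℂ) (hdot : ∀ w, dot w ∈ D.coset w)
    {I : Type*} [LinearOrder I] [Finite I]
    (s : I → BottSamelson.Weyl H) (hs : ∀ i, BottSamelson.IsReflection (s i))
    (R : Set (I × I)) (hR : BottSamelson.IsNested R) (v : R → BottSamelson.Weyl H)
    (F : Set R) (hF : F.PairwiseDisjoint fun f => Set.Icc f.1.1 f.1.2) :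
    BottSamelson.IsNested (BottSamelson.RF F) ∧
    (∀ i, BottSamelson.IsReflection (BottSamelson.sF F s v i)) ∧
    (∀ a ∈ D.BSNested s v, ∃ c ∈ D.CNested s v,
      BottSamelson.ChevalleyData.IsBalanced dot F v c.1 ∧
        Quotient.mk (D.orbitSetoid s) c = a) ∧
    ∃ p : D.BSNested s v → D.BSNested (BottSamelson.sF F s v) (BottSamelson.vF F v),
      D.IsProjectionAlong dot s F v p ∧
      (∀ q, D.IsProjectionAlong dot s F v q → q = p) ∧
      ∀ b, ∃ e : Bundle.Trivialization
          ((f : F) → D.BSNested (BottSamelson.sRes s f.1) (BottSamelson.vRes v f.1)) p,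
        b ∈ e.baseSet := by
  have hle := hR.le
  have hu : ∀ r, (v r, dot (v r)) ∈ D.cosetSystem.N := fun r => hdot (v r)
  have hbal : ∀ a ∈ D.BSNested s v, ∃ c ∈ D.CNested s v,
      BottSamelson.ChevalleyData.IsBalanced dot F v c.1 ∧
        Quotient.mk (D.orbitSetoid s) c = a := by
    rintro _ ⟨c, hc, rfl⟩
    obtain ⟨β, -, hβ⟩ :=
      BottSamelson.CosetSystem.exists_balanced (S := D.cosetSystem) (s := s) hF hle hu
    obtain ⟨h1, h2⟩ := hβ ⟨c.1, c.2, hc⟩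
    exact ⟨⟨_, (β ⟨c.1, c.2, hc⟩).2.1⟩, (β ⟨c.1, c.2, hc⟩).2.2, h1,
      ((D.mk_eq_mk_iff _ _).mpr h2).symm⟩
  refine ⟨BottSamelson.isNested_RF F hR, fun i => ?_, hbal, ?_⟩
  · obtain ⟨α, hα⟩ := hs i
    exact ⟨_, by rw [BottSamelson.sF, ← hα, BottSamelson.refl_conj]⟩
  obtain ⟨p, hp, htriv⟩ := BottSamelson.CosetSystem.exists_projection (S := D.cosetSystem) hR hF hu
    (D.isOpenQuotientMap_toBS s v hle) (D.toBS_eq_iff s v)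
    (D.isOpenQuotientMap_toBS _ _ (BottSamelson.isNested_RF F hR).le) (D.toBS_eq_iff _ _)
    (fun f : F => D.isOpenQuotientMap_toBS (BottSamelson.sRes s f.1)
      (BottSamelson.vRes v f.1) fun r hr => hle _ hr)
    (fun f => D.toBS_eq_iff _ _)
  have hpp : D.IsProjectionAlong dot s F v p := by
    intro c hc hb
    exact ⟨_, congrArg Subtype.val (hp ⟨c.1, c.2, hc⟩ hb)⟩
  -- A projection is determined by its values at the classes of balanced sequences.
  refine ⟨p, hpp, fun q hq => funext fun b => Subtype.ext ?_, htriv⟩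
  obtain ⟨a, ha⟩ := b
  obtain ⟨c, hc, hb, rfl⟩ := hbal a ha
  obtain ⟨h1, h2⟩ := hq c hc hb
  obtain ⟨h3, h4⟩ := hpp c hc hb
  rw [h2, h4]
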